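/- Let $\mathbb{T}=\mathbb{R}^d/\ell\mathbb{Z}^d$ with $\ell>0$, let $k\ge 0$ be an integer and let $I$ be a finite set of field indices. For $n\ge 0$ let $\mathcal{C}_k(\mathbb{T}^n)$ be the space of complex functions $f_{a_1\cdots a_n}(x_1,\dots,x_n)$, $x_i\in\mathbb{T}$, $a_i\in I$, that are $k$ times continuously differentiable in each of the variables $x_i$, with the norm $\|f\|_{\mathcal{C}}=\sup|\partial^\alpha f_{a}(x)|$, the supremum being over all points $x$, all indices $a$ and all multi-indices $\alpha$ of order at most $k$ in each $x_i$; let $\mathcal{C}'$ be its dual. Indices are suppressed below: they are summed wherever the variable they belong to is integrated. For $h>0$ let $\mathcal{G}_h$ be the Banach algebra of formal expressions $$F(\psi,\bar\psi)=\sum_{n,m}\frac1{n!m!}\int F_{nm}(x,y)\,\psi(x_1)\cdots\psi(x_n)\bar\psi(y_1)\cdots\bar\psi(y_m)\,dx\,dy$$ in anticommuting fields $\psi,\bar\psi$, with kernels $F_{nm}\in\mathcal{C}'=\mathcal{C}_k(\mathbb{T}^{n+m})'$ anti-symmetric in the $x_i$ and in the $y_j$ separately and $\|F\|_h=\sum_{n,m}\frac{h^{n+m}}{n!m!}\|F_{nm}\|_{\mathcal{C}'}<\infty$.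 Similarly let $\mathcal{G}_{h,h'}$ be the algebra in anticommuting fields $\psi,\bar\psi,J,\bar J$ with kernels $F_{nmkl}$ (of $\psi^n\bar\psi^m J^k\bar J^l$, normalized by $1/(n!m!k!l!)$) and norm $\|F\|_{h,h'}=\sum\frac{h^{n+m}h'^{k+l}}{n!m!k!l!}\|F_{nmkl}\|_{\mathcal{C}'}<\infty$; and regard $\mathcal{G}_{h'}$ as the algebra in $J,\bar J$ alone. Products are given by the anti-symmetrized tensor products of the kernels, and exponentials by their power series. Let $G=(G_{ab})_{a,b\in I}$ be a smooth matrix-valued function on $\mathbb{T}$ with a factorization $G_{ab}(x-y)=\sum_c\int G_{1,ac}(x,z)G_{2,cb}(z,y)\,dz$, where $x\mapsto G_{1,ac}(x,\cdot)$ and $y\mapsto G_{2,cb}(\cdot,y)$ are $k$ times continuously differentiable with values in $L^2(\mathbb{T})$. Put $$h(G)=\sup_{|\alpha|\le k}\{\|\partial^\alpha G_1\|_2,\|\partial^\alpha G_2\|_2\},\qquad \|G\|=\max\Big\{\sup_a\sum_b\int|G_{ab}(x)|dx,\ \sup_b\sum_a\int|G_{ab}(x)|dx\Big\},$$ where $\|\partial^\alpha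 G_1\|_2=\sup_{a,x}\big(\sum_c\int|\partial_x^\alpha G_{1,ac}(x,z)|^2dz\big)^{1/2}$ and $\|\partial^\alpha G_2\|_2=\sup_{b,y}\big(\sum_c\int|\partial_y^\alpha G_{2,cb}(z,y)|^2dz\big)^{1/2}$. The Gaussian integral $\int F(\psi,J)\,d\mu_G(\psi)$ of $F\in\mathcal{G}_{h(G),h'}$ is the element of the algebra in $J,\bar J$ with kernels $\sum_n\frac{(-1)^{n(n-1)/2}}{(n!)^2}\int F_{nnkl}(x,y,z,w)\det\{G(x_i-y_j)\}\,dx\,dy$; equivalently, $\int\psi(x_1)\bar\psi(y_1)\cdots\psi(x_n)\bar\psi(y_n)\,d\mu_G=\det\{G(x_i-y_j)\}$, and monomials with different numbers of $\psi$ and $\bar\psi$ have integral $0$. Write $\langle\bar J,\psi\rangle=\int\bar J(x)\psi(x)dx$, $\langle\bar\psi,J\rangle=\int\bar\psi(x)J(x)dx$, $(GJ)(x)=\int G(x-x')J(x')dx'$, $(\bar JG)(y)=\int\bar J(y')G(y'-y)dy'$, $\langle\bar J,GJ\rangle=\int\bar J(x)(GJ)(x)dx$. Let $h,h'>0$ with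 $h(G)+\|G\|h'<h$ and let $F\in\mathcal{G}_h$. Then $e^{\langle\bar J,\psi\rangle+\langle\bar\psi,J\rangle}F(\psi,\bar\psi)\in\mathcal{G}_{h,h'}$ and $F(\psi+GJ,\bar\psi+\bar JG)\in\mathcal{G}_{h(G),h'}$, the series defining the Gaussian integrals of these two elements converge absolutely when paired with any test function, these two integrals and $e^{\langle\bar J,GJ\rangle}$ are elements of $\mathcal{G}_{h'}$, and in $\mathcal{G}_{h'}$ $$\int e^{\langle\bar J,\psi\rangle+\langle\bar\psi,J\rangle}F(\psi,\bar\psi)\,d\mu_G(\psi)=e^{\langle\bar J,GJ\rangle}\int F(\psi+GJ,\bar\psi+\bar JG)\,d\mu_G(\psi).$$ -/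

import Mathlib

open MeasureTheory
open scoped ENNReal NNReal

noncomputable section

namespace Grassmann

/-! ### The torus, points with a field index, iterated partial derivatives -/

/-- The `d`-dimensional torus `ℝ^d / ℓ ℤ^d`. Its `volume` has total mass `ℓ ^ d`. -/
abbrev Torus (d : ℕ) (ℓ : ℝ) : Type := Fin d → AddCircle ℓ

/-- A point of the torus together with a value of the (spinor and internal) field index. -/
abbrev Pt (ι : Type) (d : ℕ) (ℓ : ℝ) : Type := ι × Torus d ℓ

/-- Derivative at `x` in the direction of the curve `t ↦ x + e t`. -/
def dirDeriv {X E : Type*} [Add X] [NormedAddCommGroup E] [NormedSpace ℝ E]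
    (e : ℝ → X) (g : X → E) (x : X) : E :=
  deriv (fun t : ℝ => g (x + e t)) 0

/-- Iterated derivative `∂_{p₁} ⋯ ∂_{p_r} g` along the word `[p₁, …, p_r]` of directions. -/
def iterDeriv {X E D : Type*} [Add X] [NormedAddCommGroup E] [NormedSpace ℝ E]
    (e : D → ℝ → X) : List D → (X → E) → X → E
  | [], g => g
  | p :: w, g => dirDeriv (e p) (iterDeriv e w g)

/-- All the iterated derivatives of `g` along the words satisfying `A` exist and are continuous
(`A` will be stable under passing from `p :: w` to `w`). -/
def HasContDerivs {X E D : Type*} [Add X] [TopologicalSpace X]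
    [NormedAddCommGroup E] [NormedSpace ℝ E]
    (e : D → ℝ → X) (A : List D → Prop) (g : X → E) : Prop :=
  (∀ w, A w → Continuous (iterDeriv e w g)) ∧
  ∀ p w, A (p :: w) → ∀ x, DifferentiableAt ℝ (fun t : ℝ => iterDeriv e w g (x + e p t)) 0

/-- The coordinate directions on the torus. -/
def dirT (d : ℕ) (ℓ : ℝ) (μ : Fin d) (t : ℝ) : Torus d ℓ := Pi.single μ (t : AddCircle ℓ)

/-- The coordinate directions on a product `𝕋^V` of tori: `(v, μ)` is the `μ`-th coordinate of the
`v`-th variable. -/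
def dirTV (V : Type) [DecidableEq V] (d : ℕ) (ℓ : ℝ) (p : V × Fin d) (t : ℝ) : V → Torus d ℓ :=
  Pi.single p.1 (dirT d ℓ p.2 t)

/-- A word of directions on `𝕋^V` which differentiates *each* of the variables at most `k` times
(so `sup_v ∑_μ α_{v,μ} ≤ k` for the associated multi-index `α`). -/
def AdmWord (k : ℕ) {V : Type} [DecidableEq V] {d : ℕ} (w : List (V × Fin d)) : Prop :=
  ∀ v, (w.map Prod.fst).count v ≤ k

/-! ### The space `𝓒_k` of test functions and its dual -/

/-- Functions of variables `(x_v, a_v)_{v ∈ V}`, with `x_v` in the torus and `a_v` an index. -/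
abbrev TestFn (ι : Type) (d : ℕ) (ℓ : ℝ) (V : Type) : Type := (V → Pt ι d ℓ) → ℂ

/-- The component of `f` with the indices `a`, a function on `𝕋^V`. -/
def comp {ι : Type} {d : ℕ} {ℓ : ℝ} {V : Type} (f : TestFn ι d ℓ V) (a : V → ι) :
    (V → Torus d ℓ) → ℂ :=
  fun x => f (fun v => (a v, x v))

/-- `f ∈ 𝓒_k(𝕋^V)`: `f` is `k` times continuously differentiable in each of its variables. -/
def IsCk (k : ℕ) {ι : Type} {d : ℕ} {ℓ : ℝ} {V : Type} [DecidableEq V]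
    (f : TestFn ι d ℓ V) : Prop :=
  ∀ a, HasContDerivs (dirTV V d ℓ) (AdmWord k) (comp f a)

/-- The norm of `𝓒_k`: the supremum of all derivatives `∂^α f` of order at most `k` in each variable,
over all points and all indices. -/
def ckNorm (k : ℕ) {ι : Type} {d : ℕ} {ℓ : ℝ} {V : Type} [DecidableEq V]
    (f : TestFn ι d ℓ V) : ℝ≥0∞ :=
  ⨆ (a : V → ι) (w : List (V × Fin d)) (_ : AdmWord k w) (x : V → Torus d ℓ),
    ‖iterDeriv (dirTV V d ℓ) w (comp f a) x‖ₑ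

/-- The dual norm `sup { |⟨u, f⟩| : f ∈ 𝓒_k, ‖f‖ ≤ 1 }`. -/
def dualNorm (k : ℕ) {ι : Type} {d : ℕ} {ℓ : ℝ} {V : Type} [DecidableEq V]
    (u : TestFn ι d ℓ V → ℂ) : ℝ≥0∞ :=
  ⨆ (f : TestFn ι d ℓ V) (_ : IsCk k f) (_ : ckNorm k f ≤ 1), ‖u f‖ₑ

/-- `u` is an element of the dual `𝓒_k'`: linear and bounded on `𝓒_k`. Only the values of `u` on
`𝓒_k` are meaningful. -/
structure IsDistr (k : ℕ) {ι : Type} {d : ℕ} {ℓ : ℝ} {V : Type} [DecidableEq V]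
    (u : TestFn ι d ℓ V → ℂ) : Prop where
  map_add : ∀ f g, IsCk k f → IsCk k g → u (f + g) = u f + u g
  map_smul : ∀ (c : ℂ) f, IsCk k f → u (c • f) = c * u f
  bounded : dualNorm k u < ⊤

/-! ### The Grassmann algebra with `q` species of fields -/

/-- The variables of a kernel with `N s` fields of species `s`. -/
abbrev Var {q : ℕ} (N : Fin q → ℕ) : Type := Σ s : Fin q, Fin (N s)

/-- A formal element
`∑_N (∏_s 1 / N_s!) ∫ F_N(x) Ψ_0(x_{0,1}) ⋯ Ψ_0(x_{0,N_0}) Ψ_1(x_{1,1}) ⋯ Ψ_{q-1}(x_{q-1,N_{q-1}}) dx`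
in `q` species of fields, given by its kernels; a kernel is given by its pairing with test functions
`f ↦ ∫ F_N(x) f(x) dx`.
With `q = 2` the fields are `ψ, ψ̄` (or `J, J̄`), with `q = 4` they are `ψ, ψ̄, J, J̄`, in this order. -/
abbrev Elem (ι : Type) (d : ℕ) (ℓ : ℝ) (q : ℕ) : Type :=
  (N : Fin q → ℕ) → TestFn ι d ℓ (Var N) → ℂ

/-- The norm `∑_N (∏_s h_s ^ N_s / N_s!) ‖F_N‖`, with a weight for each of the species. -/
def gNorm (k : ℕ) {ι : Type} {d : ℕ} {ℓ : ℝ} {q : ℕ} (h : Fin q → ℝ≥0∞)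
    (F : Elem ι d ℓ q) : ℝ≥0∞ :=
  ∑' N : Fin q → ℕ, (∏ s, h s ^ N s / ((N s).factorial : ℝ≥0∞)) * dualNorm k (F N)

/-- Permute the variables within each of the species. -/
def permVar {q : ℕ} {N : Fin q → ℕ} (π : (s : Fin q) → Equiv.Perm (Fin (N s))) (v : Var N) : Var N :=
  ⟨v.1, π v.1 v.2⟩

/-- The product of the signs of a family of permutations. -/
def signs {q : ℕ} {N : Fin q → ℕ} (π : (s : Fin q) → Equiv.Perm (Fin (N s))) : ℂ :=
  ∏ s, ((Equiv.Perm.sign (π s) : ℤ) : ℂ)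

/-- Membership in the Banach algebra `𝒢_h`: the kernels are in `𝓒_k'`, they are
anti-symmetric in the variables of each of the species, and the norm is finite. -/
structure MemG (k : ℕ) {ι : Type} {d : ℕ} {ℓ : ℝ} {q : ℕ} (h : Fin q → ℝ≥0∞)
    (F : Elem ι d ℓ q) : Prop where
  distr : ∀ N : Fin q → ℕ, IsDistr k (F N)
  antisymm : ∀ (N : Fin q → ℕ) (π : (s : Fin q) → Equiv.Perm (Fin (N s))) (f : TestFn ι d ℓ (Var N)),
    IsCk k f → F N (fun p => f (fun v => p (permVar π v))) = signs π * F N f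
  norm_lt_top : gNorm k h F < ⊤

/-- Equality of elements: the kernels are equal as distributions. -/
def SameElem (k : ℕ) {ι : Type} {d : ℕ} {ℓ : ℝ} {q : ℕ} (F H : Elem ι d ℓ q) : Prop :=
  ∀ (N : Fin q → ℕ) (f : TestFn ι d ℓ (Var N)), IsCk k f → F N f = H N f

/-- Concatenation, in each of the species, of the variables `p` (`n s` of them) and
`p'` (`N s - n s` of them). -/
def join {q : ℕ} {N n : Fin q → ℕ} {P : Type} (p : Var n → P)
    (p' : Var (fun s => N s - n s) → P) (v : Var N) : P :=
  if h : (v.2 : ℕ) < n v.1 then p ⟨v.1, ⟨v.2, h⟩⟩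
  else p' ⟨v.1, ⟨(v.2 : ℕ) - n v.1, Nat.sub_lt_sub_right (not_lt.mp h) v.2.isLt⟩⟩

/-- The sign in
`(Ψ_0^{n_0} ⋯ Ψ_{q-1}^{n_{q-1}}) (Ψ_0^{n'_0} ⋯ Ψ_{q-1}^{n'_{q-1}})
  = ± (Ψ_0^{n_0} Ψ_0^{n'_0}) ⋯ (Ψ_{q-1}^{n_{q-1}} Ψ_{q-1}^{n'_{q-1}})`. -/
def reorderSign {q : ℕ} (n n' : Fin q → ℕ) : ℂ :=
  ∏ s, ∏ s', if s' < s then (-1) ^ (n' s' * n s) else 1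

/-- The product. The kernel of `F H` in degree `N` is the sum over `n + n' = N` of
`(∏_s N_s! / (n_s! n'_s!))` times the (reordering sign times the) anti-symmetrization
`(∏_s 1 / N_s!) ∑_π sgn π (…)` of the tensor product of `F_n` and `H_{n'}`. -/
def mul {ι : Type} {d : ℕ} {ℓ : ℝ} {q : ℕ} (F H : Elem ι d ℓ q) : Elem ι d ℓ q :=
  fun N f => ∑ n ∈ Finset.Icc 0 N,
    reorderSign n (fun s => N s - n s) *
    (∏ s, (1 / (((n s).factorial : ℂ) * ((N s - n s).factorial : ℂ)))) *
    ∑ π : (s : Fin q) → Equiv.Perm (Fin (N s)), signs π *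
      F n (fun p => H (fun s => N s - n s) (fun p' => f (fun v => join p p' (permVar π v))))

open Classical in
/-- The unit of the algebra: its only kernel is the number `1` in degree `0`. -/
def one (ι : Type) (d : ℕ) (ℓ : ℝ) (q : ℕ) : Elem ι d ℓ q :=
  fun N f => if h : IsEmpty (Var N) then f (fun v => h.elim v) else 0

/-- Powers. -/
def pow {ι : Type} {d : ℕ} {ℓ : ℝ} {q : ℕ} (A : Elem ι d ℓ q) : ℕ → Elem ι d ℓ q
  | 0 => one ι d ℓ q
  | j + 1 => mul A (pow A j)

/-- The exponential `∑_j A ^ j / j!`. It is used for `A` without kernel in degree `0`; then the sum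
has finitely many non-zero terms in each degree. -/
def exp {ι : Type} {d : ℕ} {ℓ : ℝ} {q : ℕ} (A : Elem ι d ℓ q) : Elem ι d ℓ q :=
  fun N f => ∑' j : ℕ, (1 / (j.factorial : ℂ)) * pow A j N f

/-! ### The covariance -/

/-- A function on the torus is smooth. -/
def SmoothT {d : ℕ} {ℓ : ℝ} (g : Torus d ℓ → ℂ) : Prop :=
  ContDiff ℝ ((⊤ : ℕ∞) : WithTop ℕ∞) (fun y : Fin d → ℝ => g (fun μ => (y μ : AddCircle ℓ)))

/-- `‖G‖ = max { sup_a ∑_b ∫ |G_{ab}|, sup_b ∑_a ∫ |G_{ab}| }`. -/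
def covNorm {ι : Type} [Fintype ι] {d : ℕ} {ℓ : ℝ} [Fact (0 < ℓ)]
    (G : ι → ι → Torus d ℓ → ℂ) : ℝ≥0∞ :=
  max (⨆ a, ∑ b, ∫⁻ x, ‖G a b x‖ₑ) (⨆ b, ∑ a, ∫⁻ x, ‖G a b x‖ₑ)

/-- `x ↦ G₁(x, ·)` is `k` times continuously differentiable with values in `L²(𝕋)`. -/
def IsCkL2 (k : ℕ) {d : ℕ} {ℓ : ℝ} [Fact (0 < ℓ)]
    (g : Torus d ℓ → Lp ℂ 2 (volume : Measure (Torus d ℓ))) : Prop :=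
  HasContDerivs (dirT d ℓ) (fun w => w.length ≤ k) g

/-- `h(G) = sup_{|α| ≤ k} { ‖∂^α G₁‖₂, ‖∂^α G₂‖₂ }` for a factorization
`G_{ab}(x, y) = ∑_c ∫ G₁_{ac}(x, z) G₂_{cb}(z, y) dz`.
Here `G₁ a c x` is the function `z ↦ G₁_{ac}(x, z)` and `G₂ c b y` is the function
`z ↦ G₂_{cb}(z, y)`; the derivatives are taken in `x`, respectively `y`; the `L²` norm is taken in
`(c, z)`, and the supremum over the remaining variable. -/
def covH (k : ℕ) {ι : Type} [Fintype ι] {d : ℕ} {ℓ : ℝ} [Fact (0 < ℓ)]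
    (G₁ G₂ : ι → ι → Torus d ℓ → Lp ℂ 2 (volume : Measure (Torus d ℓ))) : ℝ≥0∞ :=
  ⨆ (w : List (Fin d)) (_ : w.length ≤ k) (a : ι) (x : Torus d ℓ),
    max ((∑ c, ‖iterDeriv (dirT d ℓ) w (G₁ a c) x‖ₑ ^ 2) ^ (1 / 2 : ℝ))
      ((∑ c, ‖iterDeriv (dirT d ℓ) w (G₂ c a) x‖ₑ ^ 2) ^ (1 / 2 : ℝ))

/-! ### The Gaussian integral over `ψ, ψ̄` -/

/-- Regard the variables `J, J̄` as the last variables of `ψ, ψ̄, J, J̄`. -/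
def varJ (n : ℕ) (N : Fin 2 → ℕ) : Var N → Var ![n, n, N 0, N 1]
  | ⟨0, i⟩ => ⟨2, i⟩
  | ⟨1, i⟩ => ⟨3, i⟩

/-- The test function `det { G(x_i - y_j) } f(z, w)`. -/
def detTensor {ι : Type} {d : ℕ} {ℓ : ℝ} (G : ι → ι → Torus d ℓ → ℂ) (n : ℕ) (N : Fin 2 → ℕ)
    (f : TestFn ι d ℓ (Var N)) : TestFn ι d ℓ (Var ![n, n, N 0, N 1]) :=
  fun p =>
    Matrix.det (fun i j : Fin n =>
      G (p ⟨0, i⟩).1 (p ⟨1, j⟩).1 ((p ⟨0, i⟩).2 - (p ⟨1, j⟩).2)) *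
    f (fun v => p (varJ n N v))

/-- The `n`-th term of the kernel of `∫ F(ψ, J) dμ_G(ψ)`, paired with `f`. The sign
`ε_n = (-1)^{n(n-1)/2}` is the one in
`ψ(x_1) ψ̄(y_1) ⋯ ψ(x_n) ψ̄(y_n) = ε_n ψ(x_1) ⋯ ψ(x_n) ψ̄(y_1) ⋯ ψ̄(y_n)`,
the left side having the integral `det { G(x_i - y_j) }`. -/
def gaussTerm {ι : Type} {d : ℕ} {ℓ : ℝ} (G : ι → ι → Torus d ℓ → ℂ) (F : Elem ι d ℓ 4)
    (N : Fin 2 → ℕ) (f : TestFn ι d ℓ (Var N)) (n : ℕ) : ℂ :=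
  (-1) ^ (n * (n - 1) / 2) / ((n.factorial : ℂ) * (n.factorial : ℂ)) *
    F ![n, n, N 0, N 1] (detTensor G n N f)

/-- The series defining the kernels of `∫ F(ψ, J) dμ_G(ψ)` converge absolutely. -/
def GaussIntegrable (k : ℕ) {ι : Type} {d : ℕ} {ℓ : ℝ} (G : ι → ι → Torus d ℓ → ℂ)
    (F : Elem ι d ℓ 4) : Prop :=
  ∀ (N : Fin 2 → ℕ) (f : TestFn ι d ℓ (Var N)), IsCk k f → Summable (gaussTerm G F N f)

/-- The Gaussian integral `∫ F(ψ, J) dμ_G(ψ)`, an element of the algebra generated by `J, J̄`. -/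
def gaussInt {ι : Type} {d : ℕ} {ℓ : ℝ} (G : ι → ι → Torus d ℓ → ℂ) (F : Elem ι d ℓ 4) :
    Elem ι d ℓ 2 :=
  fun N f => ∑' n : ℕ, gaussTerm G F N f n

/-! ### The elements and substitutions in the identity -/

/-- `⟨J̄, ψ⟩ = ∑_a ∫ J̄_a(x) ψ_a(x) dx = - ∑_a ∫ ψ_a(x) J̄_a(x) dx`. -/
def pairJbarPsi (ι : Type) [Fintype ι] (d : ℕ) (ℓ : ℝ) [Fact (0 < ℓ)] : Elem ι d ℓ 4 :=
  fun N f => if N = ![1, 0, 0, 1] then -∑ a, ∫ x : Torus d ℓ, f (fun _ => (a, x)) else 0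

/-- `⟨ψ̄, J⟩ = ∑_a ∫ ψ̄_a(x) J_a(x) dx`. -/
def pairPsibarJ (ι : Type) [Fintype ι] (d : ℕ) (ℓ : ℝ) [Fact (0 < ℓ)] : Elem ι d ℓ 4 :=
  fun N f => if N = ![0, 1, 1, 0] then ∑ a, ∫ x : Torus d ℓ, f (fun _ => (a, x)) else 0

/-- `⟨J̄, G J⟩ = ∑_{ab} ∫∫ J̄_a(x) G_{ab}(x - y) J_b(y) dx dy
  = - ∑_{ab} ∫∫ G_{ab}(x - y) J_b(y) J̄_a(x) dx dy`. -/
def pairJbarGJ {ι : Type} [Fintype ι] {d : ℕ} {ℓ : ℝ} [Fact (0 < ℓ)]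
    (G : ι → ι → Torus d ℓ → ℂ) : Elem ι d ℓ 2 :=
  fun N f => if N = ![1, 1] then
    -∑ a, ∑ b, ∫ x : Torus d ℓ, ∫ y : Torus d ℓ,
      G a b (x - y) * f (fun v => if v.1 = 0 then (b, y) else (a, x))
  else 0

/-- `F(ψ, ψ̄)` as an element of the algebra generated by `ψ, ψ̄, J, J̄`. -/
def embed {ι : Type} {d : ℕ} {ℓ : ℝ} (F : Elem ι d ℓ 2) : Elem ι d ℓ 4 :=
  fun N f => if h : N 2 = 0 ∧ N 3 = 0 then
    F ![N 0, N 1] (fun p => f (fun v => match v with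
      | ⟨0, i⟩ => p ⟨0, i⟩
      | ⟨1, i⟩ => p ⟨1, i⟩
      | ⟨2, i⟩ => (Fin.cast h.1 i).elim0
      | ⟨3, i⟩ => (Fin.cast h.2 i).elim0))
  else 0

/-- The position of the variables of `ψ, ψ̄, J, J̄` among the arguments of
`F_{n + k, m + l}(x, z, y, w)`. -/
def varPlus (N : Fin 4 → ℕ) : Var N → Var ![N 0 + N 2, N 1 + N 3]
  | ⟨0, i⟩ => ⟨0, Fin.castAdd (N 2) i⟩
  | ⟨1, i⟩ => ⟨1, Fin.castAdd (N 3) i⟩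
  | ⟨2, i⟩ => ⟨0, Fin.natAdd (N 0) i⟩
  | ⟨3, i⟩ => ⟨1, Fin.natAdd (N 1) i⟩

/-- `F(ψ + J, ψ̄ + J̄)`. The binomial expansion and the anti-symmetry of the kernels give
`∑ 1 / (n! m! k! l!) ∫ F_{n + k, m + l}(x, z, y, w) ψ(x) J(z) ψ̄(y) J̄(w)`, and
`ψ(x) J(z) ψ̄(y) J̄(w) = (-1)^{k m} ψ(x) ψ̄(y) J(z) J̄(w)`. -/
def plus {ι : Type} {d : ℕ} {ℓ : ℝ} (F : Elem ι d ℓ 2) : Elem ι d ℓ 4 :=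
  fun N f => (-1) ^ (N 2 * N 1) *
    F ![N 0 + N 2, N 1 + N 3] (fun p => f (fun v => p (varPlus N v)))

/-- The action on test functions of the substitution `J ↦ G J`, `J̄ ↦ J̄ G`:
`f ↦ ∫ ∏_i G(z_i - z'_i) ∏_j G(w'_j - w_j) f(x, y, z', w') dz' dw'`, the indices being contracted
accordingly. -/
def smear {ι : Type} [Fintype ι] {d : ℕ} {ℓ : ℝ} [Fact (0 < ℓ)]
    (G : ι → ι → Torus d ℓ → ℂ) {N : Fin 4 → ℕ} (f : TestFn ι d ℓ (Var N)) :
    TestFn ι d ℓ (Var N) :=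
  fun p => ∑ b : Fin (N 2) → ι, ∑ c : Fin (N 3) → ι,
    ∫ z : Fin (N 2) → Torus d ℓ, ∫ w : Fin (N 3) → Torus d ℓ,
      (∏ i, G (p ⟨2, i⟩).1 (b i) ((p ⟨2, i⟩).2 - z i)) *
      (∏ j, G (c j) (p ⟨3, j⟩).1 (w j - (p ⟨3, j⟩).2)) *
      f (fun v => match v with
        | ⟨0, i⟩ => p ⟨0, i⟩
        | ⟨1, i⟩ => p ⟨1, i⟩
        | ⟨2, i⟩ => (b i, z i)
        | ⟨3, j⟩ => (c j, w j))

/-- The substitution `J ↦ G J`, `J̄ ↦ J̄ G`, where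
`(G J)_a(x) = ∑_b ∫ G_{ab}(x - x') J_b(x') dx'` and
`(J̄ G)_b(y) = ∑_a ∫ J̄_a(y') G_{ab}(y' - y) dy'`. -/
def substG {ι : Type} [Fintype ι] {d : ℕ} {ℓ : ℝ} [Fact (0 < ℓ)]
    (G : ι → ι → Torus d ℓ → ℂ) (F : Elem ι d ℓ 4) : Elem ι d ℓ 4 :=
  fun N f => F N (smear G f)

/-- `F(ψ + G J, ψ̄ + J̄ G)`. -/
def translate {ι : Type} [Fintype ι] {d : ℕ} {ℓ : ℝ} [Fact (0 < ℓ)]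
    (G : ι → ι → Torus d ℓ → ℂ) (F : Elem ι d ℓ 2) : Elem ι d ℓ 4 :=
  substG G (plus F)

/-- `e^{⟨J̄, ψ⟩ + ⟨ψ̄, J⟩} F(ψ, ψ̄)`. -/
def sourced {ι : Type} [Fintype ι] {d : ℕ} {ℓ : ℝ} [Fact (0 < ℓ)]
    (F : Elem ι d ℓ 2) : Elem ι d ℓ 4 :=
  mul (exp (fun N f => pairJbarPsi ι d ℓ N f + pairPsibarJ ι d ℓ N f)) (embed F)

end Grassmann

end

open MeasureTheory
open scoped ENNReal NNReal

noncomputable section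

set_option linter.unusedSectionVars false

namespace Grassmann

/-! ### Iterated derivatives with a budget of derivatives for each variable -/

/-! Both sides are elements of the algebra in `J, J̄` with anti-symmetric kernels, so it suffices to
compare them on anti-symmetric test functions (`sameElem_of_isAnti`). On these the
anti-symmetrization in a product disappears, leaving binomial coefficients and a reordering sign
(`mul_of_isAnti`). The exponential of a quadratic element `A` is then recognized by the recursion `A
T = (deg / 2) T` (`exp_eq_of_recursion`): the exponential of the sources identifies the points of
`ψ` with those of `J̄` and the points of `ψ̄` with those of `J` (`exp_source_eq`), and `e^{⟨J̄,
GJ⟩}` is integration against a product of covariances (`exp_cov_eq`).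

What remains is combinatorial. In degree `K` in `J` and `L` in `J̄`, the `n`-th Gaussian term of the
left side pairs the kernel `F_{M M'}`, where `L + M = n = K + M'`, with an `n × n` determinant. Its
rows are the `L` points of `J̄` and `M` points `ψ` of the kernel, its columns the `K` points of `J`
and `M'` points `ψ̄` of the kernel. The Leibniz formula gives a sum over bijections from rows to
columns. As `f` and `F` are anti-symmetric, the signed contribution of a bijection depends only on
the number `j` of points `J̄` matched with a `J` (`signedPairInt_eq_of_leftCount_eq`), and the
bijections with given `j` are counted by `card_leftCount_eq`. For fixed `j` the matched pairs form
the degree `(j, j)` of `e^{⟨J̄, GJ⟩}`; the other `K - j` points `J` and `L - j` points `J̄` are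
attached by `G` to arguments of `F`, which is the substitution `F(ψ + GJ, ψ̄ + J̄G)`; the last `m`
arguments of each kind form the determinant of the Gaussian integral on the right
(`ptInt_gaussTerm_translate`). Factorials and signs are matched in `sourced_coeff`, and the sum over
`n = m + (K - j) + L` is taken in `hasSum_sourcedTerm`.

The analysis rests on Gram's inequality (`norm_det_inner_le`). The covariance is an inner product of
Hilbert space valued `C^k` functions, and a derivative in one variable changes just one row or
column of the determinant, so all its derivatives are bounded by `h(G)^{2n}` (`cdb_det`). This is
the weight that the norm gives to `ψ^n ψ̄^n` (`MemG.gaussInt`). The substitution costs a factor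
`‖G‖` for each source field (`ckB_smear`), and the binomial theorem turns this into the weight `h(G)
+ ‖G‖ h'` (`MemG.translate`). The kernels are only distributions; by Hahn-Banach they are
functionals of the jet of a test function (`IsDistr.exists_extension`). Hence they commute with
integrals, and pairing with some of the variables of a test function leaves a test function
(`IsDistr.ckB_pair`). -/

/-- The curves `e p` are continuous one-parameter subgroups. -/
structure IsFlow {X D : Type*} [AddCommGroup X] [TopologicalSpace X] (e : D → ℝ → X) : Prop where
  zero : ∀ p, e p 0 = 0
  add : ∀ p s t, e p (s + t) = e p s + e p t
  cont : ∀ p, Continuous (e p)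

/-- A word of directions which uses each vertex `v` at most `m v` times. -/
def Adm {D V : Type*} [DecidableEq V] (vtx : D → V) (m : V → ℕ) (w : List D) : Prop :=
  ∀ v, (w.map vtx).count v ≤ m v

/-- Lower the budget of the vertex `v` by one. -/
def dec {V : Type*} [DecidableEq V] (m : V → ℕ) (v : V) : V → ℕ :=
  Function.update m v (m v - 1)

/-- The derivatives of `g` along the words within the budget `m` exist, are continuous and are
bounded by `C`. -/
def CDB {X E D V : Type*} [Add X] [TopologicalSpace X] [NormedAddCommGroup E] [NormedSpace ℝ E]
    [DecidableEq V] (e : D → ℝ → X) (vtx : D → V) (m : V → ℕ) (C : ℝ≥0∞) (g : X → E) : Prop :=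
  HasContDerivs e (Adm vtx m) g ∧ ∀ w, Adm vtx m w → ∀ x, ‖iterDeriv e w g x‖ₑ ≤ C

section Basic

variable {X E E' E'' D V : Type*} [AddCommGroup X] [TopologicalSpace X]
  [NormedAddCommGroup E] [NormedSpace ℝ E] [NormedAddCommGroup E'] [NormedSpace ℝ E']
  [NormedAddCommGroup E''] [NormedSpace ℝ E'']
  [DecidableEq V] {e : D → ℝ → X} {vtx : D → V} {m m' : V → ℕ} {C C' : ℝ≥0∞}

/-- The head of a word is the outermost derivative. Peeling off the innermost one instead replaces
`g` by its derivative, which is what an argument about classes of functions closed under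
differentiation needs. -/
theorem iterDeriv_concat (w : List D) (p : D) (g : X → E) :
    iterDeriv e (w ++ [p]) g = iterDeriv e w (dirDeriv (e p) g) := by
  induction w with
  | nil => rfl
  | cons q w ih => simp only [List.cons_append, iterDeriv, ih]

theorem adm_nil : Adm vtx m [] := fun v => by simp

theorem adm_concat {w : List D} {p : D} :
    Adm vtx m (w ++ [p]) ↔ 0 < m (vtx p) ∧ Adm vtx (dec m (vtx p)) w := by
  unfold Adm dec
  constructor
  · intro h
    refine ⟨?_, fun v => ?_⟩
    · have := h (vtx p)
      simp at this
      omega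
    · have := h v
      by_cases hv : v = vtx p
      · subst hv
        simp at this ⊢
        omega
      · simp [Function.update_of_ne hv, Ne.symm hv] at this ⊢
        omega
  · rintro ⟨h0, h⟩ v
    have := h v
    by_cases hv : v = vtx p
    · subst hv
      simp at this ⊢
      omega
    · simp [Function.update_of_ne hv, Ne.symm hv] at this ⊢
      omega

theorem dec_le (m : V → ℕ) (v : V) : dec m v ≤ m := by
  intro u
  unfold dec
  by_cases h : u = v
  · subst h; simp
  · simp [h]

theorem Adm.mono {w : List D} (h : m ≤ m') (hw : Adm vtx m w) : Adm vtx m' w :=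
  fun v => (hw v).trans (h v)

theorem CDB.mono {g : X → E} (hg : CDB e vtx m' C g) (h : m ≤ m') (hC : C ≤ C') :
    CDB e vtx m C' g :=
  ⟨⟨fun w hw => hg.1.1 w (hw.mono h), fun p w hw => hg.1.2 p w (hw.mono h)⟩,
    fun w hw x => (hg.2 w (hw.mono h) x).trans hC⟩

theorem CDB.continuous {g : X → E} (hg : CDB e vtx m C g) : Continuous g := hg.1.1 [] adm_nil

theorem CDB.bound {g : X → E} (hg : CDB e vtx m C g) (x : X) : ‖g x‖ₑ ≤ C := hg.2 [] adm_nil x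

theorem CDB.differentiableAt {g : X → E} (hg : CDB e vtx m C g) {p : D} (hp : 0 < m (vtx p))
    (x : X) : DifferentiableAt ℝ (fun t => g (x + e p t)) 0 :=
  hg.1.2 p [] (adm_concat (w := []).2 ⟨hp, adm_nil⟩) x

theorem CDB.dirDeriv {g : X → E} (hg : CDB e vtx m C g) {p : D} (hp : 0 < m (vtx p)) :
    CDB e vtx (dec m (vtx p)) C (dirDeriv (e p) g) := by
  refine ⟨⟨fun w hw => ?_, fun q w hw x => ?_⟩, fun w hw x => ?_⟩
  · rw [← iterDeriv_concat]
    exact hg.1.1 _ (adm_concat.2 ⟨hp, hw⟩)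
  · rw [← iterDeriv_concat]
    exact hg.1.2 q _ (by rw [← List.cons_append]; exact adm_concat.2 ⟨hp, hw⟩) x
  · rw [← iterDeriv_concat]
    exact hg.2 _ (adm_concat.2 ⟨hp, hw⟩) x

/-- A class of functions with budgets that is stable under differentiation consists of functions
with continuous bounded derivatives. -/
theorem CDB.coind (S : (V → ℕ) → (X → E) → Prop)
    (hS : ∀ m g, S m g → Continuous g ∧ (∀ x, ‖g x‖ₑ ≤ C) ∧ ∀ p, 0 < m (vtx p) →
      (∀ x, DifferentiableAt ℝ (fun t => g (x + e p t)) 0) ∧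
      S (dec m (vtx p)) (Grassmann.dirDeriv (e p) g)) {g : X → E} (hg : S m g) :
    CDB e vtx m C g := by
  -- The induction removes letters at the innermost end, so `m` and `g` have to vary.
  have key : ∀ w : List D, ∀ m g, S m g →
      (Adm vtx m w → Continuous (iterDeriv e w g) ∧ ∀ x, ‖iterDeriv e w g x‖ₑ ≤ C) ∧
      ∀ p, Adm vtx m (p :: w) →
        ∀ x, DifferentiableAt ℝ (fun t : ℝ => iterDeriv e w g (x + e p t)) 0 := by
    intro w
    induction w using List.reverseRecOn with
    | nil =>
      intro m g hg
      refine ⟨fun _ => ⟨(hS m g hg).1, (hS m g hg).2.1⟩, fun p hp x => ?_⟩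
      exact ((hS m g hg).2.2 p (adm_concat (w := []).1 hp).1).1 x
    | append_singleton w q ih =>
      intro m g hg
      rw [iterDeriv_concat]
      refine ⟨fun h => ?_, fun p hp x => ?_⟩
      · obtain ⟨h1, h2⟩ := adm_concat.1 h
        exact (ih _ _ ((hS m g hg).2.2 q h1).2).1 h2
      · rw [← List.cons_append] at hp
        obtain ⟨h1, h2⟩ := adm_concat.1 hp
        exact (ih _ _ ((hS m g hg).2.2 q h1).2).2 p h2 x
  exact ⟨⟨fun w hw => ((key w m g hg).1 hw).1, fun p w hw x => (key w m g hg).2 p hw x⟩,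
    fun w hw x => ((key w m g hg).1 hw).2 x⟩

/-- One-step version of `CDB.coind`, for proofs by induction on the budget: the class consists of
`g` alone and of everything already known to be regular. -/
theorem CDB.of_step {g : X → E} (h1 : Continuous g) (h2 : ∀ x, ‖g x‖ₑ ≤ C)
    (h3 : ∀ p, 0 < m (vtx p) → (∀ x, DifferentiableAt ℝ (fun t => g (x + e p t)) 0) ∧
      CDB e vtx (dec m (vtx p)) C (Grassmann.dirDeriv (e p) g)) : CDB e vtx m C g := by
  refine CDB.coind (S := fun m' g' => (m' = m ∧ g' = g) ∨ CDB e vtx m' C g') ?_ (Or.inl ⟨rfl, rfl⟩)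
  rintro m' g' (⟨rfl, rfl⟩ | h)
  · exact ⟨h1, h2, fun p hp => ⟨(h3 p hp).1, Or.inr (h3 p hp).2⟩⟩
  · exact ⟨h.continuous, h.bound, fun p hp => ⟨h.differentiableAt hp, Or.inr (h.dirDeriv hp)⟩⟩

theorem hasDerivAt_zero_of_differentiableAt {g : X → E} {p : D} {x : X}
    (h : DifferentiableAt ℝ (fun t => g (x + e p t)) 0) :
    HasDerivAt (fun t => g (x + e p t)) (Grassmann.dirDeriv (e p) g x) 0 := h.hasDerivAt

/-- Differentiability is only assumed at parameter `0`; the group law of the flow moves it to every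
`t`. -/
theorem IsFlow.hasDerivAt (he : IsFlow e) {g : X → E} {p : D}
    (h : ∀ x, DifferentiableAt ℝ (fun t => g (x + e p t)) 0) (x : X) (t : ℝ) :
    HasDerivAt (fun t => g (x + e p t)) (Grassmann.dirDeriv (e p) g (x + e p t)) t := by
  have h1 := hasDerivAt_zero_of_differentiableAt (h (x + e p t))
  have h2 : HasDerivAt (fun s => s - t) 1 t := (hasDerivAt_id t).sub_const t
  rw [← sub_self t] at h1
  have h3 := HasDerivAt.scomp (h := fun s => s - t) t h1 h2
  simp only [one_smul] at h3
  refine h3.congr_of_eventuallyEq (Filter.Eventually.of_forall fun s => ?_)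
  simp only [Function.comp]
  rw [add_assoc, ← he.add]
  simp

theorem CDB.zero : CDB e vtx m C (fun _ : X => (0 : E)) := by
  refine CDB.coind (S := fun _ g => g = fun _ => 0) ?_ rfl
  rintro m g rfl
  refine ⟨continuous_const, fun x => by simp, fun p _ => ⟨fun x => differentiableAt_const _, ?_⟩⟩
  funext x
  simp [Grassmann.dirDeriv]

theorem CDB.add {f g : X → E} (hf : CDB e vtx m C f) (hg : CDB e vtx m C' g) :
    CDB e vtx m (C + C') (fun x => f x + g x) := by
  refine CDB.coind (S := fun m h => ∃ f g, CDB e vtx m C f ∧ CDB e vtx m C' g ∧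
    h = fun x => f x + g x) ?_ ⟨f, g, hf, hg, rfl⟩
  rintro m _ ⟨f, g, hf, hg, rfl⟩
  refine ⟨hf.continuous.add hg.continuous, fun x => (enorm_add_le _ _).trans
    (add_le_add (hf.bound x) (hg.bound x)), fun p hp => ⟨fun x =>
    (hf.differentiableAt hp x).add (hg.differentiableAt hp x), _, _, hf.dirDeriv hp,
    hg.dirDeriv hp, ?_⟩⟩
  funext x
  exact ((hasDerivAt_zero_of_differentiableAt (hf.differentiableAt hp x)).add
    (hasDerivAt_zero_of_differentiableAt (hg.differentiableAt hp x))).deriv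

theorem CDB.clm_comp {f : X → E} (hf : CDB e vtx m C f) (T : E →L[ℝ] E') :
    CDB e vtx m (‖T‖ₑ * C) (fun x => T (f x)) := by
  refine CDB.coind (S := fun m h => ∃ f, CDB e vtx m C f ∧ h = fun x => T (f x)) ?_ ⟨f, hf, rfl⟩
  rintro m _ ⟨f, hf, rfl⟩
  refine ⟨T.continuous.comp hf.continuous, fun x => (T.le_opENorm _).trans (by gcongr; exact hf.bound x),
    fun p hp => ⟨fun x => T.differentiableAt.comp (0 : ℝ) (hf.differentiableAt hp x), _, hf.dirDeriv hp, ?_⟩⟩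
  funext x
  exact (T.hasFDerivAt.comp_hasDerivAt (0 : ℝ)
    (hasDerivAt_zero_of_differentiableAt (hf.differentiableAt hp x))).deriv

theorem sum_dec_lt [Fintype V] {v : V} (hv : 0 < m v) : ∑ u, dec m v u < ∑ u, m u := by
  refine Finset.sum_lt_sum (fun u _ => dec_le m v u) ⟨v, Finset.mem_univ _, ?_⟩
  simp [dec]; omega

/-- The Leibniz rule gives two terms of the same shape with a smaller total budget. The constants it
produces are not tracked: the bound is `⊤`, and only regularity is asserted. -/
theorem CDB.bilin [Fintype V] {f : X → E} {g : X → E'} (he : IsFlow e)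
    (hf : CDB e vtx m ⊤ f) (hg : CDB e vtx m ⊤ g)
    (B : E →L[ℝ] E' →L[ℝ] E'') : CDB e vtx m ⊤ (fun x => B (f x) (g x)) := by
  induction hM : ∑ v, m v using Nat.strong_induction_on generalizing m f g with
  | _ M ih =>
  refine CDB.of_step (B.isBoundedBilinearMap.continuous.comp (hf.continuous.prodMk hg.continuous))
    (fun x => le_top) fun p hp => ?_
  have key : ∀ x, HasDerivAt (fun t => B (f (x + e p t)) (g (x + e p t)))
      (B (f x) (Grassmann.dirDeriv (e p) g x) + B (Grassmann.dirDeriv (e p) f x) (g x)) 0 := by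
    intro x
    have := B.hasFDerivAt_of_bilinear
      (hasDerivAt_zero_of_differentiableAt (hf.differentiableAt hp x)).hasFDerivAt
      (hasDerivAt_zero_of_differentiableAt (hg.differentiableAt hp x)).hasFDerivAt
    have := this.hasDerivAt
    simpa [he.zero] using this
  refine ⟨fun x => (key x).differentiableAt, ?_⟩
  have h2 : Grassmann.dirDeriv (e p) (fun x => B (f x) (g x)) = fun x =>
      B (f x) (Grassmann.dirDeriv (e p) g x) + B (Grassmann.dirDeriv (e p) f x) (g x) :=
    funext fun x => (key x).deriv
  rw [h2]
  have hlt := sum_dec_lt hp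
  exact ((ih _ (hM ▸ hlt) (hf.mono (dec_le _ _) le_rfl) (hg.dirDeriv hp) rfl).add
    (ih _ (hM ▸ hlt) (hf.dirDeriv hp) (hg.mono (dec_le _ _) le_rfl) rfl)).mono le_rfl le_top

/-- `g` does not depend on the directions whose vertex is in `S`. -/
def Indep (e : D → ℝ → X) (vtx : D → V) (S : Set V) (g : X → E) : Prop :=
  ∀ p, vtx p ∈ S → ∀ x t, g (x + e p t) = g x

theorem Indep.dirDeriv {S : Set V} {g : X → E} (hg : Indep e vtx S g) (q : D) :
    Indep e vtx S (Grassmann.dirDeriv (e q) g) := by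
  intro p hp x t
  unfold Grassmann.dirDeriv
  congr 1
  funext s
  rw [add_right_comm]
  exact hg p hp _ _

/-- The factors depend on complementary sets of variables, so each derivative hits only one of them.
No Leibniz constants arise and the bounds simply multiply. -/
theorem CDB.tensor {f g : X → ℂ} {S : Set V}
    (hf : CDB e vtx m C f) (hg : CDB e vtx m C' g)
    (hfS : Indep e vtx S f) (hgS : Indep e vtx Sᶜ g) :
    CDB e vtx m (C * C') (fun x => f x * g x) := by
  refine CDB.coind (S := fun m h => ∃ f g, CDB e vtx m C f ∧ CDB e vtx m C' g ∧
    Indep e vtx S f ∧ Indep e vtx Sᶜ g ∧ h = fun x => f x * g x) ?_ ⟨f, g, hf, hg, hfS, hgS, rfl⟩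
  rintro m _ ⟨f, g, hf, hg, hfS, hgS, rfl⟩
  refine ⟨hf.continuous.mul hg.continuous, fun x => ?_, fun p hp => ?_⟩
  · rw [enorm_mul]
    exact mul_le_mul' (hf.bound x) (hg.bound x)
  · refine ⟨fun x => (hf.differentiableAt hp x).mul (hg.differentiableAt hp x), ?_⟩
    by_cases hpS : vtx p ∈ S
    · refine ⟨f, _, hf.mono (dec_le _ _) le_rfl, hg.dirDeriv hp, hfS, hgS.dirDeriv p, ?_⟩
      funext x
      have := (hasDerivAt_zero_of_differentiableAt (hg.differentiableAt hp x)).const_mul (f x)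
      rw [← this.deriv]
      simp only [Grassmann.dirDeriv, hfS p hpS]
    · refine ⟨_, g, hf.dirDeriv hp, hg.mono (dec_le _ _) le_rfl, hfS.dirDeriv p, hgS, ?_⟩
      funext x
      have := (hasDerivAt_zero_of_differentiableAt (hf.differentiableAt hp x)).mul_const (g x)
      rw [← this.deriv]
      simp only [Grassmann.dirDeriv, hgS p hpS]

end Basic

section Comp

variable {X X' E D D' V V' : Type*} [AddCommGroup X] [TopologicalSpace X]
  [AddCommGroup X'] [TopologicalSpace X'] [NormedAddCommGroup E] [NormedSpace ℝ E]
  [DecidableEq V] [DecidableEq V'] {e : D → ℝ → X} {vtx : D → V} {m : V → ℕ}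
  {e' : D' → ℝ → X'} {vtx' : D' → V'} {m' : V' → ℕ} {C : ℝ≥0∞}

/-- Composition with a map `J` that takes each direction to a direction or collapses it. -/
theorem CDB.comp_map {g : X → E} (hg : CDB e vtx m C g) (J : X' → X) (hJ : Continuous J)
    (τ : V → Option V') (hm : ∀ v v', τ v = some v' → m' v' ≤ m v)
    (hdir : ∀ p', (∃ p, τ (vtx p) = some (vtx' p') ∧ ∀ x t, J (x + e' p' t) = J x + e p t) ∨
      ∀ x t, J (x + e' p' t) = J x) :
    CDB e' vtx' m' C (fun x => g (J x)) := by
  -- The zero function is admitted to the class because a derivative in a collapsed direction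
  -- vanishes.
  refine CDB.coind (S := fun m' h => (h = fun _ => 0) ∨ ∃ g m, (∀ v v', τ v = some v' → m' v' ≤ m v) ∧
    CDB e vtx m C g ∧ h = fun x => g (J x)) ?_ (Or.inr ⟨g, m, hm, hg, rfl⟩)
  rintro m' _ (rfl | ⟨g, m, hm, hg, rfl⟩)
  · refine ⟨continuous_const, fun x => by simp, fun p _ => ⟨fun x => differentiableAt_const _, Or.inl ?_⟩⟩
    funext x
    simp [Grassmann.dirDeriv]
  · refine ⟨hg.continuous.comp hJ, fun x => hg.bound _, fun p' hp' => ?_⟩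
    obtain ⟨p, hp, hJp⟩ | h0 := hdir p'
    · have hpos : 0 < m (vtx p) := lt_of_lt_of_le hp' (hm _ _ hp)
      refine ⟨fun x => ?_, Or.inr ⟨Grassmann.dirDeriv (e p) g, dec m (vtx p), ?_, hg.dirDeriv hpos, ?_⟩⟩
      · simp only [hJp]
        exact hg.differentiableAt hpos _
      · intro v v' hv
        by_cases h : v = vtx p
        · subst h
          rw [hp, Option.some.injEq] at hv
          subst hv
          have := hm _ _ hp
          simp [dec]
          omega
        · refine (dec_le _ _ _).trans ?_
          rw [dec, Function.update_of_ne h]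
          exact hm _ _ hv
      · funext x
        simp only [Grassmann.dirDeriv, hJp]
    · refine ⟨fun x => ?_, Or.inl ?_⟩
      · simp only [h0]
        exact differentiableAt_const _
      · funext x
        simp [Grassmann.dirDeriv, h0]

end Comp

/-! ### Differentiation under the integral sign -/

section Param

variable {X Z D V : Type*} [AddCommGroup X] [TopologicalSpace X] [AddCommGroup Z]
  [TopologicalSpace Z] [DecidableEq V] {e : D → ℝ → X} {vtx : D → V} {m : V → ℕ} {C : ℝ≥0∞}

/-- The directions of `X` as directions of `Z × X`. -/
def sndDir (Z : Type*) [Zero Z] {X D : Type*} (e : D → ℝ → X) (p : D) (t : ℝ) : Z × X := (0, e p t)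

theorem iterDeriv_sndDir (g : Z × X → ℂ) (w : List D) (z : Z) (x : X) :
    iterDeriv (sndDir Z e) w g (z, x) = iterDeriv e w (fun x => g (z, x)) x := by
  induction w generalizing x with
  | nil => rfl
  | cons p w ih =>
    simp only [iterDeriv, dirDeriv, sndDir, Prod.mk_add_mk, add_zero]
    congr 1
    funext t
    exact ih _

theorem CDB.slice {g : Z × X → ℂ} (hg : CDB (sndDir Z e) vtx m C g) (z : Z) :
    CDB e vtx m C (fun x => g (z, x)) :=
  hg.comp_map (fun x => (z, x)) (by fun_prop) some (fun v v' h => by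
    rw [Option.some.injEq] at h; rw [h]) fun p => Or.inl ⟨p, rfl, fun x t => by simp [sndDir]⟩

variable [FirstCountableTopology X] [MeasurableSpace Z] [OpensMeasurableSpace Z] {μ : Measure Z}
  {ρ : Z → ℂ}

/-- A finite `C` makes `‖ρ‖ C` an integrable majorant of the integrand and of its derivative. -/
theorem CDB.hasDerivAt_integral (he : IsFlow e) (hρ : Integrable ρ μ) {g : Z × X → ℂ} (hC : C ≠ ⊤)
    (hg : CDB (sndDir Z e) vtx m C g) {p : D} (hp : 0 < m (vtx p)) (x : X) :
    HasDerivAt (fun t => ∫ z, ρ z * g (z, x + e p t) ∂μ)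
      (∫ z, ρ z * Grassmann.dirDeriv (sndDir Z e p) g (z, x) ∂μ) 0 := by
  have hd : ∀ z t, HasDerivAt (fun t => g (z, x + e p t))
      (Grassmann.dirDeriv (sndDir Z e p) g (z, x + e p t)) t := by
    intro z t
    have := he.hasDerivAt (g := fun x => g (z, x)) (fun y => (hg.slice z).differentiableAt hp y) x t
    have h2 := iterDeriv_sndDir (e := e) g [p] z (x + e p t)
    simp only [iterDeriv] at h2
    rwa [h2]
  have hgd := hg.dirDeriv hp
  have hmeas : ∀ (G : Z × X → ℂ), Continuous G → ∀ y, AEStronglyMeasurable (fun z => ρ z * G (z, y)) μ :=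
    fun G hG y => hρ.aestronglyMeasurable.mul
      (hG.comp (by fun_prop : Continuous fun z : Z => (z, y))).aestronglyMeasurable
  have hb : ∀ {G : Z × X → ℂ}, (∀ y, ‖G y‖ₑ ≤ C) → ∀ y, ‖G y‖ ≤ C.toReal := fun hG y => by
    rw [← toReal_enorm]
    exact ENNReal.toReal_mono hC (hG y)
  have := (hasDerivAt_integral_of_dominated_loc_of_deriv_le (μ := μ) (𝕜 := ℝ)
    (F := fun t z => ρ z * g (z, x + e p t))
    (F' := fun t z => ρ z * Grassmann.dirDeriv (sndDir Z e p) g (z, x + e p t)) (x₀ := 0)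
    (bound := fun z => ‖ρ z‖ * C.toReal) (s := Set.univ) Filter.univ_mem
    (Filter.Eventually.of_forall fun t => hmeas g hg.continuous _) ?_ (hmeas _ hgd.continuous _) ?_
    (hρ.norm.mul_const _) ?_).2
  · simpa [he.zero] using this
  · refine (hρ.norm.mul_const C.toReal).mono' (hmeas g hg.continuous _)
      (Filter.Eventually.of_forall fun z => ?_)
    rw [norm_mul]
    gcongr
    exact hb hg.bound _
  · refine Filter.Eventually.of_forall fun z t _ => ?_
    rw [norm_mul]
    gcongr
    exact hb hgd.bound _
  · exact Filter.Eventually.of_forall fun z t _ => (hd z t).const_mul _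

/-- Differentiating the integral only replaces `g` by its derivative, so one `L¹` estimate bounds
all orders. -/
theorem CDB.integral (he : IsFlow e) (hρ : Integrable ρ μ) {g : Z × X → ℂ} (hC : C ≠ ⊤)
    (hg : CDB (sndDir Z e) vtx m C g) :
    CDB e vtx m ((∫⁻ z, ‖ρ z‖ₑ ∂μ) * C) (fun x => ∫ z, ρ z * g (z, x) ∂μ) := by
  refine CDB.coind (S := fun m h => ∃ g : Z × X → ℂ, CDB (sndDir Z e) vtx m C g ∧
    h = fun x => ∫ z, ρ z * g (z, x) ∂μ) ?_ ⟨g, hg, rfl⟩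
  rintro m _ ⟨g, hg, rfl⟩
  refine ⟨?_, fun x => ?_, fun p hp => ⟨fun x =>
    (hg.hasDerivAt_integral he hρ hC hp x).differentiableAt, _, hg.dirDeriv hp, ?_⟩⟩
  · refine continuous_of_dominated (bound := fun z => ‖ρ z‖ * C.toReal) (fun x => ?_) (fun x => ?_)
      (hρ.norm.mul_const _) ?_
    · exact hρ.aestronglyMeasurable.mul
        (hg.continuous.comp (by fun_prop : Continuous fun z : Z => (z, x))).aestronglyMeasurable
    · refine Filter.Eventually.of_forall fun z => ?_
      rw [norm_mul]
      gcongr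
      rw [← toReal_enorm]
      exact ENNReal.toReal_mono hC (hg.bound _)
    · refine Filter.Eventually.of_forall fun z => ?_
      exact continuous_const.mul (hg.continuous.comp (by fun_prop : Continuous fun x : X => (z, x)))
  · refine (enorm_integral_le_lintegral_enorm _).trans ?_
    rw [← lintegral_mul_const'' _ hρ.aestronglyMeasurable.enorm]
    refine lintegral_mono fun z => ?_
    rw [enorm_mul]
    gcongr
    exact hg.bound _
  · funext x
    exact (hg.hasDerivAt_integral he hρ hC hp x).deriv

theorem CDB.iterDeriv_integral (he : IsFlow e) (hρ : Integrable ρ μ) {g : Z × X → ℂ} (hC : C ≠ ⊤)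
    (hg : CDB (sndDir Z e) vtx m C g) {w : List D} (hw : Adm vtx m w) (x : X) :
    iterDeriv e w (fun x => ∫ z, ρ z * g (z, x) ∂μ) x =
      ∫ z, ρ z * iterDeriv (sndDir Z e) w g (z, x) ∂μ := by
  induction w using List.reverseRecOn generalizing m g with
  | nil => rfl
  | append_singleton w q ih =>
    obtain ⟨h1, h2⟩ := adm_concat.1 hw
    rw [iterDeriv_concat, iterDeriv_concat, ← ih (hg.dirDeriv h1) h2]
    congr 1
    funext x
    exact (hg.hasDerivAt_integral he hρ hC h1 x).deriv

end Param

/-! ### Test functions, distributions, and integrals of test functions -/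

section TestFunctions

variable {ι : Type} {d k : ℕ} {ℓ : ℝ} {V : Type} [DecidableEq V] {C C' : ℝ≥0∞}

theorem isFlow_dirTV : IsFlow (dirTV V d ℓ) where
  zero p := by simp [dirTV, dirT]
  add p s t := by simp [dirTV, dirT, Pi.single_add]
  cont p := by
    have h : Continuous fun t : ℝ => dirT d ℓ p.2 t :=
      (continuous_single p.2).comp (AddCircle.continuous_mk' ℓ)
    exact (continuous_single p.1).comp h

/-- `f ∈ 𝓒_k` and its norm is at most `C`. -/
def CkB (k : ℕ) (C : ℝ≥0∞) (f : TestFn ι d ℓ V) : Prop :=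
  ∀ a, CDB (dirTV V d ℓ) Prod.fst (fun _ => k) C (comp f a)

theorem CkB.isCk {f : TestFn ι d ℓ V} (h : CkB k C f) : IsCk k f := fun a => (h a).1

theorem CkB.ckNorm_le {f : TestFn ι d ℓ V} (h : CkB k C f) : ckNorm k f ≤ C :=
  iSup_le fun a => iSup_le fun w => iSup_le fun hw => iSup_le fun x => (h a).2 w hw x

theorem IsCk.ckB {f : TestFn ι d ℓ V} (h : IsCk k f) : CkB k (ckNorm k f) f := fun a =>
  ⟨h a, fun w hw x => le_iSup_of_le a <| le_iSup_of_le w <| le_iSup_of_le hw <|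
    le_iSup (fun x => ‖iterDeriv (dirTV V d ℓ) w (comp f a) x‖ₑ) x⟩

theorem IsCk.ckB_top {f : TestFn ι d ℓ V} (h : IsCk k f) : CkB k ⊤ f :=
  fun a => (h.ckB a).mono le_rfl le_top

theorem CkB.mono {f : TestFn ι d ℓ V} (h : CkB k C f) (hC : C ≤ C') : CkB k C' f :=
  fun a => (h a).mono le_rfl hC

/-- The length of a word is the sum of the counts of its variables, hence at most `k` times their
number. -/
theorem finite_admWord [Finite V] : Finite {w : List (V × Fin d) // AdmWord k w} := by
  have := Fintype.ofFinite V
  refine ((List.finite_length_le (V × Fin d) (∑ _v : V, k)).subset fun w hw => ?_).to_subtype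
  have h : (w.map Prod.fst).length = ∑ v, (w.map Prod.fst).count v := by
    simpa using (Multiset.sum_count_eq_card (s := Finset.univ)
      (m := ((w.map Prod.fst : List V) : Multiset V)) (by simp)).symm
  rw [List.length_map] at h
  simp only [Set.mem_ofPred_eq, h]
  exact Finset.sum_le_sum fun v _ => hw v

/-- The norm is a supremum over finitely many words and indices, and each derivative is continuous
on a compact torus. -/
theorem IsCk.ckNorm_lt_top [Finite ι] [Finite V] [Fact (0 < ℓ)] {f : TestFn ι d ℓ V}
    (h : IsCk k f) : ckNorm k f < ⊤ := by
  have hW : Finite {w : List (V × Fin d) // AdmWord k w} := finite_admWord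
  have : ∀ i : (V → ι) × {w : List (V × Fin d) // AdmWord k w}, ∃ M : ℝ≥0,
      ∀ x, ‖iterDeriv (dirTV V d ℓ) i.2.1 (comp f i.1) x‖ₑ ≤ M := by
    intro i
    have hc := (h i.1).1 i.2.1 i.2.2
    obtain ⟨M, hM⟩ := (isCompact_univ.image (continuous_nnnorm.comp hc)).bddAbove
    refine ⟨M, fun x => ?_⟩
    rw [enorm_eq_nnnorm, ENNReal.coe_le_coe]
    exact hM ⟨x, trivial, rfl⟩
  choose M hM using this
  obtain ⟨B, hB⟩ := (Set.finite_range M).bddAbove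
  refine lt_of_le_of_lt ?_ (ENNReal.coe_lt_top (r := B))
  exact iSup_le fun a => iSup_le fun w => iSup_le fun hw => iSup_le fun x =>
    (hM (a, ⟨w, hw⟩) x).trans (ENNReal.coe_le_coe.2 (hB ⟨_, rfl⟩))

theorem CkB.zero : CkB k C (0 : TestFn ι d ℓ V) := fun _ => CDB.zero

theorem CkB.add {f g : TestFn ι d ℓ V} (hf : CkB k C f) (hg : CkB k C' g) :
    CkB k (C + C') (f + g) := fun a => (hf a).add (hg a)

theorem CkB.smul {f : TestFn ι d ℓ V} (hf : CkB k C f) (c : ℂ) : CkB k (‖c‖ₑ * C) (c • f) := by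
  intro a
  have := (hf a).clm_comp (c • ContinuousLinearMap.id ℝ ℂ)
  refine this.mono le_rfl ?_
  gcongr
  rw [enorm_smul]
  calc ‖c‖ₑ * ‖ContinuousLinearMap.id ℝ ℂ‖ₑ ≤ ‖c‖ₑ * 1 := by
        gcongr
        rw [← ofReal_norm]
        simp
    _ = _ := mul_one _

theorem CkB.sum {α : Type*} (s : Finset α) {f : α → TestFn ι d ℓ V} {C : α → ℝ≥0∞}
    (hf : ∀ i ∈ s, CkB k (C i) (f i)) : CkB k (∑ i ∈ s, C i) (∑ i ∈ s, f i) := by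
  classical
  induction s using Finset.induction_on with
  | empty => exact CkB.zero
  | insert i s his ih =>
    rw [Finset.sum_insert his, Finset.sum_insert his]
    exact (hf i (Finset.mem_insert_self _ _)).add (ih fun j hj => hf j (Finset.mem_insert_of_mem hj))

theorem IsCk.add {f g : TestFn ι d ℓ V} (hf : IsCk k f) (hg : IsCk k g) : IsCk k (f + g) :=
  (hf.ckB.add hg.ckB).isCk

theorem IsCk.smul {f : TestFn ι d ℓ V} (hf : IsCk k f) (c : ℂ) : IsCk k (c • f) :=
  (hf.ckB.smul c).isCk

theorem IsCk.sum {α : Type*} (s : Finset α) {f : α → TestFn ι d ℓ V}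
    (hf : ∀ i ∈ s, IsCk k (f i)) : IsCk k (∑ i ∈ s, f i) :=
  (CkB.sum s fun i hi => (hf i hi).ckB).isCk

theorem IsCk.mul [Fintype V] {f g : TestFn ι d ℓ V} (hf : IsCk k f) (hg : IsCk k g) :
    IsCk k (fun p => f p * g p) :=
  CkB.isCk (C := ⊤) fun a =>
    CDB.bilin isFlow_dirTV (hf.ckB_top a) (hg.ckB_top a) (ContinuousLinearMap.mul ℝ ℂ)

theorem isCk_const (c : ℂ) : IsCk k (fun _ => c : TestFn ι d ℓ V) := by
  refine CkB.isCk (C := ⊤) fun a => CDB.of_step continuous_const (fun _ => le_top) fun p _ => ?_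
  refine ⟨fun x => differentiableAt_const _, ?_⟩
  have h : dirDeriv (dirTV V d ℓ p) (comp (fun _ => c : TestFn ι d ℓ V) a) = fun _ => 0 := by
    funext x
    simp [dirDeriv, comp]
  rw [h]
  exact CDB.zero

theorem IsCk.prod [Fintype V] {α : Type*} (s : Finset α) {f : α → TestFn ι d ℓ V}
    (hf : ∀ i ∈ s, IsCk k (f i)) : IsCk k (fun p => ∏ i ∈ s, f i p) := by
  classical
  induction s using Finset.induction_on with
  | empty => simpa using isCk_const 1
  | insert i s his ih =>
    simp only [Finset.prod_insert his]
    exact (hf i (Finset.mem_insert_self _ _)).mul (ih fun j hj => hf j (Finset.mem_insert_of_mem hj))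

variable {P Q : Type} [DecidableEq P] [DecidableEq Q]

theorem update_single_comp {T : Type*} [AddGroup T] (e : V → P) (he : Function.Injective e) (v : V) (t : T)
    (x : P → T) : (fun u => (x + Pi.single (e v) t : P → T) (e u)) = (fun u => x (e u)) + Pi.single v t := by
  funext u
  by_cases h : u = v
  · subst h; simp
  · simp [h, he.ne h]

/-- Relabelling of the variables, possibly with dummy variables. -/
theorem CkB.comp_inj {f : TestFn ι d ℓ V} (hf : CkB k C f) {e : V → P} (he : Function.Injective e) :
    CkB k C (fun p => f (fun v => p (e v))) := by
  classical
  intro a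
  refine (hf fun v => a (e v)).comp_map (fun (x : P → Torus d ℓ) v => x (e v)) (by fun_prop) (fun v => some (e v))
    (fun _ _ _ => le_rfl) fun p => ?_
  by_cases h : ∃ v, e v = p.1
  · obtain ⟨v, hv⟩ := h
    refine Or.inl ⟨(v, p.2), by simp [hv], fun x t => ?_⟩
    rw [dirTV, dirTV, ← hv]
    exact update_single_comp e he v _ x
  · refine Or.inr fun x t => ?_
    funext v
    simp [dirTV, Pi.single_eq_of_ne (fun hv => h ⟨v, hv⟩ : e v ≠ p.1)]

theorem IsCk.comp_inj {f : TestFn ι d ℓ V} (hf : IsCk k f) {e : V → P} (he : Function.Injective e) :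
    IsCk k (fun p => f (fun v => p (e v))) := (hf.ckB.comp_inj he).isCk

/-- Fixing some of the variables. -/
theorem CkB.fix {f : TestFn ι d ℓ V} (hf : CkB k C f) {e : V → P ⊕ Q} (he : Function.Injective e)
    (q : Q → Pt ι d ℓ) : CkB k C (fun p => f (fun v => Sum.elim p q (e v))) := by
  intro a
  have h1 := hf.comp_inj he (Sum.elim a fun j => (q j).1)
  have h2 : CDB (dirTV P d ℓ) Prod.fst (fun _ => k) C (fun x : P → Torus d ℓ =>
      comp (fun p => f (fun v => p (e v))) (Sum.elim a fun j => (q j).1)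
        (Sum.elim x fun j => (q j).2)) := by
    refine h1.comp_map (fun x : P → Torus d ℓ => Sum.elim x fun j => (q j).2) ?_
      (Sum.elim some fun _ => none) (fun _ _ _ => le_rfl)
      fun p => Or.inl ⟨(Sum.inl p.1, p.2), rfl, fun x t => ?_⟩
    · refine continuous_pi fun v => ?_
      cases v
      · exact continuous_apply _
      · exact continuous_const
    · funext v
      rcases v with v | v
      · by_cases h : v = p.1
        · subst h; simp [dirTV]
        · simp [dirTV, h]
      · simp [dirTV]
  convert h2 using 1
  funext x
  simp only [comp]
  congr 1
  funext v
  rcases e v with v | v <;> rfl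

theorem IsCk.fix {f : TestFn ι d ℓ V} (hf : IsCk k f) {e : V → P ⊕ Q} (he : Function.Injective e)
    (q : Q → Pt ι d ℓ) : IsCk k (fun p => f (fun v => Sum.elim p q (e v))) := (hf.ckB.fix he q).isCk

end TestFunctions

/-! ### Distributions as continuous functionals of jets -/

section Distributions

variable {ι : Type} [Fintype ι] {d k : ℕ} {ℓ : ℝ} [Fact (0 < ℓ)] {V : Type} [Fintype V]
  [DecidableEq V] {C : ℝ≥0∞} {u : TestFn ι d ℓ V → ℂ}

theorem IsDistr.map_zero (hu : IsDistr k u) : u 0 = 0 := by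
  have := hu.map_smul 0 0 (CkB.zero (C := 0)).isCk
  simpa using this

theorem IsDistr.map_sum (hu : IsDistr k u) {α : Type*} (s : Finset α) {f : α → TestFn ι d ℓ V}
    (hf : ∀ i ∈ s, IsCk k (f i)) : u (∑ i ∈ s, f i) = ∑ i ∈ s, u (f i) := by
  classical
  induction s using Finset.induction_on with
  | empty => simpa using hu.map_zero
  | insert i s his ih =>
    have h2 : ∀ j ∈ s, IsCk k (f j) := fun j hj => hf j (Finset.mem_insert_of_mem hj)
    rw [Finset.sum_insert his, Finset.sum_insert his, hu.map_add _ _ (hf i (Finset.mem_insert_self _ _))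
      (IsCk.sum s h2), ih h2]

theorem IsDistr.map_sub (hu : IsDistr k u) {f g : TestFn ι d ℓ V} (hf : IsCk k f) (hg : IsCk k g) :
    u (f - g) = u f - u g := by
  have : f - g = f + (-1 : ℂ) • g := by ext; simp [sub_eq_add_neg]
  rw [this, hu.map_add _ _ hf (hg.smul _), hu.map_smul _ _ hg]
  ring

/-- Rescaling to the unit ball. The case of norm zero is separate; there the empty word shows that
`f` vanishes. -/
theorem IsDistr.enorm_le (hu : IsDistr k u) {f : TestFn ι d ℓ V} (hf : IsCk k f) :
    ‖u f‖ₑ ≤ dualNorm k u * ckNorm k f := by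
  by_cases h0 : ckNorm k f = 0
  · have : f = 0 := by
      funext p
      have := (hf.ckB (fun v => (p v).1)).bound (fun v => (p v).2)
      rw [h0] at this
      simpa [comp] using this
    rw [this, hu.map_zero]
    simp
  · set c := ckNorm k f with hc
    have hct : c ≠ ⊤ := hf.ckNorm_lt_top.ne
    have hcr : c.toReal ≠ 0 := by simp [ENNReal.toReal_eq_zero_iff, h0, hct]
    have h1 : CkB k 1 (((c.toReal⁻¹ : ℝ) : ℂ) • f) := by
      refine (hf.ckB.smul _).mono ?_
      rw [← hc, ← ofReal_norm, Complex.norm_real, norm_inv, Real.norm_of_nonneg ENNReal.toReal_nonneg,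
        ENNReal.ofReal_inv_of_pos (lt_of_le_of_ne ENNReal.toReal_nonneg hcr.symm), ENNReal.ofReal_toReal hct,
        ENNReal.inv_mul_cancel h0 hct]
    have h2 : ‖u (((c.toReal⁻¹ : ℝ) : ℂ) • f)‖ₑ ≤ dualNorm k u :=
      le_iSup_of_le _ <| le_iSup_of_le h1.isCk <| le_iSup (fun _ => ‖u (((c.toReal⁻¹ : ℝ) : ℂ) • f)‖ₑ) h1.ckNorm_le
    rw [hu.map_smul _ _ hf, enorm_mul, ← ofReal_norm, Complex.norm_real, norm_inv, Real.norm_of_nonneg ENNReal.toReal_nonneg,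
        ENNReal.ofReal_inv_of_pos (lt_of_le_of_ne ENNReal.toReal_nonneg hcr.symm), ENNReal.ofReal_toReal hct] at h2
    calc ‖u f‖ₑ = c⁻¹ * ‖u f‖ₑ * c := by
          rw [mul_right_comm, ENNReal.inv_mul_cancel h0 hct, one_mul]
      _ ≤ _ := by gcongr

theorem dualNorm_le {u : TestFn ι d ℓ V → ℂ} {M : ℝ≥0∞}
    (h : ∀ f, IsCk k f → ‖u f‖ₑ ≤ M * ckNorm k f) : dualNorm k u ≤ M :=
  iSup_le fun f => iSup_le fun hf => iSup_le fun h1 => (h f hf).trans <| by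
    calc M * ckNorm k f ≤ M * 1 := by gcongr
      _ = M := mul_one M

/-- The derivatives of a test function, as a family of continuous functions. -/
def jet (k : ℕ) (f : TestFn ι d ℓ V) (hf : IsCk k f) :
    ({w : List (V × Fin d) // AdmWord k w} × (V → ι)) → C(V → Torus d ℓ, ℂ) :=
  fun i => ⟨iterDeriv (dirTV V d ℓ) i.1.1 (comp f i.2), (hf i.2).1 _ i.1.2⟩

instance : Fintype {w : List (V × Fin d) // AdmWord k w} :=
  have := finite_admWord (V := V) (d := d) (k := k)
  Fintype.ofFinite _

theorem iterDeriv_add_comp {f g : TestFn ι d ℓ V} (hf : IsCk k f) (hg : IsCk k g) (a : V → ι)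
    {w : List (V × Fin d)} (hw : AdmWord k w) :
    iterDeriv (dirTV V d ℓ) w (comp (f + g) a) = fun x =>
      iterDeriv (dirTV V d ℓ) w (comp f a) x + iterDeriv (dirTV V d ℓ) w (comp g a) x := by
  induction w with
  | nil => rfl
  | cons p w ih =>
    have hw' : AdmWord k w := fun v => le_trans (by simp [List.count_cons]) (hw v)
    rw [iterDeriv, ih hw']
    funext x
    exact ((hasDerivAt_zero_of_differentiableAt ((hf a).2 p w hw x)).add
      (hasDerivAt_zero_of_differentiableAt ((hg a).2 p w hw x))).deriv

theorem iterDeriv_smul_comp {f : TestFn ι d ℓ V} (hf : IsCk k f) (c : ℂ) (a : V → ι)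
    {w : List (V × Fin d)} (hw : AdmWord k w) :
    iterDeriv (dirTV V d ℓ) w (comp (c • f) a) = fun x =>
      c * iterDeriv (dirTV V d ℓ) w (comp f a) x := by
  induction w with
  | nil => rfl
  | cons p w ih =>
    have hw' : AdmWord k w := fun v => le_trans (by simp [List.count_cons]) (hw v)
    rw [iterDeriv, ih hw']
    funext x
    exact ((hasDerivAt_zero_of_differentiableAt ((hf a).2 p w hw x)).const_mul c).deriv

variable (ι d k ℓ V) in
/-- The space `𝓒_k`. -/
def ckSubmodule : Submodule ℂ (TestFn ι d ℓ V) where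
  carrier := {f | IsCk k f}
  add_mem' hf hg := hf.add hg
  zero_mem' := (CkB.zero (C := 0)).isCk
  smul_mem' c _ hf := hf.smul c

variable (ι d k ℓ V) in
/-- The derivatives of a test function, as a linear map. -/
def jetₗ : ckSubmodule ι d k ℓ V →ₗ[ℂ]
    (({w : List (V × Fin d) // AdmWord k w} × (V → ι)) → C(V → Torus d ℓ, ℂ)) where
  toFun f := jet k f.1 f.2
  map_add' f g := by
    funext i; ext x
    exact congrFun (iterDeriv_add_comp f.2 g.2 i.2 i.1.2) x
  map_smul' c f := by
    funext i; ext x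
    exact congrFun (iterDeriv_smul_comp f.2 c i.2 i.1.2) x

theorem ckNorm_le_jet {f : TestFn ι d ℓ V} (hf : IsCk k f) : ckNorm k f ≤ ‖jet k f hf‖ₑ := by
  refine iSup_le fun a => iSup_le fun w => iSup_le fun hw => iSup_le fun x => ?_
  rw [← ofReal_norm, ← ofReal_norm]
  refine ENNReal.ofReal_le_ofReal ?_
  exact ((jet k f hf (⟨w, hw⟩, a)).norm_coe_le_norm x).trans (norm_le_pi_norm (jet k f hf) (⟨w, hw⟩, a))

/-- Through the injection `j` the functional becomes bounded on the range of `j`, and Hahn-Banach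
extends it to all of `W`. -/
theorem _root_.LinearMap.exists_strongDual_factor {S W : Type*} [AddCommGroup S] [Module ℂ S]
    [NormedAddCommGroup W] [NormedSpace ℂ W] (j : S →ₗ[ℂ] W) (hj : Function.Injective j)
    (φ : S →ₗ[ℂ] ℂ) (M : ℝ) (h : ∀ s, ‖φ s‖ ≤ M * ‖j s‖) :
    ∃ U : StrongDual ℂ W, ∀ s, φ s = U (j s) := by
  let E := LinearEquiv.ofInjective j hj
  let ψ : StrongDual ℂ (LinearMap.range j) :=
    (φ ∘ₗ E.symm.toLinearMap).mkContinuous M (by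
      intro y
      obtain ⟨f, rfl⟩ := E.surjective y
      simpa [E] using h f)
  obtain ⟨U, hU, -⟩ := exists_extension_norm_eq _ ψ
  refine ⟨U, fun f => ?_⟩
  have h2 := hU (E f)
  have h3 : ψ (E f) = φ f := by simp [ψ]
  rw [← h3, ← h2]
  rfl

/-- A distribution is a continuous linear functional of the derivatives. -/
theorem IsDistr.exists_extension (hu : IsDistr k u) :
    ∃ U : StrongDual ℂ (({w : List (V × Fin d) // AdmWord k w} × (V → ι)) → C(V → Torus d ℓ, ℂ)),
      ∀ f (hf : IsCk k f), u f = U (jet k f hf) := by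
  -- The component of the jet along the empty word is the function itself.
  have hinj : Function.Injective (jetₗ ι d k ℓ V) := by
    intro f g hfg
    ext p
    have := congrFun hfg (⟨[], fun v => by simp⟩, fun v => (p v).1)
    exact congrArg (fun h : C(V → Torus d ℓ, ℂ) => h (fun v => (p v).2)) this
  let φ : ckSubmodule ι d k ℓ V →ₗ[ℂ] ℂ :=
    { toFun := fun f => u f.1
      map_add' := fun f g => hu.map_add _ _ f.2 g.2
      map_smul' := fun c f => hu.map_smul _ _ f.2 }
  obtain ⟨U, hU⟩ := LinearMap.exists_strongDual_factor (jetₗ ι d k ℓ V) hinj φ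
    (dualNorm k u).toReal (by
      intro f
      have h1 := (hu.enorm_le f.2).trans (mul_le_mul_right (ckNorm_le_jet f.2) _)
      have h2 := ENNReal.toReal_mono (ENNReal.mul_ne_top hu.bounded.ne enorm_ne_top) h1
      rw [ENNReal.toReal_mul, toReal_enorm, toReal_enorm] at h2
      exact h2)
  exact ⟨U, fun f hf => hU ⟨f, hf⟩⟩

variable {Z : Type*} [AddCommGroup Z] [TopologicalSpace Z]

/-- The test function `g(z, ·)`. -/
def slice (g : (V → ι) → Z × (V → Torus d ℓ) → ℂ) (z : Z) : TestFn ι d ℓ V :=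
  fun p => g (fun v => (p v).1) (z, fun v => (p v).2)

theorem ckB_slice {g : (V → ι) → Z × (V → Torus d ℓ) → ℂ}
    (hg : ∀ a, CDB (sndDir Z (dirTV V d ℓ)) Prod.fst (fun _ => k) C (g a)) (z : Z) :
    CkB k C (slice g z) := fun a => (hg a).slice z

/-- Joint continuity of the derivatives in the parameter and the point curries to continuity into
`C(V → Torus d ℓ, ℂ)`, whose topology is that of the supremum norm since the torus is compact. -/
theorem continuous_jet_slice {g : (V → ι) → Z × (V → Torus d ℓ) → ℂ}
    (hg : ∀ a, CDB (sndDir Z (dirTV V d ℓ)) Prod.fst (fun _ => k) C (g a)) :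
    Continuous fun z => jet k (slice g z) (ckB_slice hg z).isCk := by
  refine continuous_pi fun i => ?_
  let G : C(Z × (V → Torus d ℓ), ℂ) :=
    ⟨iterDeriv (sndDir Z (dirTV V d ℓ)) i.1.1 (g i.2), (hg i.2).1.1 _ i.1.2⟩
  convert G.curry.continuous using 1
  funext z
  ext x
  exact (iterDeriv_sndDir (g i.2) i.1.1 z x).symm

theorem IsDistr.continuous_slice (hu : IsDistr k u) {g : (V → ι) → Z × (V → Torus d ℓ) → ℂ}
    (hg : ∀ a, CDB (sndDir Z (dirTV V d ℓ)) Prod.fst (fun _ => k) C (g a)) :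
    Continuous fun z => u (slice g z) := by
  obtain ⟨U, hU⟩ := hu.exists_extension
  simp only [fun z => hU _ (ckB_slice hg z).isCk]
  exact U.continuous.comp (continuous_jet_slice hg)

variable [MeasurableSpace Z] [OpensMeasurableSpace Z] [SecondCountableTopology Z] {μ : Measure Z} {ρ : Z → ℂ}

theorem ckB_integral (hρ : Integrable ρ μ) (hC : C ≠ ⊤) {g : (V → ι) → Z × (V → Torus d ℓ) → ℂ}
    (hg : ∀ a, CDB (sndDir Z (dirTV V d ℓ)) Prod.fst (fun _ => k) C (g a)) :
    CkB k ((∫⁻ z, ‖ρ z‖ₑ ∂μ) * C) (fun p => ∫ z, ρ z * slice g z p ∂μ) :=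
  fun a => (hg a).integral isFlow_dirTV hρ hC

/-- A distribution commutes with integrals. -/
theorem IsDistr.map_integral (hu : IsDistr k u) (hρ : Integrable ρ μ) (hC : C ≠ ⊤)
    {g : (V → ι) → Z × (V → Torus d ℓ) → ℂ}
    (hg : ∀ a, CDB (sndDir Z (dirTV V d ℓ)) Prod.fst (fun _ => k) C (g a)) :
    u (fun p => ∫ z, ρ z * slice g z p ∂μ) = ∫ z, ρ z * u (slice g z) ∂μ := by
  obtain ⟨U, hU⟩ := hu.exists_extension
  rw [hU _ (ckB_integral hρ hC hg).isCk]
  simp only [fun z => hU _ (ckB_slice hg z).isCk]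
  set Φ := fun z => jet k (slice g z) (ckB_slice hg z).isCk with hΦ
  have hΦc : Continuous Φ := continuous_jet_slice hg
  have hΦb : ∀ z, ‖Φ z‖ ≤ C.toReal := by
    intro z
    refine (pi_norm_le_iff_of_nonneg ENNReal.toReal_nonneg).2 fun i => ?_
    refine (ContinuousMap.norm_le _ ENNReal.toReal_nonneg).2 fun x => ?_
    rw [← toReal_enorm]
    exact ENNReal.toReal_mono hC ((ckB_slice hg z i.2).2 _ i.1.2 x)
  have hint : Integrable (fun z => ρ z • Φ z) μ := by
    refine (hρ.norm.mul_const C.toReal).mono' (hρ.aestronglyMeasurable.smul hΦc.aestronglyMeasurable)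
      (Filter.Eventually.of_forall fun z => ?_)
    rw [norm_smul]
    gcongr
    exact hΦb z
  -- The jet of the integral is the Bochner integral of the jets: evaluation at a component and a
  -- point is continuous and linear, and the derivatives pass under the scalar integral.
  have h1 : jet k (fun p => ∫ z, ρ z * slice g z p ∂μ) (ckB_integral hρ hC hg).isCk
      = ∫ z, ρ z • Φ z ∂μ := by
    funext i
    ext x
    have h2 := ((ContinuousMap.evalCLM ℂ x).comp (ContinuousLinearMap.proj i)).integral_comp_comm hint
    have h3 : (∫ z, ρ z • Φ z ∂μ) i x = ∫ z, ρ z * (Φ z i x) ∂μ := by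
      simpa using h2.symm
    rw [h3]
    refine ((hg i.2).iterDeriv_integral isFlow_dirTV hρ hC i.1.2 x).trans ?_
    refine integral_congr_ae (Filter.Eventually.of_forall fun z => ?_)
    exact congrArg (ρ z * ·) (iterDeriv_sndDir (g i.2) i.1.1 z x)
  rw [h1, ← U.integral_comp_comm hint]
  simp [hΦ]

end Distributions

/-! ### Pairing a distribution with some of the variables of a test function -/

/-- The signed indicator function of the interval between `0` and `t`. -/
def signedIndicator (t s : ℝ) : ℂ :=
  (Set.Ioc 0 t).indicator (fun _ => 1) s - (Set.Ioc t 0).indicator (fun _ => 1) s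

theorem integrable_signedIndicator (t : ℝ) : Integrable (signedIndicator t) := by
  refine Integrable.sub ?_ ?_ <;>
  · refine (integrable_indicator_iff measurableSet_Ioc).2 ?_
    exact integrableOn_const (by simp)

/-- Brings an oriented interval integral into the form required by `IsDistr.map_integral`: an
integral over the whole line with an integrable weight. -/
theorem integral_signedIndicator_mul {φ : ℝ → ℂ} (hφ : Continuous φ) (t : ℝ) :
    ∫ s, signedIndicator t s * φ s = ∫ s in (0 : ℝ)..t, φ s := by
  have h : ∀ s, signedIndicator t s * φ s
      = (Set.Ioc 0 t).indicator φ s - (Set.Ioc t 0).indicator φ s := by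
    intro s
    simp only [signedIndicator, Set.indicator]
    split_ifs <;> ring
  have hi : ∀ a b : ℝ, Integrable ((Set.Ioc a b).indicator φ) := fun a b =>
    (integrable_indicator_iff measurableSet_Ioc).2
      ((hφ.integrableOn_Icc (a := a) (b := b)).mono_set Set.Ioc_subset_Icc_self)
  simp only [h]
  rw [integral_sub (hi _ _) (hi _ _), integral_indicator measurableSet_Ioc,
    integral_indicator measurableSet_Ioc, intervalIntegral]

theorem dec_sumElim {P Q : Type*} [DecidableEq P] [DecidableEq Q] (m : P → ℕ) (m' : Q → ℕ) (v : P) :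
    dec (Sum.elim m m') (Sum.inl v) = Sum.elim (dec m v) m' := by
  funext u
  rcases u with u | u
  · by_cases h : u = v
    · subst h; simp [dec]
    · simp [dec, h]
  · simp [dec]

section Partial

variable {ι : Type} [Fintype ι] {d k : ℕ} {ℓ : ℝ} [Fact (0 < ℓ)] {V P Q : Type}
  [Fintype V] [DecidableEq V] [Fintype P] [DecidableEq P] [Fintype Q] [DecidableEq Q] {C : ℝ≥0∞}
  {u : TestFn ι d ℓ Q → ℂ}

theorem sumElim_add_dirTV_inl (p : P × Fin d) (x : P → Torus d ℓ) (y : Q → Torus d ℓ) (t : ℝ) :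
    Sum.elim (x + dirTV P d ℓ p t) y = Sum.elim x y + dirTV (P ⊕ Q) d ℓ (Sum.inl p.1, p.2) t := by
  funext v
  rcases v with v | v
  · by_cases h : v = p.1
    · subst h; simp [dirTV]
    · simp [dirTV, h]
  · simp [dirTV]

theorem sumElim_add_dirTV_inr (q : Q × Fin d) (x : P → Torus d ℓ) (y : Q → Torus d ℓ) (t : ℝ) :
    Sum.elim x (y + dirTV Q d ℓ q t) = Sum.elim x y + dirTV (P ⊕ Q) d ℓ (Sum.inr q.1, q.2) t := by
  funext v
  rcases v with v | v
  · simp [dirTV]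
  · by_cases h : v = q.1
    · subst h; simp [dirTV]
    · simp [dirTV, h]

theorem continuous_sumElim {Z : Type*} [TopologicalSpace Z] {T : Type*} [TopologicalSpace T] {f : Z → P → T} {g : Z → Q → T}
    (hf : Continuous f) (hg : Continuous g) : Continuous fun z => (Sum.elim (f z) (g z) : P ⊕ Q → T) := by
  refine continuous_pi fun v => ?_
  rcases v with v | v
  · exact (continuous_apply v).comp hf
  · exact (continuous_apply v).comp hg

/-- Let the variables in `P` be functions of a parameter. -/
theorem CDB.param_left {Z : Type*} [AddCommGroup Z] [TopologicalSpace Z] {m : P → ℕ}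
    {g : (P ⊕ Q → Torus d ℓ) → ℂ}
    (hg : CDB (dirTV (P ⊕ Q) d ℓ) Prod.fst (Sum.elim m fun _ => k) C g) {θ : Z → P → Torus d ℓ}
    (hθ : Continuous θ) :
    CDB (sndDir Z (dirTV Q d ℓ)) Prod.fst (fun _ => k) C
      (fun zy : Z × (Q → Torus d ℓ) => g (Sum.elim (θ zy.1) zy.2)) := by
  refine hg.comp_map (fun zy : Z × (Q → Torus d ℓ) => Sum.elim (θ zy.1) zy.2)
    (continuous_sumElim (hθ.comp continuous_fst) continuous_snd)
    (Sum.elim (fun _ => none) some) ?_ fun q => Or.inl ⟨(Sum.inr q.1, q.2), rfl, fun x t => ?_⟩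
  · rintro (v | v) v' h
    · simp at h
    · simp
  · rw [← sumElim_add_dirTV_inr]
    simp [sndDir]

/-- A derivative in a variable of `P` passes to `g`, which stays in the class with a lowered budget
in `P` and the full budget `k` in `Q`. Hence `u` can be applied to every derivative of `g` with the
same bound. -/
theorem IsDistr.cdb_pair (hu : IsDistr k u) (hC : C ≠ ⊤) {m : P → ℕ}
    {g : (Q → ι) → (P ⊕ Q → Torus d ℓ) → ℂ}
    (hg : ∀ a, CDB (dirTV (P ⊕ Q) d ℓ) Prod.fst (Sum.elim m fun _ => k) C (g a)) :
    CDB (dirTV P d ℓ) Prod.fst m (dualNorm k u * C) (fun x : P → Torus d ℓ =>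
      u fun p' => g (fun v => (p' v).1) (Sum.elim x fun v => (p' v).2)) := by
  refine CDB.coind (S := fun m h => ∃ g : (Q → ι) → (P ⊕ Q → Torus d ℓ) → ℂ,
    (∀ a, CDB (dirTV (P ⊕ Q) d ℓ) Prod.fst (Sum.elim m fun _ => k) C (g a)) ∧
    h = fun x : P → Torus d ℓ => u fun p' => g (fun v => (p' v).1) (Sum.elim x fun v => (p' v).2))
    ?_ ⟨g, hg, rfl⟩
  rintro m _ ⟨g, hg, rfl⟩
  have hck : ∀ {m : P → ℕ} {g : (Q → ι) → (P ⊕ Q → Torus d ℓ) → ℂ}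
      (_ : ∀ a, CDB (dirTV (P ⊕ Q) d ℓ) Prod.fst (Sum.elim m fun _ => k) C (g a)) (x : P → Torus d ℓ),
      CkB k C (fun p' => g (fun v => (p' v).1) (Sum.elim x fun v => (p' v).2)) := fun hg x =>
    ckB_slice (fun a => (hg a).param_left continuous_id) x
  refine ⟨?_, fun x => ?_, fun p hp => ?_⟩
  · exact hu.continuous_slice fun a => (hg a).param_left continuous_id
  · exact (hu.enorm_le (hck hg x).isCk).trans (by gcongr; exact (hck hg x).ckNorm_le)
  · have hp' : 0 < (Sum.elim m fun _ => k : P ⊕ Q → ℕ) (Prod.fst ((Sum.inl p.1, p.2) : (P ⊕ Q) × Fin d)) := hp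
    set g' : (Q → ι) → (P ⊕ Q → Torus d ℓ) → ℂ :=
      fun a => Grassmann.dirDeriv (dirTV (P ⊕ Q) d ℓ (Sum.inl p.1, p.2)) (g a) with hg'
    have hg'd : ∀ a, CDB (dirTV (P ⊕ Q) d ℓ) Prod.fst (Sum.elim (dec m p.1) fun _ => k) C (g' a) :=
      fun a => by
        rw [← dec_sumElim]
        exact (hg a).dirDeriv hp'
    have key : ∀ x, HasDerivAt (fun t => u fun p' => g (fun v => (p' v).1)
        (Sum.elim (x + dirTV P d ℓ p t) fun v => (p' v).2))
        (u fun p' => g' (fun v => (p' v).1) (Sum.elim x fun v => (p' v).2)) 0 := by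
      intro x
      have hθ : Continuous fun s : ℝ => x + dirTV P d ℓ p s :=
        continuous_const.add (isFlow_dirTV.cont p)
      have hpar := fun a => (hg'd a).param_left hθ
      have hcont := hu.continuous_slice hpar
      -- Difference quotients of `g` are not known to converge in the norm of `𝓒_k`. The increment
      -- is therefore written as the integral of the derivative, `u` is moved inside, and the
      -- continuous integrand is differentiated by the fundamental theorem of calculus.
      have hFT : ∀ t, (u fun p' => g (fun v => (p' v).1) (Sum.elim (x + dirTV P d ℓ p t) fun v => (p' v).2))
          = (u fun p' => g (fun v => (p' v).1) (Sum.elim x fun v => (p' v).2)) +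
            ∫ s in (0 : ℝ)..t, u (slice (fun a (zy : ℝ × (Q → Torus d ℓ)) =>
              g' a (Sum.elim (x + dirTV P d ℓ p zy.1) zy.2)) s) := by
        intro t
        rw [← integral_signedIndicator_mul hcont,
          ← hu.map_integral (integrable_signedIndicator t) hC hpar, ← sub_eq_iff_eq_add',
          ← hu.map_sub (hck hg _).isCk (hck hg _).isCk]
        congr 1
        funext p'
        have hc2 : Continuous fun s => slice (fun a (zy : ℝ × (Q → Torus d ℓ)) =>
              g' a (Sum.elim (x + dirTV P d ℓ p zy.1) zy.2)) s p' :=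
          (hpar fun v => (p' v).1).continuous.comp (by fun_prop : Continuous fun s : ℝ => (s, fun v => (p' v).2))
        rw [integral_signedIndicator_mul hc2]
        have hd : ∀ s, HasDerivAt (fun s => g (fun v => (p' v).1)
            (Sum.elim (x + dirTV P d ℓ p s) fun v => (p' v).2))
            (slice (fun a (zy : ℝ × (Q → Torus d ℓ)) =>
              g' a (Sum.elim (x + dirTV P d ℓ p zy.1) zy.2)) s p') s := by
          intro s
          simp only [sumElim_add_dirTV_inl, slice]
          exact isFlow_dirTV.hasDerivAt (fun y => (hg _).differentiableAt hp' y) _ s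
        rw [intervalIntegral.integral_eq_sub_of_hasDerivAt (fun s _ => hd s) (hc2.intervalIntegrable _ _)]
        simp [isFlow_dirTV.zero]
      have h2 := ((intervalIntegral.integral_hasDerivAt_right (hcont.intervalIntegrable 0 0)
        (hcont.stronglyMeasurableAtFilter _ _) hcont.continuousAt)).const_add
        (u fun p' => g (fun v => (p' v).1) (Sum.elim x fun v => (p' v).2))
      simp only [hFT]
      have h3 : slice (fun a (zy : ℝ × (Q → Torus d ℓ)) => g' a (Sum.elim (x + dirTV P d ℓ p zy.1) zy.2)) 0
          = fun p' => g' (fun v => (p' v).1) (Sum.elim x fun v => (p' v).2) := by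
        funext p'
        simp [slice, isFlow_dirTV.zero]
      rw [h3] at h2
      exact h2
    exact ⟨fun x => (key x).differentiableAt, g', hg'd, funext fun x => (key x).deriv⟩

/-- The pairing of a distribution with some of the variables of a test function. -/
theorem IsDistr.ckB_pair (hu : IsDistr k u) (hC : C ≠ ⊤) {f : TestFn ι d ℓ V} (hf : CkB k C f)
    {e : V → P ⊕ Q} (he : Function.Injective e) :
    CkB k (dualNorm k u * C) (fun p => u fun q => f fun v => Sum.elim p q (e v)) := by
  intro a
  have h := hu.cdb_pair (P := P) (m := fun _ => k) hC (g := fun a' =>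
    comp (fun p => f fun v => p (e v)) (Sum.elim a a')) (fun a' => by
      refine (hf.comp_inj he _).mono ?_ le_rfl
      rintro (v | v) <;> rfl)
  convert h using 1
  funext x
  simp only [comp]
  congr 1
  funext q
  congr 1
  funext v
  rcases e v with v | v <;> rfl

theorem IsDistr.isCk_pair (hu : IsDistr k u) {f : TestFn ι d ℓ V} (hf : IsCk k f)
    {e : V → P ⊕ Q} (he : Function.Injective e) :
    IsCk k (fun p => u fun q => f fun v => Sum.elim p q (e v)) :=
  (hu.ckB_pair hf.ckNorm_lt_top.ne hf.ckB he).isCk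

end Partial

/-! ### Integration over points with an index -/

section PtInt

variable {ι : Type} [Fintype ι] {d k : ℕ} {ℓ : ℝ} [Fact (0 < ℓ)] {V W P Q : Type}
  [Fintype V] [DecidableEq V] [Fintype W] [DecidableEq W]
  [Fintype P] [DecidableEq P] [Fintype Q] [DecidableEq Q] {C : ℝ≥0∞}

/-- The integral over all variables, with a sum over the indices. -/
def ptInt (g : TestFn ι d ℓ V) : ℂ := ∑ a : V → ι, ∫ x : V → Torus d ℓ, comp g a x

/-- All the components of `g` are continuous. -/
def ContTF (g : TestFn ι d ℓ V) : Prop := ∀ a, Continuous (comp g a)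

theorem IsCk.contTF {f : TestFn ι d ℓ V} (hf : IsCk k f) : ContTF f := fun a => (hf.ckB a).continuous

theorem integrable_torus {X : Type*} [TopologicalSpace X] [CompactSpace X] [MeasurableSpace X]
    [OpensMeasurableSpace X] (μ : Measure X) [IsFiniteMeasure μ] {f : X → ℂ}
    (hf : Continuous f) : Integrable f μ :=
  hf.integrable_of_hasCompactSupport (HasCompactSupport.of_compactSpace f)

theorem ptInt_reindex (e : V ≃ W) (g : TestFn ι d ℓ V) :
    ptInt g = ptInt (fun p : W → Pt ι d ℓ => g fun v => p (e v)) := by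
  unfold ptInt
  rw [← (Equiv.arrowCongr e (Equiv.refl ι)).sum_comp]
  refine Finset.sum_congr rfl fun a _ => ?_
  have h := volume_measurePreserving_piCongrLeft (fun _ : W => Torus d ℓ) e
  rw [← h.integral_comp' ]
  refine integral_congr_ae (Filter.Eventually.of_forall fun x => ?_)
  simp only [comp]
  congr 1
  funext v
  simp only [Equiv.arrowCongr_apply, Equiv.coe_refl, Function.comp, id, Equiv.symm_apply_apply]
  congr 1
  exact (Equiv.piCongrLeft_apply_apply (fun _ : W => Torus d ℓ) e x v).symm

theorem integrable_component {g : TestFn ι d ℓ (P ⊕ Q)} (hg : ContTF g) (a : P → ι) (b : Q → ι) :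
    Integrable (fun xy : (P → Torus d ℓ) × (Q → Torus d ℓ) =>
      comp g (Sum.elim a b) (Sum.elim xy.1 xy.2)) (volume.prod volume) :=
  integrable_torus _ ((hg _).comp (continuous_sumElim continuous_fst continuous_snd))

theorem ptInt_components {g : TestFn ι d ℓ (P ⊕ Q)} (hg : ContTF g) :
    ptInt g = ∑ a : P → ι, ∑ b : Q → ι, ∫ x : P → Torus d ℓ, ∫ y : Q → Torus d ℓ,
      comp g (Sum.elim a b) (Sum.elim x y) := by
  unfold ptInt
  rw [← (Equiv.sumArrowEquivProdArrow P Q ι).symm.sum_comp, Fintype.sum_prod_type]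
  refine Finset.sum_congr rfl fun a _ => Finset.sum_congr rfl fun b _ => ?_
  have h := volume_measurePreserving_sumPiEquivProdPi_symm (fun _ : P ⊕ Q => Torus d ℓ)
  rw [← h.integral_comp', ← integral_prod _ (integrable_component hg a b)]
  refine integral_congr_ae (Filter.Eventually.of_forall fun x => ?_)
  simp only [comp]
  rfl

theorem comp_sumElim (g : TestFn ι d ℓ (P ⊕ Q)) (a : P → ι) (b : Q → ι) (x : P → Torus d ℓ)
    (y : Q → Torus d ℓ) : comp g (Sum.elim a b) (Sum.elim x y) =
      g (Sum.elim (fun v => (a v, x v)) fun v => (b v, y v)) := by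
  simp only [comp]
  congr 1
  funext v
  rcases v with v | v <;> rfl

theorem ptInt_sum {g : TestFn ι d ℓ (P ⊕ Q)} (hg : ContTF g) :
    ptInt g = ptInt (fun p : P → Pt ι d ℓ => ptInt fun q : Q → Pt ι d ℓ => g (Sum.elim p q)) := by
  rw [ptInt_components hg]
  refine Finset.sum_congr rfl fun a _ => ?_
  rw [← integral_finsetSum _ fun b _ => (integrable_component hg a b).integral_prod_left]
  refine integral_congr_ae (Filter.Eventually.of_forall fun x => ?_)
  refine Finset.sum_congr rfl fun b _ => ?_
  simp only [comp_sumElim]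
  rfl

theorem ContTF.comp_any {g : TestFn ι d ℓ V} (hg : ContTF g) (e : V → W) :
    ContTF (fun p : W → Pt ι d ℓ => g fun v => p (e v)) := fun a =>
  (hg fun v => a (e v)).comp (by fun_prop : Continuous fun (x : W → Torus d ℓ) v => x (e v))

theorem ptInt_split (e : V ≃ P ⊕ Q) {g : TestFn ι d ℓ V} (hg : ContTF g) :
    ptInt g = ptInt (fun p : P → Pt ι d ℓ => ptInt fun q : Q → Pt ι d ℓ => g fun v => Sum.elim p q (e v)) := by
  rw [ptInt_reindex e, ptInt_sum (hg.comp_any e)]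

theorem ptInt_smul (c : ℂ) (g : TestFn ι d ℓ V) : ptInt (fun p => c * g p) = c * ptInt g := by
  simp only [ptInt, comp, integral_const_mul, Finset.mul_sum]

theorem ptInt_finset_sum {α : Type*} (s : Finset α) {g : α → TestFn ι d ℓ V} (hg : ∀ i ∈ s, ContTF (g i)) :
    ptInt (fun p => ∑ i ∈ s, g i p) = ∑ i ∈ s, ptInt (g i) := by
  simp only [ptInt, comp]
  rw [Finset.sum_comm]
  refine Finset.sum_congr rfl fun a _ => ?_
  exact integral_finsetSum _ fun i hi => integrable_torus _ (hg i hi a)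

theorem enorm_ptInt_le {g : TestFn ι d ℓ V} (h : ∀ p, ‖g p‖ₑ ≤ C) :
    ‖ptInt g‖ₑ ≤ (∑ _a : V → ι, volume (Set.univ : Set (V → Torus d ℓ))) * C := by
  unfold ptInt
  refine (enorm_sum_le _ _).trans ?_
  rw [Finset.sum_mul]
  refine Finset.sum_le_sum fun a _ => (enorm_integral_le_lintegral_enorm _).trans ?_
  calc _ ≤ ∫⁻ _ : V → Torus d ℓ, C := lintegral_mono fun x => h _
    _ = _ := by rw [lintegral_const, mul_comm]

theorem ptVol_ne_top : (∑ _a : V → ι, volume (Set.univ : Set (V → Torus d ℓ))) ≠ ⊤ := by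
  exact ENNReal.sum_ne_top.2 fun _ _ => measure_ne_top _ _

theorem cdb_component {f : TestFn ι d ℓ (P ⊕ Q)} (hf : CkB k C f) (a : P → ι) (b : Q → ι) :
    CDB (sndDir (P → Torus d ℓ) (dirTV Q d ℓ)) Prod.fst (fun _ => k) C
      (fun zy : (P → Torus d ℓ) × (Q → Torus d ℓ) => comp f (Sum.elim a b) (Sum.elim zy.1 zy.2)) :=
  ((hf (Sum.elim a b)).mono (by rintro (v | v) <;> rfl) le_rfl :
    CDB _ _ (Sum.elim (fun _ => k) fun _ => k) C _).param_left continuous_id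

theorem slice_component (f : TestFn ι d ℓ (P ⊕ Q)) (a : P → ι) (x : P → Torus d ℓ) :
    slice (fun b (zy : (P → Torus d ℓ) × (Q → Torus d ℓ)) =>
      comp f (Sum.elim a b) (Sum.elim zy.1 zy.2)) x = fun q => f (Sum.elim (fun v => (a v, x v)) q) := by
  funext q
  simp only [slice, comp]
  congr 1
  funext v
  rcases v with v | v <;> rfl

/-- Integration over part of the variables becomes a finite sum of parameter integrals with weight
`1`, to which `IsDistr.map_integral` and `ckB_integral` apply. -/
theorem ptInt_eq_sum_slice (f : TestFn ι d ℓ (P ⊕ Q)) :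
    (fun q => ptInt fun p => f (Sum.elim p q)) = ∑ a : P → ι, fun q => ∫ x : P → Torus d ℓ, (1 : ℂ) *
      slice (fun b (zy : (P → Torus d ℓ) × (Q → Torus d ℓ)) =>
        comp f (Sum.elim a b) (Sum.elim zy.1 zy.2)) x q := by
  funext q
  simp only [slice_component, Finset.sum_apply, one_mul]
  rfl

/-- A distribution commutes with the integration over other variables. -/
theorem IsDistr.map_ptInt {u : TestFn ι d ℓ Q → ℂ} (hu : IsDistr k u) {f : TestFn ι d ℓ (P ⊕ Q)}
    (hf : IsCk k f) :
    u (fun q => ptInt fun p => f (Sum.elim p q)) = ptInt fun p => u fun q => f (Sum.elim p q) := by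
  have h1 : Integrable (fun _ : P → Torus d ℓ => (1 : ℂ)) := integrable_const _
  have hC := hf.ckNorm_lt_top.ne
  rw [ptInt_eq_sum_slice, hu.map_sum _ fun a _ =>
    (ckB_integral h1 hC (cdb_component hf.ckB a)).isCk]
  unfold ptInt
  refine Finset.sum_congr rfl fun a _ => ?_
  rw [hu.map_integral h1 hC (cdb_component hf.ckB a)]
  simp only [slice_component, one_mul]
  rfl

theorem IsCk.ptInt {f : TestFn ι d ℓ (P ⊕ Q)} (hf : IsCk k f) :
    IsCk k (fun q => Grassmann.ptInt fun p => f (Sum.elim p q)) := by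
  rw [ptInt_eq_sum_slice]
  exact IsCk.sum _ fun a _ =>
    (ckB_integral (integrable_const _) hf.ckNorm_lt_top.ne (cdb_component hf.ckB a)).isCk

end PtInt

/-! ### The Gram determinant inequality -/

section Gram

variable {H : Type*} [NormedAddCommGroup H] [InnerProductSpace ℂ H] {n : ℕ}

/-- The vector `v j` is the sum of its orthogonalization and a vector orthogonal to it, so this is
Pythagoras. -/
theorem norm_gramSchmidt_le (v : Fin n → H) (j : Fin n) :
    ‖InnerProductSpace.gramSchmidt ℂ v j‖ ≤ ‖v j‖ := by
  set s := ∑ i ∈ Finset.Iio j, (inner ℂ (InnerProductSpace.gramSchmidt ℂ v i) (v j) /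
    (‖InnerProductSpace.gramSchmidt ℂ v i‖ : ℂ) ^ 2) • InnerProductSpace.gramSchmidt ℂ v i with hs
  have h1 : v j = InnerProductSpace.gramSchmidt ℂ v j + s :=
    InnerProductSpace.gramSchmidt_def'' ℂ v j
  have h0 : inner ℂ (InnerProductSpace.gramSchmidt ℂ v j) s = 0 := by
    rw [hs, inner_sum]
    refine Finset.sum_eq_zero fun i hi => ?_
    rw [inner_smul_right, InnerProductSpace.gramSchmidt_orthogonal ℂ v (Finset.mem_Iio.1 hi).ne', mul_zero]
  have h2 := norm_add_sq_eq_norm_sq_add_norm_sq_of_inner_eq_zero _ _ h0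
  rw [← h1] at h2
  nlinarith [norm_nonneg (v j), norm_nonneg (InnerProductSpace.gramSchmidt ℂ v j), mul_self_nonneg ‖s‖]

/-- The `v j` are expressed in their orthogonalization by an upper triangular matrix `T` with unit
diagonal, which does not change the determinant. -/
theorem det_inner_gramSchmidt (u v : Fin n → H) :
    Matrix.det (Matrix.of fun i j => inner ℂ (u i) (v j)) =
      Matrix.det (Matrix.of fun i j => inner ℂ (u i) (InnerProductSpace.gramSchmidt ℂ v j)) := by
  let T : Matrix (Fin n) (Fin n) ℂ := Matrix.of fun i j =>
    if i = j then 1 else if i < j then inner ℂ (InnerProductSpace.gramSchmidt ℂ v i) (v j) /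
      (‖InnerProductSpace.gramSchmidt ℂ v i‖ : ℂ) ^ 2 else 0
  have hT : T.det = 1 := by
    rw [Matrix.det_of_isUpperTriangular]
    · simp [T]
    · intro i j hij
      have hij' : j < i := hij
      simp [T, hij'.ne', hij'.not_gt]
  have hM : (Matrix.of fun i j => inner ℂ (u i) (v j)) =
      (Matrix.of fun i j => inner ℂ (u i) (InnerProductSpace.gramSchmidt ℂ v j)) * T := by
    ext i j
    rw [Matrix.mul_apply]
    simp only [Matrix.of_apply, T]
    conv_lhs => rw [InnerProductSpace.gramSchmidt_def'' ℂ v j]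
    rw [inner_add_right, inner_sum, ← Finset.add_sum_erase _ _ (Finset.mem_univ j)]
    congr 1
    · simp
    · refine Finset.sum_subset_zero_on_sdiff (fun i hi => ?_) (fun l hl => ?_) fun l hl => ?_
      · simp [(Finset.mem_Iio.1 hi).ne]
      · simp only [Finset.mem_sdiff, Finset.mem_erase, Finset.mem_univ, and_true, Finset.mem_Iio] at hl
        simp [hl.1, hl.2]
      · have := Finset.mem_Iio.1 hl
        rw [inner_smul_right, if_neg this.ne, if_pos this, mul_comm]
        rfl
  rw [hM, Matrix.det_mul, hT, mul_one]

/-- Up to conjugate transposition the matrix consists of the coordinate vectors `r i` of `u i` in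
the orthonormal system. By Bessel `‖r i‖ ≤ ‖u i‖`, and the rest is Hadamard's inequality for the `r
i`. -/
theorem norm_det_le_of_orthonormal (u e : Fin n → H) (he : Orthonormal ℂ e) :
    ‖Matrix.det (Matrix.of fun i j => inner ℂ (u i) (e j))‖ ≤ ∏ i, ‖u i‖ := by
  let r : Fin n → EuclideanSpace ℂ (Fin n) := fun i => WithLp.toLp 2 fun j => inner ℂ (e j) (u i)
  have hr : ∀ i, ‖r i‖ ≤ ‖u i‖ := by
    intro i
    refine le_of_sq_le_sq ?_ (norm_nonneg _)
    rw [EuclideanSpace.norm_sq_eq]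
    exact he.sum_inner_products_le (u i) (s := Finset.univ)
  let b : Fin n → EuclideanSpace ℂ (Fin n) := InnerProductSpace.gramSchmidt ℂ r
  let B : Matrix (Fin n) (Fin n) ℂ := Matrix.of fun i j => b j i
  have h1 : ‖Matrix.det (Matrix.of fun i j => inner ℂ (u i) (e j))‖ = ‖B.det‖ := by
    let std : Fin n → EuclideanSpace ℂ (Fin n) := fun i => EuclideanSpace.single i 1
    have h2 := det_inner_gramSchmidt std r
    have h3 : (Matrix.of fun i j => inner ℂ (std i) (InnerProductSpace.gramSchmidt ℂ r j)) = B := by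
      ext i j
      simp [std, B, b, EuclideanSpace.inner_single_left]
    have h4 : (Matrix.of fun i j => inner ℂ (u i) (e j)) =
        (Matrix.of fun i j => inner ℂ (std i) (r j)).conjTranspose := by
      ext i j
      simp [std, r, EuclideanSpace.inner_single_left]
    rw [h4, Matrix.det_conjTranspose, h2, h3, norm_star]
  -- The columns of `B` are orthogonal, so `|det B|²` is the product of their squared norms.
  have h5 : B.conjTranspose * B = Matrix.diagonal fun i => ((‖b i‖ ^ 2 : ℝ) : ℂ) := by
    ext i j
    have h6 : (B.conjTranspose * B) i j = inner ℂ (b i) (b j) := by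
      simp [Matrix.mul_apply, B, PiLp.inner_apply, mul_comm]
    rw [h6]
    by_cases hij : i = j
    · subst hij
      simp [inner_self_eq_norm_sq_to_K]
    · rw [Matrix.diagonal_apply_ne _ hij]
      exact InnerProductSpace.gramSchmidt_orthogonal ℂ r hij
  have h7 : ‖B.det‖ ^ 2 = ∏ i, ‖b i‖ ^ 2 := by
    have := congrArg (fun M => ‖Matrix.det M‖) h5
    simp only [Matrix.det_mul, Matrix.det_conjTranspose, Matrix.det_diagonal, norm_mul, norm_star,
      norm_prod, Complex.norm_real] at this
    rw [sq, this]
    simp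
  rw [h1]
  refine le_of_sq_le_sq ?_ (Finset.prod_nonneg fun _ _ => norm_nonneg _)
  rw [h7, Finset.prod_pow]
  gcongr with i
  exact (norm_gramSchmidt_le r i).trans (hr i)

/-- Gram's inequality. -/
theorem norm_det_inner_le (u v : Fin n → H) :
    ‖Matrix.det (Matrix.of fun i j => inner ℂ (u i) (v j))‖ ≤ (∏ i, ‖u i‖) * ∏ j, ‖v j‖ := by
  rw [det_inner_gramSchmidt]
  set b := InnerProductSpace.gramSchmidt ℂ v with hb
  have hle : (∏ i, ‖u i‖) * ∏ j, ‖b j‖ ≤ (∏ i, ‖u i‖) * ∏ j, ‖v j‖ := by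
    gcongr with j
    exact norm_gramSchmidt_le v j
  refine le_trans ?_ hle
  -- For linearly dependent `v` some `b j` vanishes and the determinant has a zero column; otherwise
  -- the `b j` can be normalized.
  by_cases h0 : ∃ j, b j = 0
  · obtain ⟨j, hj⟩ := h0
    rw [Matrix.det_eq_zero_of_column_eq_zero j (by simp [hj])]
    simp only [norm_zero]
    positivity
  · push Not at h0
    have he : Orthonormal ℂ fun j => ((‖b j‖⁻¹ : ℝ) : ℂ) • b j := by
      refine ⟨fun j => ?_, fun i j hij => ?_⟩
      · rw [norm_smul, Complex.norm_real, norm_inv, norm_norm, inv_mul_cancel₀ (norm_ne_zero_iff.2 (h0 j))]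
      · show inner ℂ (((‖b i‖⁻¹ : ℝ) : ℂ) • b i) (((‖b j‖⁻¹ : ℝ) : ℂ) • b j) = 0
        rw [inner_smul_left, inner_smul_right, InnerProductSpace.gramSchmidt_orthogonal ℂ v hij]
        simp
    have h1 := norm_det_le_of_orthonormal u _ he
    have h2 : (Matrix.of fun i j => inner ℂ (u i) (b j)) = Matrix.of fun i j =>
        ((‖b j‖ : ℝ) : ℂ) * (Matrix.of fun i j => inner ℂ (u i) (((‖b j‖⁻¹ : ℝ) : ℂ) • b j)) i j := by
      ext i j
      simp only [Matrix.of_apply, inner_smul_right]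
      rw [← mul_assoc, ← Complex.ofReal_mul, mul_inv_cancel₀ (norm_ne_zero_iff.2 (h0 j))]
      simp
    rw [h2, Matrix.det_mul_row, norm_mul, norm_prod, mul_comm]
    simp only [Complex.norm_real, norm_norm]
    gcongr

end Gram

/-! ### Determinants of the covariance as test functions -/

section CovDet

variable {D X E H : Type*} [AddCommGroup X] [TopologicalSpace X] [NormedAddCommGroup E]
  [NormedSpace ℝ E] [NormedAddCommGroup H] [NormedSpace ℝ H]

/-- Used to assemble the components `c` of a factor of `G` into one function with values in a
Hilbert space; a continuous linear map commutes with all derivatives. -/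
theorem hasContDerivs_pi {κ : Type*} [Fintype κ] {e : D → ℝ → X} {A : List D → Prop}
    (hA : ∀ p w, A (p :: w) → A w) {g : κ → X → E} (hg : ∀ c, HasContDerivs e A (g c))
    (T : (κ → E) →L[ℝ] H) :
    HasContDerivs e A (fun x => T fun c => g c x) ∧
      ∀ w, A w → iterDeriv e w (fun x => T fun c => g c x) = fun x => T fun c => iterDeriv e w (g c) x := by
  have hd : ∀ p w, A (p :: w) → ∀ x, HasDerivAt (fun t => T fun c => iterDeriv e w (g c) (x + e p t))
      (T fun c => iterDeriv e (p :: w) (g c) x) 0 := by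
    intro p w hw x
    exact T.hasFDerivAt.comp_hasDerivAt (0 : ℝ)
      (hasDerivAt_pi.2 fun c => ((hg c).2 p w hw x).hasDerivAt)
  have h : ∀ w, A w → iterDeriv e w (fun x => T fun c => g c x) =
      fun x => T fun c => iterDeriv e w (g c) x := by
    intro w
    induction w with
    | nil => intro _; rfl
    | cons p w ih =>
      intro hw
      rw [iterDeriv, ih (hA p w hw)]
      funext x
      exact (hd p w hw x).deriv
  refine ⟨⟨fun w hw => ?_, fun p w hw x => ?_⟩, h⟩
  · rw [h w hw]
    exact T.continuous.comp (continuous_pi fun c => (hg c).1 w hw)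
  · rw [h w (hA p w hw)]
    exact (hd p w hw x).differentiableAt

end CovDet

section DetTest

variable {d n : ℕ} {ℓ : ℝ} {V : Type} [DecidableEq V] {H : Type*} [NormedAddCommGroup H]
  [InnerProductSpace ℂ H] {C : ℝ≥0∞}

/-- The determinant is linear in a single row; `Matrix.cramer` supplies it as a linear map. -/
theorem hasDerivAt_det_updateRow (M : Matrix (Fin n) (Fin n) ℂ) (i : Fin n) {b : ℝ → Fin n → ℂ}
    {b' : Fin n → ℂ} {t : ℝ} (hb : HasDerivAt b b' t) :
    HasDerivAt (fun t => (M.updateRow i (b t)).det) (M.updateRow i b').det t := by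
  let L : (Fin n → ℂ) →ₗ[ℝ] ℂ := ((LinearMap.proj i).comp (Matrix.cramer M.transpose)).restrictScalars ℝ
  have hL : ∀ b, L b = (M.updateRow i b).det := fun b => Matrix.cramer_transpose_apply M b i
  have := (LinearMap.toContinuousLinearMap L).hasFDerivAt.comp_hasDerivAt t hb
  simp only [← hL]
  exact this

theorem hasDerivAt_det_updateCol (M : Matrix (Fin n) (Fin n) ℂ) (i : Fin n) {b : ℝ → Fin n → ℂ}
    {b' : Fin n → ℂ} {t : ℝ} (hb : HasDerivAt b b' t) :
    HasDerivAt (fun t => (M.updateCol i (b t)).det) (M.updateCol i b').det t := by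
  have := hasDerivAt_det_updateRow M.transpose i hb
  simpa only [Matrix.updateRow_transpose, Matrix.det_transpose] using this

/-- Each variable occurs in at most one row or one column, by injectivity of `Sum.elim r c`. Its
derivative replaces one vector by its derivative, so the result is again a determinant of inner
products of vectors bounded by `C`. Gram's inequality then bounds every derivative by the same
constant, with no combinatorial factor. -/
theorem cdb_det {r c : Fin n → V} (hrc : Function.Injective (Sum.elim r c)) {m : V → ℕ}
    {A B : Fin n → Torus d ℓ → H}
    (hA : ∀ i, CDB (dirT d ℓ) (fun _ => ()) (fun _ => m (r i)) C (A i))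
    (hB : ∀ j, CDB (dirT d ℓ) (fun _ => ()) (fun _ => m (c j)) C (B j)) :
    CDB (dirTV V d ℓ) Prod.fst m (C ^ n * C ^ n) (fun x =>
      Matrix.det (Matrix.of fun i j => inner ℂ (A i (x (r i))) (B j (x (c j))))) := by
  refine CDB.coind (S := fun m h => (h = fun _ => 0) ∨ ∃ A B : Fin n → Torus d ℓ → H,
    (∀ i, CDB (dirT d ℓ) (fun _ => ()) (fun _ => m (r i)) C (A i)) ∧
    (∀ j, CDB (dirT d ℓ) (fun _ => ()) (fun _ => m (c j)) C (B j)) ∧ h = fun x =>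
      Matrix.det (Matrix.of fun i j => inner ℂ (A i (x (r i))) (B j (x (c j))))) ?_
    (Or.inr ⟨A, B, hA, hB, rfl⟩)
  have hr : ∀ {i i'}, r i = r i' → i = i' := fun h => Sum.inl_injective (hrc h)
  have hc : ∀ {i i'}, c i = c i' → i = i' := fun h => Sum.inr_injective (hrc h)
  have hne : ∀ i j, r i ≠ c j := fun i j h => by cases hrc (a₁ := Sum.inl i) (a₂ := Sum.inr j) h
  have hdec : ∀ (m : V → ℕ) v, 0 < m v → dec (fun _ : Unit => m v) () = fun _ => dec m v v := by
    intro m v _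
    funext
    simp [dec]
  rintro m _ (rfl | ⟨A, B, hA, hB, rfl⟩)
  · refine ⟨continuous_const, fun x => by simp, fun p _ => ⟨fun x => differentiableAt_const _, Or.inl ?_⟩⟩
    funext x
    simp [Grassmann.dirDeriv]
  · refine ⟨?_, fun x => ?_, fun p hp => ?_⟩
    · refine Continuous.matrix_det (continuous_matrix fun i j => ?_)
      exact ((hA i).continuous.comp (continuous_apply (A := fun _ : V => Torus d ℓ) (r i))).inner (𝕜 := ℂ)
        ((hB j).continuous.comp (continuous_apply (A := fun _ : V => Torus d ℓ) (c j)))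
    · have h1 := norm_det_inner_le (fun i => A i (x (r i))) (fun j => B j (x (c j)))
      rw [← ofReal_norm]
      refine (ENNReal.ofReal_le_ofReal h1).trans ?_
      rw [ENNReal.ofReal_mul (Finset.prod_nonneg fun _ _ => norm_nonneg _),
        ENNReal.ofReal_prod_of_nonneg (fun _ _ => norm_nonneg _),
        ENNReal.ofReal_prod_of_nonneg (fun _ _ => norm_nonneg _)]
      simp only [ofReal_norm]
      refine mul_le_mul' ?_ ?_
      · simpa using Finset.prod_le_pow_card Finset.univ _ C fun i _ => (hA i).bound (x (r i))
      · simpa using Finset.prod_le_pow_card Finset.univ _ C fun i _ => (hB i).bound (x (c i))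
    · by_cases h1 : ∃ i, r i = p.1
      · obtain ⟨i, hi⟩ := h1
        have hpi : 0 < m (r i) := hi ▸ hp
        have key : ∀ x : V → Torus d ℓ, HasDerivAt (fun t => Matrix.det (Matrix.of fun i j =>
            inner ℂ (A i ((x + dirTV V d ℓ p t) (r i))) (B j ((x + dirTV V d ℓ p t) (c j)))))
            (Matrix.det (Matrix.of fun i' j => inner ℂ
              (Function.update A i (Grassmann.dirDeriv (dirT d ℓ p.2) (A i)) i' (x (r i'))) (B j (x (c j))))) 0 := by
          intro x
          set M : Matrix (Fin n) (Fin n) ℂ := Matrix.of fun i j => inner ℂ (A i (x (r i))) (B j (x (c j))) with hM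
          have hb : HasDerivAt (fun t j => inner ℂ (A i (x (r i) + dirT d ℓ p.2 t)) (B j (x (c j))))
              (fun j => inner ℂ (Grassmann.dirDeriv (dirT d ℓ p.2) (A i) (x (r i))) (B j (x (c j)))) 0 := by
            refine hasDerivAt_pi.2 fun j => ?_
            have := (hasDerivAt_zero_of_differentiableAt (((hA i)).differentiableAt (p := p.2) hpi (x (r i)))).inner ℂ
              (hasDerivAt_const (0 : ℝ) (B j (x (c j))))
            simpa using this
          have h2 := hasDerivAt_det_updateRow M i hb
          convert h2 using 1
          · funext t
            congr 1
            ext i' j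
            have hcj : (x + dirTV V d ℓ p t) (c j) = x (c j) := by
              simp [dirTV, Pi.single_eq_of_ne (hi ▸ (hne i j).symm : c j ≠ p.1)]
            by_cases hii : i' = i
            · subst hii
              simp only [Matrix.of_apply, Matrix.updateRow_self, hcj]
              simp [dirTV, ← hi]
            · have hri : (x + dirTV V d ℓ p t) (r i') = x (r i') := by
                simp [dirTV, Pi.single_eq_of_ne (hi ▸ (fun h => hii (hr h)) : r i' ≠ p.1)]
              simp only [Matrix.of_apply, Matrix.updateRow_ne hii, hcj, hri, hM]
          · congr 1
            ext i' j
            by_cases hii : i' = i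
            · subst hii
              simp
            · simp [hii, hM]
        refine ⟨fun x => (key x).differentiableAt, Or.inr ⟨_, B, fun i' => ?_, fun j => ?_, funext fun x => (key x).deriv⟩⟩
        · by_cases hii : i' = i
          · subst hii
            rw [Function.update_self, ← hi, ← hdec m _ hpi]
            exact (hA i').dirDeriv (p := p.2) hpi
          · rw [Function.update_of_ne hii]
            exact (hA i').mono (fun _ => dec_le _ _ _) le_rfl
        · exact (hB j).mono (fun _ => dec_le _ _ _) le_rfl
      · by_cases h2 : ∃ j, c j = p.1
        · obtain ⟨i, hi⟩ := h2
          have hpi : 0 < m (c i) := hi ▸ hp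
          have key : ∀ x : V → Torus d ℓ, HasDerivAt (fun t => Matrix.det (Matrix.of fun i j =>
              inner ℂ (A i ((x + dirTV V d ℓ p t) (r i))) (B j ((x + dirTV V d ℓ p t) (c j)))))
              (Matrix.det (Matrix.of fun i' j => inner ℂ (A i' (x (r i')))
                (Function.update B i (Grassmann.dirDeriv (dirT d ℓ p.2) (B i)) j (x (c j))))) 0 := by
            intro x
            set M : Matrix (Fin n) (Fin n) ℂ := Matrix.of fun i j => inner ℂ (A i (x (r i))) (B j (x (c j))) with hM
            have hb : HasDerivAt (fun t j => inner ℂ (A j (x (r j))) (B i (x (c i) + dirT d ℓ p.2 t)))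
                (fun j => inner ℂ (A j (x (r j))) (Grassmann.dirDeriv (dirT d ℓ p.2) (B i) (x (c i)))) 0 := by
              refine hasDerivAt_pi.2 fun j => ?_
              have := (hasDerivAt_const (0 : ℝ) (A j (x (r j)))).inner ℂ
                (hasDerivAt_zero_of_differentiableAt (((hB i)).differentiableAt (p := p.2) hpi (x (c i))))
              simpa using this
            have h2 := hasDerivAt_det_updateCol M i hb
            convert h2 using 1
            · funext t
              congr 1
              ext j i'
              have hcj : (x + dirTV V d ℓ p t) (r j) = x (r j) := by
                simp [dirTV, Pi.single_eq_of_ne (hi ▸ hne j i : r j ≠ p.1)]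
              by_cases hii : i' = i
              · subst hii
                simp only [Matrix.of_apply, Matrix.updateCol_self, hcj]
                simp [dirTV, ← hi]
              · have hri : (x + dirTV V d ℓ p t) (c i') = x (c i') := by
                  simp [dirTV, Pi.single_eq_of_ne (hi ▸ (fun h => hii (hc h)) : c i' ≠ p.1)]
                simp only [Matrix.of_apply, Matrix.updateCol_ne hii, hcj, hri, hM]
            · congr 1
              ext j i'
              by_cases hii : i' = i
              · subst hii
                simp
              · simp [hii, hM]
          refine ⟨fun x => (key x).differentiableAt, Or.inr ⟨A, _, fun j => ?_, fun i' => ?_, funext fun x => (key x).deriv⟩⟩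
          · exact (hA j).mono (fun _ => dec_le _ _ _) le_rfl
          · by_cases hii : i' = i
            · subst hii
              rw [Function.update_self, ← hi, ← hdec m _ hpi]
              exact (hB i').dirDeriv (p := p.2) hpi
            · rw [Function.update_of_ne hii]
              exact (hB i').mono (fun _ => dec_le _ _ _) le_rfl
        -- The direction belongs to a variable that occurs in no row or column, so the derivative is
        -- zero.
        · push Not at h1 h2
          have h3 : ∀ (x : V → Torus d ℓ) t, (Matrix.det (Matrix.of fun i j =>
              inner ℂ (A i ((x + dirTV V d ℓ p t) (r i))) (B j ((x + dirTV V d ℓ p t) (c j))))) =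
              Matrix.det (Matrix.of fun i j => inner ℂ (A i (x (r i))) (B j (x (c j)))) := by
            intro x t
            congr 1
            ext i j
            simp [dirTV, Pi.single_eq_of_ne (h1 i), Pi.single_eq_of_ne (h2 j)]
          refine ⟨fun x => ?_, Or.inl ?_⟩
          · simp only [h3]
            exact differentiableAt_const _
          · funext x
            simp only [Grassmann.dirDeriv, h3, deriv_const]

end DetTest

/-! ### The covariance as an inner product in a Hilbert space -/

section Cov

variable {ι : Type} {d k : ℕ} {ℓ : ℝ} {V : Type} [DecidableEq V]

/-- The properties of the covariance that are used: it is continuous, and its determinants are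
test functions that satisfy Gram's inequality with the constant `η`. -/
structure IsCov (k : ℕ) (G : ι → ι → Torus d ℓ → ℂ) (η : ℝ≥0∞) : Prop where
  cont : ∀ a b, Continuous (G a b)
  det_ckB : ∀ {V : Type} [DecidableEq V] (n : ℕ) (r c : Fin n → V), Function.Injective (Sum.elim r c) →
    CkB k (η ^ n * η ^ n) (fun p : V → Pt ι d ℓ => Matrix.det (Matrix.of fun i j =>
      G (p (r i)).1 (p (c j)).1 ((p (r i)).2 - (p (c j)).2)))

/-- This is the determinant bound for `n = 1`. -/
theorem IsCov.isCk {G : ι → ι → Torus d ℓ → ℂ} {η : ℝ≥0∞} (hG : IsCov k G η) {v v' : V} (h : v ≠ v') :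
    IsCk k (fun p : V → Pt ι d ℓ => G (p v).1 (p v').1 ((p v).2 - (p v').2)) := by
  have h1 := (hG.det_ckB 1 (fun _ => v) (fun _ => v') (by
    rintro (i | i) (j | j) hij
    · rw [Subsingleton.elim i j]
    · exact absurd hij h
    · exact absurd hij.symm h
    · rw [Subsingleton.elim i j])).isCk
  simpa [Matrix.det_fin_one] using h1

variable [Fintype ι] [Fact (0 < ℓ)]

local notation "L2T" => Lp ℂ 2 (volume : Measure (Torus d ℓ))

/-- Complex conjugation on `L²`. -/
def conjL2 (d : ℕ) (ℓ : ℝ) [Fact (0 < ℓ)] : Lp ℂ 2 (volume : Measure (Torus d ℓ)) →L[ℝ]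
    Lp ℂ 2 (volume : Measure (Torus d ℓ)) :=
  ContinuousLinearMap.compLpL 2 volume (Complex.conjCLE : ℂ →L[ℝ] ℂ)

theorem coeFn_conjL2 (f : L2T) : conjL2 d ℓ f =ᵐ[volume] fun z => starRingEnd ℂ (f z) := by
  exact ContinuousLinearMap.coeFn_compLp (Complex.conjCLE : ℂ →L[ℝ] ℂ) f

theorem norm_conjL2 (f : L2T) : ‖conjL2 d ℓ f‖ = ‖f‖ := by
  rw [Lp.norm_def, Lp.norm_def]
  congr 1
  refine eLpNorm_congr_norm_ae ?_
  filter_upwards [coeFn_conjL2 f] with z hz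
  rw [hz]
  simp

/-- Families of functions in `L²` as vectors of a Hilbert space. -/
def vecL2 : (ι → L2T) →L[ℝ] PiLp 2 (fun _ : ι => L2T) :=
  (PiLp.continuousLinearEquiv 2 ℝ (fun _ : ι => L2T)).symm.toContinuousLinearMap

theorem enorm_vecL2_le {v : ι → L2T} {C : ℝ≥0∞} (h : (∑ c, ‖v c‖ₑ ^ 2) ^ (1 / 2 : ℝ) ≤ C) :
    ‖vecL2 v‖ₑ ≤ C := by
  refine le_trans (le_of_eq ?_) h
  have h1 : ‖vecL2 v‖ₑ ^ 2 = ∑ c, ‖v c‖ₑ ^ 2 := by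
    have h2 := PiLp.nnnorm_eq_of_L2 (β := fun _ : ι => L2T) (vecL2 v)
    have h3 : ‖vecL2 v‖₊ ^ 2 = ∑ c, ‖v c‖₊ ^ 2 := by
      rw [h2, NNReal.sq_sqrt]
      rfl
    rw [enorm_eq_nnnorm, ← ENNReal.coe_pow, h3]
    push_cast
    rfl
  rw [← h1, ← ENNReal.rpow_natCast, ← ENNReal.rpow_mul]
  norm_num

/-- The inner product is conjugate linear in its first argument; `conjL2` undoes this and leaves the
bilinear integral of the factorization. -/
theorem inner_vecL2 (u v : ι → L2T) :
    inner ℂ (vecL2 fun c => conjL2 d ℓ (u c)) (vecL2 v) = ∑ c, ∫ z, u c z * v c z := by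
  rw [PiLp.inner_apply]
  refine Finset.sum_congr rfl fun c _ => ?_
  rw [L2.inner_def]
  refine integral_congr_ae ?_
  filter_upwards [coeFn_conjL2 (u c)] with z hz
  show inner ℂ ((conjL2 d ℓ (u c)) z) (v c z) = _
  rw [hz]
  simp [mul_comm]

/-- The covariance is `⟨A a x, B b y⟩` in the `ℓ²` sum over `c` of copies of `L²`, with `A` and `B`
of class `C^k` and bounded by `h(G)` together with their derivatives. Thus `cdb_det` applies;
continuity follows at `y = 0`. -/
theorem isCov_of_factorization {G : ι → ι → Torus d ℓ → ℂ} {G₁ G₂ : ι → ι → Torus d ℓ → L2T}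
    (hG₁ : ∀ a c, IsCkL2 k (G₁ a c)) (hG₂ : ∀ c b, IsCkL2 k (G₂ c b))
    (hfac : ∀ a b x y, G a b (x - y) = ∑ c, ∫ z, G₁ a c x z * G₂ c b y z) :
    IsCov k G (covH k G₁ G₂) := by
  have hlen : ∀ (p : Fin d) (w : List (Fin d)), (p :: w).length ≤ k → w.length ≤ k :=
    fun p w h => by simp at h; omega
  have hadm : ∀ w : List (Fin d), Adm (fun _ => ()) (fun _ => k) w ↔ w.length ≤ k := by
    intro w
    constructor
    · intro h
      simpa using h ()
    · intro h v
      simpa using h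
  let T : (ι → L2T) →L[ℝ] PiLp 2 (fun _ : ι => L2T) :=
    vecL2.comp (ContinuousLinearMap.pi fun c => (conjL2 d ℓ).comp (ContinuousLinearMap.proj c))
  let A : ι → Torus d ℓ → PiLp 2 (fun _ : ι => L2T) := fun a x => T fun c => G₁ a c x
  let B : ι → Torus d ℓ → PiLp 2 (fun _ : ι => L2T) := fun b x => vecL2 fun c => G₂ c b x
  have hle : ∀ (w : List (Fin d)) (hw : w.length ≤ k) (a : ι) (x : Torus d ℓ),
      max ((∑ c, ‖iterDeriv (dirT d ℓ) w (G₁ a c) x‖ₑ ^ 2) ^ (1 / 2 : ℝ))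
        ((∑ c, ‖iterDeriv (dirT d ℓ) w (G₂ c a) x‖ₑ ^ 2) ^ (1 / 2 : ℝ)) ≤ covH k G₁ G₂ :=
    fun w hw a x => le_iSup_of_le w <| le_iSup_of_le hw <| le_iSup_of_le a <| le_iSup
      (fun x => max ((∑ c, ‖iterDeriv (dirT d ℓ) w (G₁ a c) x‖ₑ ^ 2) ^ (1 / 2 : ℝ))
        ((∑ c, ‖iterDeriv (dirT d ℓ) w (G₂ c a) x‖ₑ ^ 2) ^ (1 / 2 : ℝ))) x
  have hA : ∀ a, CDB (dirT d ℓ) (fun _ => ()) (fun _ => k) (covH k G₁ G₂) (A a) := by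
    intro a
    obtain ⟨h1, h2⟩ := hasContDerivs_pi hlen (hG₁ a) T
    refine ⟨⟨fun w hw => h1.1 w ((hadm w).1 hw), fun p w hw => h1.2 p w ((hadm _).1 hw)⟩, fun w hw x => ?_⟩
    rw [h2 w ((hadm w).1 hw)]
    refine enorm_vecL2_le ?_
    have h3 : ∀ c, ‖conjL2 d ℓ (iterDeriv (dirT d ℓ) w (G₁ a c) x)‖ₑ = ‖iterDeriv (dirT d ℓ) w (G₁ a c) x‖ₑ :=
      fun c => by rw [← ofReal_norm, norm_conjL2, ofReal_norm]
    refine le_trans (le_of_eq ?_) ((le_max_left _ _).trans (hle w ((hadm w).1 hw) a x))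
    congr 1
    exact Finset.sum_congr rfl fun c _ => by rw [← h3 c]; rfl
  have hB : ∀ b, CDB (dirT d ℓ) (fun _ => ()) (fun _ => k) (covH k G₁ G₂) (B b) := by
    intro a
    obtain ⟨h1, h2⟩ := hasContDerivs_pi hlen (fun c => hG₂ c a) vecL2
    refine ⟨⟨fun w hw => h1.1 w ((hadm w).1 hw), fun p w hw => h1.2 p w ((hadm _).1 hw)⟩, fun w hw x => ?_⟩
    rw [h2 w ((hadm w).1 hw)]
    exact enorm_vecL2_le ((le_max_right _ _).trans (hle w ((hadm w).1 hw) a x))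
  have hin : ∀ a b x y, G a b (x - y) = inner ℂ (A a x) (B b y) := by
    intro a b x y
    rw [hfac]
    exact (inner_vecL2 _ _).symm
  refine ⟨fun a b => ?_, fun n r c hrc a => ?_⟩
  · have h : G a b = fun x => inner ℂ (A a x) (B b 0) := by
      funext x
      rw [← hin, sub_zero]
    rw [h]
    exact (hA a).continuous.inner (𝕜 := ℂ) continuous_const
  · have h := cdb_det (C := covH k G₁ G₂) (m := fun _ => k) hrc (fun i => hA (a (r i))) (fun j => hB (a (c j)))
    convert h using 1
    funext x
    simp only [comp, hin]

end Cov

/-! ### Operations on distributions -/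

theorem summable_of_tsum_enorm_ne_top {α : Type*} {f : α → ℂ} (h : ∑' i, ‖f i‖ₑ ≠ ⊤) : Summable f := by
  simp only [enorm_eq_nnnorm] at h
  exact Summable.of_nnnorm (ENNReal.tsum_coe_ne_top_iff_summable.1 h)

theorem enorm_tsum_le {α : Type*} (f : α → ℂ) : ‖∑' i, f i‖ₑ ≤ ∑' i, ‖f i‖ₑ := by
  by_cases h : ∑' i, ‖f i‖ₑ = ⊤
  · rw [h]; exact le_top
  · have h' := h
    simp only [enorm_eq_nnnorm] at h' ⊢
    have hs := ENNReal.tsum_coe_ne_top_iff_summable.1 h'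
    rw [← ENNReal.coe_tsum hs, ENNReal.coe_le_coe]
    exact nnnorm_tsum_le hs

theorem enorm_finset_prod {α : Type*} (s : Finset α) (f : α → ℂ) : ‖∏ i ∈ s, f i‖ₑ = ∏ i ∈ s, ‖f i‖ₑ := by
  simp only [enorm_eq_nnnorm, nnnorm_prod, ENNReal.ofNNReal_finsetProd]

section Operations

variable {ι : Type} [Fintype ι] {d k : ℕ} {ℓ : ℝ} [Fact (0 < ℓ)] {V P Q : Type}
  [Fintype V] [DecidableEq V] [Fintype P] [DecidableEq P] [Fintype Q] [DecidableEq Q]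

theorem IsDistr.of_bound {u : TestFn ι d ℓ V → ℂ} {M : ℝ≥0∞} (hM : M ≠ ⊤)
    (hadd : ∀ f g, IsCk k f → IsCk k g → u (f + g) = u f + u g)
    (hsmul : ∀ (c : ℂ) f, IsCk k f → u (c • f) = c * u f)
    (h : ∀ f, IsCk k f → ‖u f‖ₑ ≤ M * ckNorm k f) : IsDistr k u :=
  ⟨hadd, hsmul, lt_of_le_of_lt (dualNorm_le h) hM.lt_top⟩

theorem isDistr_zero : IsDistr k (fun _ : TestFn ι d ℓ V => (0 : ℂ)) :=
  IsDistr.of_bound (M := 0) (by simp) (by simp) (by simp) (by simp)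

theorem dualNorm_zero : dualNorm k (fun _ : TestFn ι d ℓ V => (0 : ℂ)) = 0 :=
  le_antisymm (dualNorm_le (by simp)) bot_le

theorem IsDistr.const_mul {u : TestFn ι d ℓ V → ℂ} (hu : IsDistr k u) (c : ℂ) :
    IsDistr k (fun f => c * u f) ∧ dualNorm k (fun f => c * u f) ≤ ‖c‖ₑ * dualNorm k u := by
  have h : ∀ f, IsCk k f → ‖c * u f‖ₑ ≤ ‖c‖ₑ * dualNorm k u * ckNorm k f := fun f hf => by
    rw [enorm_mul, mul_assoc]
    gcongr
    exact hu.enorm_le hf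
  refine ⟨IsDistr.of_bound (ENNReal.mul_ne_top enorm_ne_top hu.bounded.ne) (fun f g hf hg => ?_)
    (fun c' f hf => ?_) h, dualNorm_le h⟩
  · rw [hu.map_add f g hf hg, mul_add]
  · rw [hu.map_smul c' f hf]; ring

theorem IsDistr.sum {α : Type*} (s : Finset α) {u : α → TestFn ι d ℓ V → ℂ}
    (hu : ∀ i ∈ s, IsDistr k (u i)) :
    IsDistr k (fun f => ∑ i ∈ s, u i f) ∧
      dualNorm k (fun f => ∑ i ∈ s, u i f) ≤ ∑ i ∈ s, dualNorm k (u i) := by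
  have h : ∀ f, IsCk k f → ‖∑ i ∈ s, u i f‖ₑ ≤ (∑ i ∈ s, dualNorm k (u i)) * ckNorm k f := fun f hf => by
    rw [Finset.sum_mul]
    exact (enorm_sum_le _ _).trans (Finset.sum_le_sum fun i hi => (hu i hi).enorm_le hf)
  refine ⟨IsDistr.of_bound (ENNReal.sum_ne_top.2 fun i hi => (hu i hi).bounded.ne) (fun f g hf hg => ?_)
    (fun c f hf => ?_) h, dualNorm_le h⟩
  · rw [← Finset.sum_add_distrib]
    exact Finset.sum_congr rfl fun i hi => (hu i hi).map_add f g hf hg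
  · rw [Finset.mul_sum]
    exact Finset.sum_congr rfl fun i hi => (hu i hi).map_smul c f hf

theorem IsDistr.summable {α : Type*} {u : α → TestFn ι d ℓ V → ℂ} (hu : ∀ i, IsDistr k (u i))
    (hs : ∑' i, dualNorm k (u i) ≠ ⊤) {f : TestFn ι d ℓ V} (hf : IsCk k f) : Summable fun i => u i f := by
  refine summable_of_tsum_enorm_ne_top (ne_top_of_le_ne_top ?_ (ENNReal.tsum_le_tsum fun i => (hu i).enorm_le hf))
  rw [ENNReal.tsum_mul_right]
  exact ENNReal.mul_ne_top hs hf.ckNorm_lt_top.ne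

theorem IsDistr.tsum {α : Type*} {u : α → TestFn ι d ℓ V → ℂ} (hu : ∀ i, IsDistr k (u i))
    (hs : ∑' i, dualNorm k (u i) ≠ ⊤) :
    IsDistr k (fun f => ∑' i, u i f) ∧
      dualNorm k (fun f => ∑' i, u i f) ≤ ∑' i, dualNorm k (u i) := by
  have h : ∀ f, IsCk k f → ‖∑' i, u i f‖ₑ ≤ (∑' i, dualNorm k (u i)) * ckNorm k f := fun f hf => by
    rw [← ENNReal.tsum_mul_right]
    exact (enorm_tsum_le _).trans (ENNReal.tsum_le_tsum fun i => (hu i).enorm_le hf)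
  refine ⟨IsDistr.of_bound hs (fun f g hf hg => ?_) (fun c f hf => ?_) h, dualNorm_le h⟩
  · rw [← (IsDistr.summable hu hs hf).tsum_add (IsDistr.summable hu hs hg)]
    exact tsum_congr fun i => (hu i).map_add f g hf hg
  · rw [← tsum_mul_left]
    exact tsum_congr fun i => (hu i).map_smul c f hf

/-- The tensor product of distributions. -/
theorem IsDistr.tensor {u : TestFn ι d ℓ P → ℂ} {u' : TestFn ι d ℓ Q → ℂ} (hu : IsDistr k u)
    (hu' : IsDistr k u') {e : V → P ⊕ Q} (he : Function.Injective e) :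
    IsDistr k (fun f : TestFn ι d ℓ V => u fun p => u' fun q => f fun v => Sum.elim p q (e v)) ∧
      dualNorm k (fun f : TestFn ι d ℓ V => u fun p => u' fun q => f fun v => Sum.elim p q (e v)) ≤
        dualNorm k u * dualNorm k u' := by
  have h : ∀ f : TestFn ι d ℓ V, IsCk k f → ‖u fun p => u' fun q => f fun v => Sum.elim p q (e v)‖ₑ ≤
      dualNorm k u * dualNorm k u' * ckNorm k f := fun f hf => by
    have h1 := hu'.ckB_pair hf.ckNorm_lt_top.ne hf.ckB he
    refine (hu.enorm_le h1.isCk).trans ?_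
    rw [mul_assoc]
    gcongr
    exact h1.ckNorm_le
  have hfix : ∀ (f : TestFn ι d ℓ V) (p : P → Pt ι d ℓ), IsCk k f →
      IsCk k (fun q : Q → Pt ι d ℓ => f fun v => Sum.elim p q (e v)) := by
    intro f p hf
    have := hf.fix (e := fun v => (e v).swap) (fun v v' h => he (Sum.swap_leftInverse.injective h)) p (P := Q)
    convert this using 5 with q v
    rcases e v with v | v <;> rfl
  refine ⟨IsDistr.of_bound (ENNReal.mul_ne_top hu.bounded.ne hu'.bounded.ne) (fun f g hf hg => ?_)
    (fun c f hf => ?_) h, dualNorm_le h⟩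
  · rw [← hu.map_add _ _ (hu'.isCk_pair hf he) (hu'.isCk_pair hg he)]
    congr 1
    funext p
    exact hu'.map_add _ _ (hfix f p hf) (hfix g p hg)
  · rw [← hu.map_smul c _ (hu'.isCk_pair hf he)]
    congr 1
    funext p
    exact hu'.map_smul c _ (hfix f p hf)

/-- Pullback of a distribution along an injective relabelling of the variables. -/
theorem IsDistr.relabel {u : TestFn ι d ℓ P → ℂ} (hu : IsDistr k u) {e : V → P} (he : Function.Injective e) :
    IsDistr k (fun f : TestFn ι d ℓ V => u fun p => f fun v => p (e v)) ∧
      dualNorm k (fun f : TestFn ι d ℓ V => u fun p => f fun v => p (e v)) ≤ dualNorm k u := by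
  have h : ∀ f : TestFn ι d ℓ V, IsCk k f → ‖u fun p => f fun v => p (e v)‖ₑ ≤
      dualNorm k u * ckNorm k f := fun f hf =>
    (hu.enorm_le (hf.comp_inj he)).trans (by gcongr; exact (hf.ckB.comp_inj he).ckNorm_le)
  exact ⟨IsDistr.of_bound hu.bounded.ne (fun f g hf hg => hu.map_add _ _ (hf.comp_inj he) (hg.comp_inj he))
    (fun c f hf => hu.map_smul c _ (hf.comp_inj he)) h, dualNorm_le h⟩

end Operations

/-! ### The algebra -/

section Algebra

variable {q : ℕ} {N n : Fin q → ℕ}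

/-- The position of a variable among the first or the second factor of a product. -/
def splitVar (N n : Fin q → ℕ) (v : Var N) : Var n ⊕ Var (fun s => N s - n s) :=
  if h : (v.2 : ℕ) < n v.1 then Sum.inl ⟨v.1, ⟨v.2, h⟩⟩
  else Sum.inr ⟨v.1, ⟨(v.2 : ℕ) - n v.1, Nat.sub_lt_sub_right (not_lt.mp h) v.2.isLt⟩⟩

theorem join_eq {P : Type} (p : Var n → P) (p' : Var (fun s => N s - n s) → P) (v : Var N) :
    join p p' v = Sum.elim p p' (splitVar N n v) := by
  unfold join splitVar
  split_ifs <;> rfl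

theorem var_ext {v w : Var N} (h : v.1 = w.1) (h2 : (v.2 : ℕ) = w.2) : v = w := by
  obtain ⟨s, i⟩ := v
  obtain ⟨s', i'⟩ := w
  obtain rfl : s = s' := h
  obtain rfl : i = i' := Fin.ext h2
  rfl

theorem splitVar_injective : Function.Injective (splitVar N n) := by
  rintro v w h
  unfold splitVar at h
  split_ifs at h with h1 h2 h2
  · rw [Sum.inl.injEq] at h
    have h3 := congrArg Sigma.fst h
    have h4 : (((⟨v.1, ⟨v.2, h1⟩⟩ : Var n)).2 : ℕ) = ((⟨w.1, ⟨w.2, h2⟩⟩ : Var n)).2 := by rw [h]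
    exact var_ext h3 h4
  · rw [Sum.inr.injEq] at h
    have h3 : v.1 = w.1 := congrArg (fun x : Var (fun s => N s - n s) => x.1) h
    have h4 : (v.2 : ℕ) - n v.1 = (w.2 : ℕ) - n w.1 :=
      congrArg (fun x : Var (fun s => N s - n s) => (x.2 : ℕ)) h
    have h5 : n v.1 = n w.1 := congrArg n h3
    refine var_ext h3 ?_
    omega

/-- Split the variables of a product among the two factors. -/
def splitEquiv (h : n ≤ N) : Var N ≃ Var n ⊕ Var (fun s => N s - n s) where
  toFun := splitVar N n
  invFun := Sum.elim (fun v => ⟨v.1, ⟨v.2, v.2.isLt.trans_le (h v.1)⟩⟩)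
    (fun v => ⟨v.1, ⟨n v.1 + v.2, by
      have h1 : (v.2 : ℕ) < N v.1 - n v.1 := v.2.isLt
      omega⟩⟩)
  left_inv v := by
    unfold splitVar
    split_ifs with h1
    · rfl
    · refine var_ext rfl ?_
      simp only [Sum.elim_inr]
      omega
  right_inv v := by
    rcases v with v | v
    · have : (v.2 : ℕ) < n v.1 := v.2.isLt
      simp [splitVar]
    · simp [splitVar]

theorem permVar_injective (π : (s : Fin q) → Equiv.Perm (Fin (N s))) : Function.Injective (permVar π) := by
  rintro ⟨s, i⟩ ⟨s', i'⟩ h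
  obtain rfl : s = s' := congrArg Sigma.fst h
  simp only [permVar, Sigma.mk.injEq, heq_eq_eq, true_and, EmbeddingLike.apply_eq_iff_eq] at h
  rw [h]

theorem permVar_mul (π σ : (s : Fin q) → Equiv.Perm (Fin (N s))) (v : Var N) :
    permVar (π * σ) v = permVar π (permVar σ v) := rfl

theorem signs_mul (π σ : (s : Fin q) → Equiv.Perm (Fin (N s))) : signs (π * σ) = signs π * signs σ := by
  simp [signs, Finset.prod_mul_distrib]

theorem signs_mul_self (π : (s : Fin q) → Equiv.Perm (Fin (N s))) : signs π * signs π = 1 := by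
  simp only [signs, ← Finset.prod_mul_distrib]
  refine Finset.prod_eq_one fun s _ => ?_
  rw [← Int.cast_mul, ← Units.val_mul, Int.units_mul_self]
  simp

theorem enorm_signs (π : (s : Fin q) → Equiv.Perm (Fin (N s))) : ‖signs π‖ₑ = 1 := by
  have h := congrArg (‖·‖) (signs_mul_self π)
  simp only [norm_mul, norm_one] at h
  have h2 : ‖signs π‖ = 1 := by nlinarith [norm_nonneg (signs π)]
  rw [← ofReal_norm, h2, ENNReal.ofReal_one]

theorem enorm_reorderSign (n n' : Fin q → ℕ) : ‖reorderSign n n'‖ₑ = 1 := by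
  have h2 : ‖reorderSign n n'‖ = 1 := by
    rw [reorderSign, norm_prod]
    refine Finset.prod_eq_one fun s _ => ?_
    rw [norm_prod]
    refine Finset.prod_eq_one fun s' _ => ?_
    split_ifs <;> simp
  rw [← ofReal_norm, h2, ENNReal.ofReal_one]

variable {ι : Type} [Fintype ι] {d k : ℕ} {ℓ : ℝ} [Fact (0 < ℓ)] {h : Fin q → ℝ≥0∞}
  {F H : Elem ι d ℓ q}

/-- The weight of the degree `N` in the norm. -/
def weight (h : Fin q → ℝ≥0∞) (N : Fin q → ℕ) : ℝ≥0∞ := ∏ s, h s ^ N s / ((N s).factorial : ℝ≥0∞)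

theorem gNorm_eq : gNorm k h F = ∑' N, weight h N * dualNorm k (F N) := rfl

theorem MemG.weight_mul_le (_ : MemG k h F) (N : Fin q → ℕ) : weight h N * dualNorm k (F N) ≤ gNorm k h F :=
  ENNReal.le_tsum (f := fun N => weight h N * dualNorm k (F N)) N

/-- Each of the `∏ N_s!` permutations contributes at most `‖F_n‖ ‖H_{N-n}‖`; with the reciprocal
factorials this gives binomial coefficients. -/
theorem isDistr_mul (hF : ∀ N, IsDistr k (F N)) (hH : ∀ N, IsDistr k (H N)) (N : Fin q → ℕ) :
    IsDistr k (mul F H N) ∧ dualNorm k (mul F H N) ≤ ∑ n ∈ Finset.Icc 0 N,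
      (∏ s, ((N s).factorial : ℝ≥0∞) / (((n s).factorial : ℝ≥0∞) * ((N s - n s).factorial : ℝ≥0∞))) *
        (dualNorm k (F n) * dualNorm k (H fun s => N s - n s)) := by
  have h1 : ∀ n ∈ Finset.Icc 0 N, ∀ π : (s : Fin q) → Equiv.Perm (Fin (N s)), _ := fun n _ π =>
    ((hF n).tensor (hH fun s => N s - n s)
      (splitVar_injective.comp (permVar_injective π))).1.const_mul (signs π)
  have h1' : ∀ n π, _ := fun n (π : (s : Fin q) → Equiv.Perm (Fin (N s))) =>
    ((hF n).tensor (hH fun s => N s - n s)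
      (splitVar_injective.comp (permVar_injective π))).2
  have h2 := fun n hn => IsDistr.sum Finset.univ fun π _ => (h1 n hn π).1
  have h3 := fun n hn => (h2 n hn).1.const_mul (reorderSign n (fun s => N s - n s) *
    (∏ s, (1 / (((n s).factorial : ℂ) * ((N s - n s).factorial : ℂ)))))
  have h4 := IsDistr.sum (Finset.Icc 0 N) fun n hn => (h3 n hn).1
  have heq : mul F H N = fun f => ∑ n ∈ Finset.Icc 0 N, (reorderSign n (fun s => N s - n s) *
    (∏ s, (1 / (((n s).factorial : ℂ) * ((N s - n s).factorial : ℂ)))) *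
    ∑ π : (s : Fin q) → Equiv.Perm (Fin (N s)), signs π * F n fun p => H (fun s => N s - n s) fun p' =>
      f fun v => Sum.elim p p' ((splitVar N n ∘ permVar π) v)) := by
    funext f
    simp only [mul, join_eq, Function.comp]
  rw [heq]
  refine ⟨h4.1, h4.2.trans (Finset.sum_le_sum fun n hn => (h3 n hn).2.trans ?_)⟩
  have h5 : ‖reorderSign n (fun s => N s - n s) *
      ∏ s, (1 / (((n s).factorial : ℂ) * ((N s - n s).factorial : ℂ)))‖ₑ =
      ∏ s, (((n s).factorial : ℝ≥0∞) * ((N s - n s).factorial : ℝ≥0∞))⁻¹ := by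
    rw [enorm_mul, enorm_reorderSign, one_mul, enorm_finset_prod]
    refine Finset.prod_congr rfl fun s _ => ?_
    rw [one_div, enorm_inv (by exact_mod_cast mul_ne_zero (Nat.factorial_ne_zero _) (Nat.factorial_ne_zero _)), enorm_mul]
    simp only [← ofReal_norm, Complex.norm_natCast, ENNReal.ofReal_natCast]
  rw [h5]
  calc _ ≤ (∏ s, (((n s).factorial : ℝ≥0∞) * ((N s - n s).factorial : ℝ≥0∞))⁻¹) *
        ∑ _π : (s : Fin q) → Equiv.Perm (Fin (N s)), dualNorm k (F n) * dualNorm k (H fun s => N s - n s) := by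
        gcongr
        refine (h2 n hn).2.trans (Finset.sum_le_sum fun π _ => ((h1 n hn π).2).trans ?_)
        rw [enorm_signs, one_mul]
        exact h1' n π
    _ = _ := by
        rw [Finset.sum_const, Finset.card_univ, Fintype.card_pi, nsmul_eq_mul, ← mul_assoc]
        congr 1
        push_cast
        rw [← Finset.prod_mul_distrib]
        refine Finset.prod_congr rfl fun s _ => ?_
        rw [Fintype.card_perm, Fintype.card_fin, mul_comm, div_eq_mul_inv]

/-- The factorials in the weight absorb the binomial coefficients, which makes the norm
submultiplicative. -/
theorem weight_split {n : Fin q → ℕ} (hn : n ≤ N) :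
    weight h N * (∏ s, ((N s).factorial : ℝ≥0∞) / (((n s).factorial : ℝ≥0∞) * ((N s - n s).factorial : ℝ≥0∞)))
      = weight h n * weight h fun s => N s - n s := by
  simp only [weight]
  rw [← Finset.prod_mul_distrib, ← Finset.prod_mul_distrib]
  refine Finset.prod_congr rfl fun s _ => ?_
  have h0 : ∀ m : ℕ, (m.factorial : ℝ≥0∞) ≠ 0 := fun m => by exact_mod_cast m.factorial_ne_zero
  have ht : ∀ m : ℕ, (m.factorial : ℝ≥0∞) ≠ ⊤ := fun m => ENNReal.natCast_ne_top _
  have hp : h s ^ N s = h s ^ n s * h s ^ (N s - n s) := by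
    rw [← pow_add, Nat.add_sub_cancel' (hn s)]
  rw [hp, div_eq_mul_inv, div_eq_mul_inv, div_eq_mul_inv, div_eq_mul_inv,
    ENNReal.mul_inv (Or.inl (h0 _)) (Or.inl (ht _))]
  calc _ = h s ^ n s * h s ^ (N s - n s) * (((N s).factorial : ℝ≥0∞)⁻¹ * ((N s).factorial : ℝ≥0∞)) *
        (((n s).factorial : ℝ≥0∞)⁻¹ * ((N s - n s).factorial : ℝ≥0∞)⁻¹) := by ring
    _ = _ := by rw [ENNReal.inv_mul_cancel (h0 _) (ht _)]; ring

/-- The sum over `N` and `n ≤ N` is part of a double sum over pairs of degrees, since `(N, n) ↦ (n,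
N - n)` is injective there. -/
theorem gNorm_mul_le (hF : ∀ N, IsDistr k (F N)) (hH : ∀ N, IsDistr k (H N)) :
    gNorm k h (mul F H) ≤ gNorm k h F * gNorm k h H := by
  simp only [gNorm_eq]
  calc _ ≤ ∑' N, ∑ n ∈ Finset.Icc 0 N, (weight h n * dualNorm k (F n)) *
        (weight h (fun s => N s - n s) * dualNorm k (H fun s => N s - n s)) := by
        refine ENNReal.tsum_le_tsum fun N => ?_
        refine (mul_le_mul_right (isDistr_mul hF hH N).2 _).trans (le_of_eq ?_)
        rw [Finset.mul_sum]
        refine Finset.sum_congr rfl fun n hn => ?_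
        rw [← mul_assoc, weight_split (Finset.mem_Icc.1 hn).2]
        ring
    _ = ∑' x : (Σ N : Fin q → ℕ, {n // n ∈ Finset.Icc 0 N}),
        (weight h x.2.1 * dualNorm k (F x.2.1)) *
        (weight h (fun s => x.1 s - x.2.1 s) * dualNorm k (H fun s => x.1 s - x.2.1 s)) := by
        rw [ENNReal.tsum_sigma']
        refine tsum_congr fun N => ?_
        rw [← Finset.tsum_subtype]
    _ ≤ ∑' x : (Fin q → ℕ) × (Fin q → ℕ), (weight h x.1 * dualNorm k (F x.1)) *
        (weight h x.2 * dualNorm k (H x.2)) := by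
        refine ENNReal.tsum_comp_le_tsum_of_injective
          (f := fun x : (Σ N : Fin q → ℕ, {n // n ∈ Finset.Icc 0 N}) =>
            ((x.2.1, fun s => x.1 s - x.2.1 s) : (Fin q → ℕ) × (Fin q → ℕ))) ?_
          (fun x => (weight h x.1 * dualNorm k (F x.1)) * (weight h x.2 * dualNorm k (H x.2)))
        rintro ⟨N, n, hn⟩ ⟨N', n', hn'⟩ heq
        simp only [Prod.mk.injEq] at heq
        obtain ⟨rfl, h2⟩ := heq
        have : N = N' := by
          funext s
          have h3 : N s - n s = N' s - n s := congrFun h2 s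
          have h4 : n s ≤ N s := (Finset.mem_Icc.1 hn).2 s
          have h5 : n s ≤ N' s := (Finset.mem_Icc.1 hn').2 s
          omega
        subst this
        rfl
    _ = _ := by
        rw [ENNReal.tsum_prod', ← ENNReal.tsum_mul_right]
        refine tsum_congr fun n => ?_
        exact ENNReal.tsum_mul_left (a := weight h n * dualNorm k (F n))
          (f := fun b => weight h b * dualNorm k (H b))

theorem MemG.mul (hF : MemG k h F) (hH : MemG k h H) : MemG k h (Grassmann.mul F H) where
  distr N := (isDistr_mul hF.distr hH.distr N).1
  antisymm N σ f _ := by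
    simp only [Grassmann.mul]
    rw [Finset.mul_sum]
    refine Finset.sum_congr rfl fun n _ => ?_
    rw [mul_left_comm]
    congr 1
    rw [Finset.mul_sum]
    -- Right translation by `σ` in the sum over permutations produces the sign of `σ`.
    refine Fintype.sum_equiv (Equiv.mulRight σ) _ _ fun π => ?_
    simp only [Equiv.coe_mulRight, permVar_mul, signs_mul]
    linear_combination (-signs π * F n fun p => H (fun s => N s - n s) fun p' =>
      f fun v => join p p' (permVar π (permVar σ v))) * signs_mul_self σ
  norm_lt_top := lt_of_le_of_lt (gNorm_mul_le hF.distr hH.distr)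
    (ENNReal.mul_lt_top hF.norm_lt_top hH.norm_lt_top)

theorem isEmpty_var_iff : IsEmpty (Var N) ↔ N = 0 := by
  constructor
  · intro h
    funext s
    by_contra h0
    exact h.elim ⟨s, ⟨0, Nat.pos_of_ne_zero h0⟩⟩
  · rintro rfl
    exact ⟨fun v => v.2.elim0⟩

theorem isDistr_one (N : Fin q → ℕ) : IsDistr k (one ι d ℓ q N) ∧ dualNorm k (one ι d ℓ q N) ≤ 1 := by
  have h : ∀ f, IsCk k f → ‖one ι d ℓ q N f‖ₑ ≤ 1 * ckNorm k f := fun f hf => by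
    unfold one
    split_ifs with h
    · rw [one_mul]
      exact (hf.ckB (fun v => h.elim v)).bound (fun v => h.elim v) |> fun h => by
        convert h using 2
        simp only [comp]
        congr 1
        funext v
        exact (isEmpty_var_iff.2 (isEmpty_var_iff.1 ‹_›)).elim v
    · simp
  refine ⟨IsDistr.of_bound ENNReal.one_ne_top (fun f g _ _ => ?_) (fun c f _ => ?_) h, dualNorm_le h⟩
  · unfold one; split_ifs <;> simp
  · unfold one; split_ifs <;> simp

theorem gNorm_one_le : gNorm k h (one ι d ℓ q) ≤ 1 := by
  rw [gNorm_eq, tsum_eq_single 0]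
  · simpa [weight] using (isDistr_one (0 : Fin q → ℕ)).2
  · intro N hN
    have h : one ι d ℓ q N = fun _ => 0 := by
      funext f
      exact dif_neg (mt isEmpty_var_iff.1 hN)
    rw [h, dualNorm_zero, mul_zero]

theorem memG_one : MemG k h (one ι d ℓ q) where
  distr N := (isDistr_one N).1
  antisymm N π f _ := by
    unfold one
    split_ifs with h
    · have h1 : signs π = 1 := by
        have : N = 0 := isEmpty_var_iff.1 h
        subst this
        refine Finset.prod_eq_one fun s _ => ?_
        have : π s = 1 := Equiv.ext fun i => i.elim0
        simp [this]
      rw [h1, one_mul]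
      congr 1
    · simp
  norm_lt_top := lt_of_le_of_lt gNorm_one_le ENNReal.one_lt_top

theorem MemG.pow (hF : MemG k h F) (j : ℕ) :
    MemG k h (Grassmann.pow F j) ∧ gNorm k h (Grassmann.pow F j) ≤ gNorm k h F ^ j := by
  induction j with
  | zero => exact ⟨memG_one, by rw [pow_zero]; exact gNorm_one_le⟩
  | succ j ih =>
    refine ⟨hF.mul ih.1, (gNorm_mul_le hF.distr ih.1.distr).trans ?_⟩
    rw [pow_succ']
    gcongr
    exact ih.2

theorem tsum_pow_div_factorial_ne_top {x : ℝ≥0∞} (hx : x ≠ ⊤) :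
    ∑' j : ℕ, (1 / (j.factorial : ℝ≥0∞)) * x ^ j ≠ ⊤ := by
  lift x to ℝ≥0 using hx
  have h : ∀ j : ℕ, (1 / (j.factorial : ℝ≥0∞)) * (x : ℝ≥0∞) ^ j = ((x ^ j / (j.factorial : ℝ≥0) : ℝ≥0) : ℝ≥0∞) := by
    intro j
    rw [ENNReal.coe_div (by exact_mod_cast j.factorial_ne_zero)]
    push_cast
    rw [one_div, mul_comm, div_eq_mul_inv]
  simp only [h]
  rw [ENNReal.tsum_coe_ne_top_iff_summable_coe]
  simpa using Real.summable_pow_div_factorial (x : ℝ)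

theorem weight_ne_zero (hh : ∀ s, h s ≠ 0) (N : Fin q → ℕ) : weight h N ≠ 0 := by
  refine Finset.prod_ne_zero_iff.2 fun s _ => ?_
  rw [Ne, ENNReal.div_eq_zero_iff]
  push Not
  exact ⟨pow_ne_zero _ (hh s), ENNReal.natCast_ne_top _⟩

theorem enorm_one_div_factorial (j : ℕ) : ‖(1 / (j.factorial : ℂ))‖ₑ = 1 / (j.factorial : ℝ≥0∞) := by
  rw [one_div, one_div, enorm_inv (by exact_mod_cast j.factorial_ne_zero)]
  simp only [← ofReal_norm, Complex.norm_natCast, ENNReal.ofReal_natCast]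

/-- Convergence in a single degree is extracted from the exponential series of norms; this requires
a nonzero weight in that degree. -/
theorem tsum_dualNorm_pow (hh : ∀ s, h s ≠ 0) (hF : MemG k h F) (N : Fin q → ℕ) :
    ∑' j : ℕ, dualNorm k (fun f => (1 / (j.factorial : ℂ)) * Grassmann.pow F j N f) ≠ ⊤ := by
  have h1 : weight h N * ∑' j : ℕ, dualNorm k (fun f => (1 / (j.factorial : ℂ)) * Grassmann.pow F j N f) ≤
      ∑' j : ℕ, (1 / (j.factorial : ℝ≥0∞)) * gNorm k h F ^ j := by
    rw [← ENNReal.tsum_mul_left]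
    refine ENNReal.tsum_le_tsum fun j => ?_
    refine (mul_le_mul_right (((hF.pow j).1.distr N).const_mul _).2 _).trans ?_
    rw [enorm_one_div_factorial, mul_left_comm]
    gcongr
    exact ((hF.pow j).1.weight_mul_le N).trans (hF.pow j).2
  intro h2
  rw [h2, ENNReal.mul_top (weight_ne_zero hh N)] at h1
  exact tsum_pow_div_factorial_ne_top hF.norm_lt_top.ne (top_le_iff.1 h1)

theorem MemG.exp (hh : ∀ s, h s ≠ 0) (hF : MemG k h F) : MemG k h (Grassmann.exp F) where
  distr N := (IsDistr.tsum (fun j => (((hF.pow j).1.distr N).const_mul _).1) (tsum_dualNorm_pow hh hF N)).1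
  antisymm N π f hf := by
    simp only [Grassmann.exp]
    rw [← tsum_mul_left]
    refine tsum_congr fun j => ?_
    rw [(hF.pow j).1.antisymm N π f hf, mul_left_comm]
  norm_lt_top := by
    refine lt_of_le_of_lt ?_ (tsum_pow_div_factorial_ne_top hF.norm_lt_top.ne).lt_top
    calc gNorm k h (Grassmann.exp F) ≤ ∑' N, ∑' j : ℕ, (1 / (j.factorial : ℝ≥0∞)) * (weight h N *
          dualNorm k (Grassmann.pow F j N)) := by
          refine ENNReal.tsum_le_tsum fun N => ?_
          refine (mul_le_mul_right (IsDistr.tsum (fun j => (((hF.pow j).1.distr N).const_mul _).1)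
            (tsum_dualNorm_pow hh hF N)).2 _).trans ?_
          rw [← ENNReal.tsum_mul_left]
          refine ENNReal.tsum_le_tsum fun j => ?_
          refine (mul_le_mul_right (((hF.pow j).1.distr N).const_mul _).2 _).trans ?_
          rw [enorm_one_div_factorial, mul_left_comm]
          rfl
      _ = ∑' j : ℕ, (1 / (j.factorial : ℝ≥0∞)) * gNorm k h (Grassmann.pow F j) := by
          rw [ENNReal.tsum_comm]
          simp only [ENNReal.tsum_mul_left, gNorm_eq]
      _ ≤ _ := ENNReal.tsum_le_tsum fun j => by
          gcongr
          exact (hF.pow j).2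

end Algebra

/-! ### Distributions given by integration -/

section IntDistr

variable {ι : Type} [Fintype ι] {d k : ℕ} {ℓ : ℝ} [Fact (0 < ℓ)] {V W P Q : Type}
  [Fintype V] [DecidableEq V] [Fintype W] [DecidableEq W] [Fintype P] [DecidableEq P]
  [Fintype Q] [DecidableEq Q]

theorem ptInt_unit (g : TestFn ι d ℓ Unit) : ptInt g = ∑ a, ∫ x : Torus d ℓ, g fun _ => (a, x) := by
  unfold ptInt
  rw [← (Equiv.funUnique Unit ι).symm.sum_comp]
  refine Finset.sum_congr rfl fun a _ => ?_
  rw [← (volume_preserving_funUnique Unit (Torus d ℓ)).symm.integral_comp']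
  rfl

theorem ContTF.bounded {g : TestFn ι d ℓ V} (hg : ContTF g) : ∃ M : ℝ≥0, ∀ p, ‖g p‖ₑ ≤ M := by
  have : ∀ a, ∃ M : ℝ≥0, ∀ x, ‖comp g a x‖ₑ ≤ M := by
    intro a
    obtain ⟨M, hM⟩ := (isCompact_univ.image (continuous_nnnorm.comp (hg a))).bddAbove
    refine ⟨M, fun x => ?_⟩
    rw [enorm_eq_nnnorm, ENNReal.coe_le_coe]
    exact hM ⟨x, trivial, rfl⟩
  choose M hM using this
  obtain ⟨B, hB⟩ := (Set.finite_range M).bddAbove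
  exact ⟨B, fun p => (hM (fun v => (p v).1) fun v => (p v).2).trans (ENNReal.coe_le_coe.2 (hB ⟨_, rfl⟩))⟩

theorem ContTF.mul {f g : TestFn ι d ℓ V} (hf : ContTF f) (hg : ContTF g) : ContTF (fun p => f p * g p) :=
  fun a => (hf a).mul (hg a)

theorem ptInt_add {f g : TestFn ι d ℓ V} (hf : ContTF f) (hg : ContTF g) :
    ptInt (fun p => f p + g p) = ptInt f + ptInt g := by
  simp only [ptInt, comp]
  rw [← Finset.sum_add_distrib]
  exact Finset.sum_congr rfl fun a _ => integral_add (integrable_torus _ (hf a)) (integrable_torus _ (hg a))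

theorem IsCk.enorm_le {f : TestFn ι d ℓ V} (hf : IsCk k f) (p : V → Pt ι d ℓ) : ‖f p‖ₑ ≤ ckNorm k f :=
  (hf.ckB fun v => (p v).1).bound fun v => (p v).2

/-- Integration against a continuous function, possibly with some variables identified. -/
theorem isDistr_ptInt {ρ : TestFn ι d ℓ W} (hρ : ContTF ρ) (e : V → W) :
    IsDistr k (fun f : TestFn ι d ℓ V => ptInt fun q : W → Pt ι d ℓ => ρ q * f fun v => q (e v)) := by
  obtain ⟨M, hM⟩ := hρ.bounded
  refine IsDistr.of_bound (M := (∑ _a : W → ι, volume (Set.univ : Set (W → Torus d ℓ))) * M)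
    (ENNReal.mul_ne_top ptVol_ne_top ENNReal.coe_ne_top) (fun f g hf hg => ?_) (fun c f _ => ?_) fun f hf => ?_
  · rw [← ptInt_add (hρ.mul (hf.contTF.comp_any e)) (hρ.mul (hg.contTF.comp_any e))]
    simp only [Pi.add_apply, mul_add]
  · rw [← ptInt_smul]
    simp only [Pi.smul_apply, smul_eq_mul, mul_left_comm]
  · rw [mul_assoc]
    refine enorm_ptInt_le fun p => ?_
    rw [enorm_mul]
    exact mul_le_mul' (hM p) (hf.enorm_le _)

theorem contTF_one : ContTF (fun _ => 1 : TestFn ι d ℓ V) := fun _ => continuous_const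

end IntDistr

/-! ### The quadratic elements, and `F` as an element of the larger algebra -/

section Elements

variable {ι : Type} [Fintype ι] {d k q : ℕ} {ℓ : ℝ} [Fact (0 < ℓ)] {h : Fin q → ℝ≥0∞}

/-- An element of a single degree, at most `1` in each of the fields. -/
theorem memG_of_support {F : Elem ι d ℓ q} {N₀ : Fin q → ℕ} (h0 : ∀ N, N ≠ N₀ → F N = fun _ => 0)
    (h1 : IsDistr k (F N₀)) (hN : ∀ s, N₀ s ≤ 1) (hh : ∀ s, h s ≠ ⊤) : MemG k h F where
  distr N := by
    by_cases hN' : N = N₀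
    · rw [hN']; exact h1
    · rw [h0 N hN']; exact isDistr_zero
  antisymm N π f _ := by
    by_cases hN' : N = N₀
    · subst hN'
      have hs : ∀ s, Subsingleton (Fin (N s)) := fun s => Fin.subsingleton_iff_le_one.2 (hN s)
      have hπ : π = 1 := funext fun s => Subsingleton.elim _ _
      subst hπ
      have : signs (1 : (s : Fin q) → Equiv.Perm (Fin (N s))) = 1 := by simp [signs]
      rw [this, one_mul]
      rfl
    · rw [h0 N hN']; simp
  norm_lt_top := by
    rw [gNorm_eq, tsum_eq_single N₀]
    · refine ENNReal.mul_lt_top ?_ h1.bounded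
      refine ENNReal.prod_lt_top fun s _ => ?_
      exact ENNReal.div_lt_top (ENNReal.pow_ne_top (hh s)) (by exact_mod_cast Nat.factorial_ne_zero _)
    · intro N hN'
      rw [h0 N hN', dualNorm_zero, mul_zero]

theorem MemG.add {F H : Elem ι d ℓ q} (hF : MemG k h F) (hH : MemG k h H) :
    MemG k h (fun N f => F N f + H N f) := by
  -- Written as a sum over `Bool` so that `IsDistr.sum` applies.
  have h1 : ∀ N f, F N f + H N f = ∑ b : Bool, (if b then F else H) N f := by
    intro N f
    simp
  have h2 := fun N => IsDistr.sum (k := k) Finset.univ (u := fun b : Bool => (if b then F else H) N)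
    (by rintro (_ | _) _ <;> simp [hF.distr, hH.distr])
  simp only [h1]
  refine ⟨fun N => (h2 N).1, fun N π f hf => ?_, ?_⟩
  · simp [hF.antisymm N π f hf, hH.antisymm N π f hf, mul_add]
  · refine lt_of_le_of_lt ?_ (ENNReal.add_lt_top.2 ⟨hF.norm_lt_top, hH.norm_lt_top⟩)
    rw [gNorm_eq, gNorm_eq, gNorm_eq, ← ENNReal.tsum_add]
    refine ENNReal.tsum_le_tsum fun N => ?_
    rw [← mul_add]
    gcongr
    simpa using (h2 N).2

theorem MemG.mono {F : Elem ι d ℓ q} {h' : Fin q → ℝ≥0∞} (hF : MemG k h F) (hle : ∀ s, h' s ≤ h s) :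
    MemG k h' F where
  distr := hF.distr
  antisymm := hF.antisymm
  norm_lt_top := by
    refine lt_of_le_of_lt (ENNReal.tsum_le_tsum fun N => ?_) hF.norm_lt_top
    gcongr with s
    exact hle s

theorem memG_pairJbarPsi {h : Fin 4 → ℝ≥0∞} (hh : ∀ s, h s ≠ ⊤) : MemG k h (pairJbarPsi ι d ℓ) := by
  refine memG_of_support (N₀ := ![1, 0, 0, 1]) (fun N hN => ?_) ?_ ?_ hh
  · funext f
    simp [pairJbarPsi, hN]
  · have h1 := ((isDistr_ptInt (k := k) (V := Var ![1, 0, 0, 1]) (contTF_one (ι := ι) (d := d) (ℓ := ℓ) (V := Unit))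
      (fun _ => ())).const_mul (-1)).1
    convert h1 using 1
    funext f
    simp [pairJbarPsi, ptInt_unit]
  · decide

theorem memG_pairPsibarJ {h : Fin 4 → ℝ≥0∞} (hh : ∀ s, h s ≠ ⊤) : MemG k h (pairPsibarJ ι d ℓ) := by
  refine memG_of_support (N₀ := ![0, 1, 1, 0]) (fun N hN => ?_) ?_ ?_ hh
  · funext f
    simp [pairPsibarJ, hN]
  · have h1 := isDistr_ptInt (k := k) (V := Var ![0, 1, 1, 0]) (contTF_one (ι := ι) (d := d) (ℓ := ℓ) (V := Unit))
      (fun _ => ())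
    convert h1 using 1
    funext f
    simp [pairPsibarJ, ptInt_unit]
  · decide

theorem contTF_cov {G : ι → ι → Torus d ℓ → ℂ} (hG : ∀ a b, Continuous (G a b)) {V : Type}
    [Fintype V] [DecidableEq V] (v v' : V) :
    ContTF (fun q : V → Pt ι d ℓ => G (q v).1 (q v').1 ((q v).2 - (q v').2)) := fun a =>
  (hG _ _).comp (by fun_prop : Continuous fun x : V → Torus d ℓ => x v - x v')

/-- Continuity makes the iterated integrals an integral over both points at once, which
`isDistr_ptInt` can handle. -/
theorem pairJbarGJ_eq {G : ι → ι → Torus d ℓ → ℂ} (hG : ∀ a b, Continuous (G a b))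
    {N : Fin 2 → ℕ} (hN : N = ![1, 1]) {f : TestFn ι d ℓ (Var N)} (hf : ContTF f) :
    pairJbarGJ G N f = -ptInt fun q : Unit ⊕ Unit → Pt ι d ℓ =>
      G (q (Sum.inl ())).1 (q (Sum.inr ())).1 ((q (Sum.inl ())).2 - (q (Sum.inr ())).2) *
      f fun v => q (if v.1 = 0 then Sum.inr () else Sum.inl ()) := by
  have hc : ContTF fun q : Unit ⊕ Unit → Pt ι d ℓ =>
      G (q (Sum.inl ())).1 (q (Sum.inr ())).1 ((q (Sum.inl ())).2 - (q (Sum.inr ())).2) *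
      f fun v => q (if v.1 = 0 then Sum.inr () else Sum.inl ()) :=
    (contTF_cov hG _ _).mul (hf.comp_any _)
  rw [ptInt_sum hc, pairJbarGJ, if_pos hN]
  simp only [ptInt_unit, Sum.elim_inl, Sum.elim_inr]
  congr 1
  refine Finset.sum_congr rfl fun a _ => ?_
  have hcc : ∀ b, Continuous fun z : Torus d ℓ × Torus d ℓ =>
      G a b (z.1 - z.2) * f fun v => if v.1 = 0 then (b, z.2) else (a, z.1) := by
    intro b
    refine ((hG a b).comp (by fun_prop)).mul ?_
    have := (hf fun v => if v.1 = 0 then b else a).comp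
      (by
        refine continuous_pi fun v => ?_
        split_ifs <;> fun_prop : Continuous fun (z : Torus d ℓ × Torus d ℓ) (v : Var N) =>
        if v.1 = 0 then z.2 else z.1)
    convert this using 1
    funext z
    simp only [Function.comp, comp]
    congr 1
    funext v
    split_ifs <;> rfl
  rw [← integral_finsetSum]
  · refine integral_congr_ae (Filter.Eventually.of_forall fun x => ?_)
    refine Finset.sum_congr rfl fun b _ => ?_
    refine integral_congr_ae (Filter.Eventually.of_forall fun y => ?_)
    simp only
    congr 2
    funext v
    split_ifs <;> rfl
  · intro b _
    exact (integrable_torus (volume.prod volume) (hcc b)).integral_prod_left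

theorem memG_pairJbarGJ {h : Fin 2 → ℝ≥0∞} (hh : ∀ s, h s ≠ ⊤) {G : ι → ι → Torus d ℓ → ℂ}
    (hG : ∀ a b, Continuous (G a b)) : MemG k h (pairJbarGJ G) := by
  refine memG_of_support (N₀ := ![1, 1]) (fun N hN => ?_) ?_ ?_ hh
  · funext f
    simp [pairJbarGJ, hN]
  · have h1 := ((isDistr_ptInt (k := k) (V := Var ![1, 1]) (contTF_cov hG (Sum.inl () : Unit ⊕ Unit) (Sum.inr ()))
      (fun v => if v.1 = 0 then Sum.inr () else Sum.inl ())).const_mul (-1)).1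
    -- The formula `pairJbarGJ_eq` holds only on continuous functions, so the two functionals are
    -- not identified; the properties are transferred one at a time.
    refine ⟨fun f g hf hg => ?_, fun c f hf => ?_, ?_⟩
    · rw [pairJbarGJ_eq hG rfl hf.contTF, pairJbarGJ_eq hG rfl hg.contTF, pairJbarGJ_eq hG rfl (hf.add hg).contTF]
      have := h1.map_add f g hf hg
      simpa using this
    · rw [pairJbarGJ_eq hG rfl hf.contTF, pairJbarGJ_eq hG rfl (hf.smul c).contTF]
      have := h1.map_smul c f hf
      simpa using this
    · refine lt_of_le_of_lt (le_of_eq ?_) h1.bounded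
      unfold dualNorm
      refine iSup_congr fun f => iSup_congr fun hf => ?_
      rw [pairJbarGJ_eq hG rfl hf.contTF]
      simp only [neg_one_mul]
  · decide

/-! ### The elements `F(ψ, ψ̄)` with the additional fields `J, J̄` -/

/-- The variables of `ψ, ψ̄` if there are no others. -/
def embedVar {N : Fin 4 → ℕ} (h : N 2 = 0 ∧ N 3 = 0) : Var N → Var ![N 0, N 1]
  | ⟨0, i⟩ => ⟨0, i⟩
  | ⟨1, i⟩ => ⟨1, i⟩
  | ⟨2, i⟩ => (Fin.cast h.1 i).elim0
  | ⟨3, i⟩ => (Fin.cast h.2 i).elim0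

theorem embedVar_val {N : Fin 4 → ℕ} (h : N 2 = 0 ∧ N 3 = 0) (v : Var N) :
    ((embedVar h v).1 : ℕ) = v.1 ∧ ((embedVar h v).2 : ℕ) = v.2 := by
  match v with
  | ⟨0, i⟩ => exact ⟨rfl, rfl⟩
  | ⟨1, i⟩ => exact ⟨rfl, rfl⟩
  | ⟨2, i⟩ => exact (Fin.cast h.1 i).elim0
  | ⟨3, i⟩ => exact (Fin.cast h.2 i).elim0

theorem embedVar_injective {N : Fin 4 → ℕ} (h : N 2 = 0 ∧ N 3 = 0) : Function.Injective (embedVar h) := by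
  intro v w hvw
  have h1 := embedVar_val h v
  rw [hvw] at h1
  have h2 := embedVar_val h w
  exact var_ext (Fin.ext (h1.1.symm.trans h2.1)) (h1.2.symm.trans h2.2)

theorem embed_eq (F : Elem ι d ℓ 2) {N : Fin 4 → ℕ} (h : N 2 = 0 ∧ N 3 = 0) (f : TestFn ι d ℓ (Var N)) :
    embed F N f = F ![N 0, N 1] fun p => f fun v => p (embedVar h v) := by
  rw [embed, dif_pos h]
  congr 1
  funext p
  congr 1
  funext v
  match v with
  | ⟨0, i⟩ => rfl
  | ⟨1, i⟩ => rfl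
  | ⟨2, i⟩ => exact (Fin.cast h.1 i).elim0
  | ⟨3, i⟩ => exact (Fin.cast h.2 i).elim0

/-- A pair of permutations as a family indexed by `Fin 2`. -/
def permPair {a b : ℕ} (σ : Equiv.Perm (Fin a)) (τ : Equiv.Perm (Fin b)) :
    (s : Fin 2) → Equiv.Perm (Fin (![a, b] s))
  | 0 => σ
  | 1 => τ

theorem signs_permPair {a b : ℕ} (σ : Equiv.Perm (Fin a)) (τ : Equiv.Perm (Fin b)) :
    signs (permPair σ τ) = ((Equiv.Perm.sign σ : ℤ) : ℂ) * ((Equiv.Perm.sign τ : ℤ) : ℂ) := by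
  rw [signs, Fin.prod_univ_two]
  rfl

theorem vec2_eta (M : Fin 2 → ℕ) : ![M 0, M 1] = M := by
  funext s
  fin_cases s <;> rfl

/-- Only degrees without `J, J̄` occur, so the norm sum runs over the image of an injection of
degrees and `h'` enters only with exponent zero. -/
theorem MemG.embed {F : Elem ι d ℓ 2} {h h' : ℝ≥0∞} (hF : MemG k ![h, h] F) :
    MemG k ![h, h, h', h'] (Grassmann.embed F) where
  distr N := by
    by_cases hN : N 2 = 0 ∧ N 3 = 0
    · simp only [funext fun f => embed_eq F hN f]
      exact ((hF.distr _).relabel (embedVar_injective hN)).1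
    · have : Grassmann.embed F N = fun _ => 0 := funext fun f => dif_neg hN
      rw [this]
      exact isDistr_zero
  antisymm N π f hf := by
    by_cases hN : N 2 = 0 ∧ N 3 = 0
    · rw [embed_eq F hN, embed_eq F hN]
      have h1 := hF.antisymm ![N 0, N 1] (permPair (π 0) (π 1)) (fun p => f fun v => p (embedVar hN v))
        (hf.comp_inj (embedVar_injective hN))
      have h2 : signs π = signs (permPair (π 0) (π 1)) := by
        rw [signs_permPair, signs, Fin.prod_univ_four]
        have e2 : IsEmpty (Fin (N 2)) := by rw [hN.1]; infer_instance
        have e3 : IsEmpty (Fin (N 3)) := by rw [hN.2]; infer_instance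
        rw [Subsingleton.elim (π 2) 1, Subsingleton.elim (π 3) 1]
        simp
      rw [h2, ← h1]
      congr 1
      funext p
      congr 1
      funext v
      match v with
      | ⟨0, i⟩ => rfl
      | ⟨1, i⟩ => rfl
      | ⟨2, i⟩ => exact (Fin.cast hN.1 i).elim0
      | ⟨3, i⟩ => exact (Fin.cast hN.2 i).elim0
    · have : ∀ f, Grassmann.embed F N f = 0 := fun f => dif_neg hN
      simp [this]
  norm_lt_top := by
    refine lt_of_le_of_lt ?_ hF.norm_lt_top
    rw [gNorm_eq, gNorm_eq]
    let i : (Fin 2 → ℕ) → (Fin 4 → ℕ) := fun M => ![M 0, M 1, 0, 0]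
    have hi : Function.Injective i := by
      intro M M' hM
      rw [← vec2_eta M, ← vec2_eta M']
      have h0 : M 0 = M' 0 := congrFun hM 0
      have h1 : M 1 = M' 1 := congrFun hM 1
      rw [h0, h1]
    rw [← hi.tsum_eq]
    · refine ENNReal.tsum_le_tsum fun M => ?_
      have hM : (i M) 2 = 0 ∧ (i M) 3 = 0 := ⟨rfl, rfl⟩
      refine mul_le_mul' (le_of_eq ?_) ?_
      · simp [weight, Fin.prod_univ_four, i]
      · simp only [funext fun f => embed_eq F hM f]
        refine ((hF.distr _).relabel (embedVar_injective hM)).2.trans (le_of_eq ?_)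
        exact congrArg (fun M => dualNorm k (F M)) (vec2_eta M)
    · intro N hN
      by_cases hN' : N 2 = 0 ∧ N 3 = 0
      · refine ⟨![N 0, N 1], ?_⟩
        funext s
        fin_cases s
        · rfl
        · rfl
        · exact hN'.1.symm
        · exact hN'.2.symm
      · have : Grassmann.embed F N = fun _ => 0 := funext fun f => dif_neg hN'
        simp [this, dualNorm_zero] at hN

end Elements

/-! ### The Gaussian integral -/

section Gauss

variable {ι : Type} [Fintype ι] {d k : ℕ} {ℓ : ℝ} [Fact (0 < ℓ)] {G : ι → ι → Torus d ℓ → ℂ}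
  {η : ℝ≥0∞}

theorem varJ_val (n : ℕ) (N : Fin 2 → ℕ) (v : Var N) :
    ((varJ n N v).1 : ℕ) = v.1 + 2 ∧ ((varJ n N v).2 : ℕ) = v.2 := by
  match v with
  | ⟨0, i⟩ => exact ⟨rfl, rfl⟩
  | ⟨1, i⟩ => exact ⟨rfl, rfl⟩

theorem varJ_injective (n : ℕ) (N : Fin 2 → ℕ) : Function.Injective (varJ n N) := by
  intro v w hvw
  have h1 := varJ_val n N v
  rw [hvw] at h1
  have h2 := varJ_val n N w
  exact var_ext (Fin.ext (by omega)) (h1.2.symm.trans h2.2)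

/-- The determinant involves only the variables of `ψ, ψ̄` and `f` only those of `J, J̄`; by
`CDB.tensor` the norms multiply. -/
theorem ckB_detTensor (hG : IsCov k G η) (n : ℕ) {N : Fin 2 → ℕ} {f : TestFn ι d ℓ (Var N)} {C : ℝ≥0∞}
    (hf : CkB k C f) : CkB k (η ^ n * η ^ n * C) (detTensor G n N f) := by
  intro a
  let r : Fin n → Var ![n, n, N 0, N 1] := fun i => ⟨0, i⟩
  let c : Fin n → Var ![n, n, N 0, N 1] := fun i => ⟨1, i⟩
  have hrc : Function.Injective (Sum.elim r c) := by
    rintro (i | i) (j | j) h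
    · have h2 : (r i).2.val = (r j).2.val := congrArg (fun v : Var ![n, n, N 0, N 1] => v.2.val) h
      exact congrArg Sum.inl (Fin.ext h2)
    · exact absurd (congrArg (fun v : Var ![n, n, N 0, N 1] => v.1) h) (by simp [r, c])
    · exact absurd (congrArg (fun v : Var ![n, n, N 0, N 1] => v.1) h) (by simp [r, c])
    · have h2 : (c i).2.val = (c j).2.val := congrArg (fun v : Var ![n, n, N 0, N 1] => v.2.val) h
      exact congrArg Sum.inr (Fin.ext h2)
  refine CDB.tensor (S := {v | 2 ≤ (v.1 : ℕ)}) (hG.det_ckB n r c hrc a) (hf.comp_inj (varJ_injective n N) a) ?_ ?_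
  · intro p hp x t
    have hr : ∀ i, (x + dirTV _ d ℓ p t) (r i) = x (r i) := fun i => by
      have : r i ≠ p.1 := by rintro h; rw [← h] at hp; simp [r] at hp
      simp [dirTV, Pi.single_eq_of_ne this]
    have hc : ∀ i, (x + dirTV _ d ℓ p t) (c i) = x (c i) := fun i => by
      have : c i ≠ p.1 := by rintro h; rw [← h] at hp; simp [c] at hp
      simp [dirTV, Pi.single_eq_of_ne this]
    refine congrArg Matrix.det (funext fun i => funext fun j => ?_)
    show G (a (r i)) (a (c j)) ((x + dirTV _ d ℓ p t) (r i) - (x + dirTV _ d ℓ p t) (c j)) = _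
    rw [hr, hc]
  · intro p hp x t
    have hv : ∀ v, (x + dirTV _ d ℓ p t) (varJ n N v) = x (varJ n N v) := fun v => by
      have : varJ n N v ≠ p.1 := by
        rintro h
        rw [← h] at hp
        have := (varJ_val n N v).1
        simp at hp
        omega
      simp [dirTV, Pi.single_eq_of_ne this]
    simp only [hv]

theorem isDistr_gaussTerm (hG : IsCov k G η) (hη : η ≠ ⊤) {H : Elem ι d ℓ 4} (hH : ∀ N, IsDistr k (H N))
    (n : ℕ) (N : Fin 2 → ℕ) :
    IsDistr k (fun f => gaussTerm G H N f n) ∧ dualNorm k (fun f => gaussTerm G H N f n) ≤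
      (((n.factorial : ℝ≥0∞) * (n.factorial : ℝ≥0∞))⁻¹ * (η ^ n * η ^ n)) * dualNorm k (H ![n, n, N 0, N 1]) := by
  have h1 : IsDistr k (fun f => H ![n, n, N 0, N 1] (detTensor G n N f)) ∧
      dualNorm k (fun f => H ![n, n, N 0, N 1] (detTensor G n N f)) ≤
        dualNorm k (H ![n, n, N 0, N 1]) * (η ^ n * η ^ n) := by
    have hb : ∀ f, IsCk k f → ‖H ![n, n, N 0, N 1] (detTensor G n N f)‖ₑ ≤
        dualNorm k (H ![n, n, N 0, N 1]) * (η ^ n * η ^ n) * ckNorm k f := by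
      intro f hf
      have h2 := ckB_detTensor hG n hf.ckB
      refine ((hH _).enorm_le h2.isCk).trans ?_
      rw [mul_assoc]
      gcongr
      exact h2.ckNorm_le
    refine ⟨IsDistr.of_bound (ENNReal.mul_ne_top (hH _).bounded.ne (ENNReal.mul_ne_top (ENNReal.pow_ne_top hη)
      (ENNReal.pow_ne_top hη))) (fun f g hf hg => ?_) (fun c f hf => ?_) hb, dualNorm_le hb⟩
    · rw [← (hH _).map_add _ _ (ckB_detTensor hG n hf.ckB).isCk (ckB_detTensor hG n hg.ckB).isCk]
      congr 1
      funext p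
      simp [detTensor, mul_add]
    · rw [← (hH _).map_smul c _ (ckB_detTensor hG n hf.ckB).isCk]
      congr 1
      funext p
      simp [detTensor]
      ring
  have h2 := h1.1.const_mul ((-1) ^ (n * (n - 1) / 2) / ((n.factorial : ℂ) * (n.factorial : ℂ)))
  refine ⟨h2.1, h2.2.trans ?_⟩
  have h3 : ‖((-1) ^ (n * (n - 1) / 2) / ((n.factorial : ℂ) * (n.factorial : ℂ)))‖ₑ =
      ((n.factorial : ℝ≥0∞) * (n.factorial : ℝ≥0∞))⁻¹ := by
    rw [div_eq_mul_inv, enorm_mul, enorm_inv (by exact_mod_cast mul_ne_zero n.factorial_ne_zero n.factorial_ne_zero),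
      enorm_mul]
    have h4 : ‖((-1 : ℂ) ^ (n * (n - 1) / 2))‖ₑ = 1 := by rw [← ofReal_norm]; simp
    rw [h4, one_mul]
    simp only [← ofReal_norm, Complex.norm_natCast, ENNReal.ofReal_natCast]
  rw [h3, mul_assoc]
  gcongr
  rw [mul_comm]
  exact h1.2

/-- With the weight `η` for `ψ, ψ̄`, Gram's bound and the factor `1 / (n!)²` of the Gaussian
integral reproduce exactly the weight of the degree `(n, n, N 0, N 1)`. -/
theorem weight_vec4 (a b : ℝ≥0∞) (n : ℕ) (N : Fin 2 → ℕ) :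
    weight ![a, a, b, b] ![n, n, N 0, N 1] =
      weight ![b, b] N * (((n.factorial : ℝ≥0∞) * (n.factorial : ℝ≥0∞))⁻¹ * (a ^ n * a ^ n)) := by
  simp only [weight, Fin.prod_univ_four, Fin.prod_univ_two]
  simp only [div_eq_mul_inv, Matrix.cons_val_zero, Matrix.cons_val_one, Matrix.cons_val]
  rw [ENNReal.mul_inv (Or.inr (ENNReal.natCast_ne_top _)) (Or.inl (ENNReal.natCast_ne_top _))]
  ring

theorem tsum_gaussTerm_le (hG : IsCov k G η) (hη : η ≠ ⊤) {H : Elem ι d ℓ 4} {h' : ℝ≥0∞}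
    (hH : ∀ N, IsDistr k (H N)) (N : Fin 2 → ℕ) :
    weight ![h', h'] N * ∑' n, dualNorm k (fun f => gaussTerm G H N f n) ≤
      ∑' n : ℕ, weight ![η, η, h', h'] ![n, n, N 0, N 1] * dualNorm k (H ![n, n, N 0, N 1]) := by
  rw [← ENNReal.tsum_mul_left]
  refine ENNReal.tsum_le_tsum fun n => ?_
  rw [weight_vec4, mul_assoc]
  gcongr
  exact (isDistr_gaussTerm hG hη hH n N).2

/-- The Gaussian integral only sees degrees with as many `ψ` as `ψ̄`, and each of them once. -/
theorem tsum_gauss_le (H : Elem ι d ℓ 4) (h : Fin 4 → ℝ≥0∞) :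
    ∑' (N : Fin 2 → ℕ) (n : ℕ), weight h ![n, n, N 0, N 1] * dualNorm k (H ![n, n, N 0, N 1]) ≤ gNorm k h H := by
  rw [gNorm_eq, ← ENNReal.tsum_prod]
  refine ENNReal.tsum_comp_le_tsum_of_injective (f := fun x : (Fin 2 → ℕ) × ℕ => ![x.2, x.2, x.1 0, x.1 1])
    ?_ (fun N => weight h N * dualNorm k (H N))
  rintro ⟨N, n⟩ ⟨N', n'⟩ hx
  have h0 : n = n' := congrFun hx 0
  have h2 : N 0 = N' 0 := congrFun hx 2
  have h3 : N 1 = N' 1 := congrFun hx 3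
  rw [← vec2_eta N, ← vec2_eta N', h0, h2, h3]

/-- The weight of `N` is positive because `h' ≠ 0`, so the weighted bound yields absolute
convergence in each degree separately. -/
theorem tsum_dualNorm_gaussTerm (hG : IsCov k G η) (hη : η ≠ ⊤) {H : Elem ι d ℓ 4} {h' : ℝ≥0∞} (hh' : h' ≠ 0)
    (hH : MemG k ![η, η, h', h'] H) (N : Fin 2 → ℕ) :
    ∑' n, dualNorm k (fun f => gaussTerm G H N f n) ≠ ⊤ := by
  intro h
  have h1 := tsum_gaussTerm_le (h' := h') hG hη hH.distr N
  rw [h, ENNReal.mul_top (weight_ne_zero (by intro s; fin_cases s <;> exact hh') N)] at h1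
  have h2 : ∑' n : ℕ, weight ![η, η, h', h'] ![n, n, N 0, N 1] * dualNorm k (H ![n, n, N 0, N 1]) ≤
      gNorm k ![η, η, h', h'] H :=
    (ENNReal.le_tsum (f := fun N : Fin 2 → ℕ => ∑' n : ℕ, weight ![η, η, h', h'] ![n, n, N 0, N 1] *
      dualNorm k (H ![n, n, N 0, N 1])) N).trans (tsum_gauss_le H _)
  exact hH.norm_lt_top.ne (top_le_iff.1 (h1.trans h2))

theorem MemG.gaussIntegrable (hG : IsCov k G η) (hη : η ≠ ⊤) {H : Elem ι d ℓ 4} {h' : ℝ≥0∞} (hh' : h' ≠ 0)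
    (hH : MemG k ![η, η, h', h'] H) : GaussIntegrable k G H := fun N _ hf =>
  IsDistr.summable (fun n => (isDistr_gaussTerm hG hη hH.distr n N).1)
    (tsum_dualNorm_gaussTerm hG hη hh' hH N) hf

/-- The permutations of the variables of `J, J̄` as permutations of the variables of
`ψ, ψ̄, J, J̄`. -/
def permJ {n : ℕ} {N : Fin 2 → ℕ} (π : (s : Fin 2) → Equiv.Perm (Fin (N s))) :
    (s : Fin 4) → Equiv.Perm (Fin (![n, n, N 0, N 1] s))
  | 0 => 1
  | 1 => 1
  | 2 => π 0
  | 3 => π 1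

theorem MemG.gaussInt (hG : IsCov k G η) (hη : η ≠ ⊤) {H : Elem ι d ℓ 4} {h' : ℝ≥0∞} (hh' : h' ≠ 0)
    (hH : MemG k ![η, η, h', h'] H) : MemG k ![h', h'] (Grassmann.gaussInt G H) where
  distr N := (IsDistr.tsum (fun n => (isDistr_gaussTerm hG hη hH.distr n N).1)
    (tsum_dualNorm_gaussTerm hG hη hh' hH N)).1
  antisymm N π f hf := by
    simp only [Grassmann.gaussInt]
    rw [← tsum_mul_left]
    refine tsum_congr fun n => ?_
    simp only [gaussTerm]
    have h1 := hH.antisymm ![n, n, N 0, N 1] (permJ π) (detTensor G n N f) (ckB_detTensor hG n hf.ckB).isCk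
    have h2 : signs (permJ (n := n) π) = signs π := by
      simp only [signs, Fin.prod_univ_four, Fin.prod_univ_two]
      have h0 : ((Equiv.Perm.sign (1 : Equiv.Perm (Fin n)) : ℤ) : ℂ) = 1 := by simp
      show ((Equiv.Perm.sign (1 : Equiv.Perm (Fin n)) : ℤ) : ℂ) *
        ((Equiv.Perm.sign (1 : Equiv.Perm (Fin n)) : ℤ) : ℂ) * _ * _ = _
      rw [h0, one_mul, one_mul]
      rfl
    rw [h2] at h1
    rw [mul_left_comm, ← h1]
    congr 2
    funext p
    simp only [detTensor]
    congr 2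
    funext v
    match v with
    | ⟨0, i⟩ => rfl
    | ⟨1, i⟩ => rfl
  norm_lt_top := by
    refine lt_of_le_of_lt ?_ hH.norm_lt_top
    refine le_trans (ENNReal.tsum_le_tsum fun N => ?_) (tsum_gauss_le H _)
    exact (mul_le_mul_right (IsDistr.tsum (fun n => (isDistr_gaussTerm hG hη hH.distr n N).1)
      (tsum_dualNorm_gaussTerm hG hη hh' hH N)).2 _).trans (tsum_gaussTerm_le hG hη hH.distr N)

end Gauss

/-! ### The substitution `J ↦ G J`, `J̄ ↦ J̄ G` -/

section Smear

variable {ι : Type} [Fintype ι] {d k : ℕ} {ℓ : ℝ} [Fact (0 < ℓ)] {G : ι → ι → Torus d ℓ → ℂ}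
  {N : Fin 4 → ℕ}

/-- Replace the variables of `J, J̄` by new ones. -/
def mergeVar (N : Fin 4 → ℕ) : Var N → Var N ⊕ (Fin (N 2) ⊕ Fin (N 3))
  | ⟨0, i⟩ => Sum.inl ⟨0, i⟩
  | ⟨1, i⟩ => Sum.inl ⟨1, i⟩
  | ⟨2, i⟩ => Sum.inr (Sum.inl i)
  | ⟨3, i⟩ => Sum.inr (Sum.inr i)

/-- The kernel of the substitution. -/
def smearKernel (G : ι → ι → Torus d ℓ → ℂ) (p : Var N → Pt ι d ℓ)
    (q : Fin (N 2) ⊕ Fin (N 3) → Pt ι d ℓ) : ℂ :=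
  (∏ i, G (p ⟨2, i⟩).1 (q (Sum.inl i)).1 ((p ⟨2, i⟩).2 - (q (Sum.inl i)).2)) *
    ∏ j, G (q (Sum.inr j)).1 (p ⟨3, j⟩).1 ((q (Sum.inr j)).2 - (p ⟨3, j⟩).2)

theorem contTF_prod {V α : Type} [Fintype V] [DecidableEq V] (s : Finset α) {f : α → TestFn ι d ℓ V}
    (hf : ∀ i ∈ s, ContTF (f i)) : ContTF (fun p => ∏ i ∈ s, f i p) := fun a =>
  continuous_finsetProd s fun i hi => hf i hi a

theorem contTF_smearKernel (hG : ∀ a b, Continuous (G a b)) :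
    ContTF (fun pq : Var N ⊕ (Fin (N 2) ⊕ Fin (N 3)) → Pt ι d ℓ =>
      smearKernel G (fun v => pq (Sum.inl v)) fun v => pq (Sum.inr v)) :=
  (contTF_prod _ fun i _ => contTF_cov hG (Sum.inl (⟨2, i⟩ : Var N)) (Sum.inr (Sum.inl i))).mul
    (contTF_prod _ fun i _ => contTF_cov hG (Sum.inr (Sum.inr i)) (Sum.inl (⟨3, i⟩ : Var N)))

theorem ContTF.fix_left {P Q : Type} [Fintype P] [DecidableEq P] [Fintype Q] [DecidableEq Q]
    {g : TestFn ι d ℓ (P ⊕ Q)} (hg : ContTF g) (p : P → Pt ι d ℓ) : ContTF (fun q => g (Sum.elim p q)) := by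
  intro b
  have h := (hg (Sum.elim (fun v => (p v).1) b)).comp
    (continuous_sumElim (continuous_const (y := fun v => (p v).2)) continuous_id)
  convert h using 1
  funext y
  exact (comp_sumElim g _ b _ y).symm

theorem contTF_smearIntegrand (hG : ∀ a b, Continuous (G a b)) {f : TestFn ι d ℓ (Var N)} (hf : ContTF f) :
    ContTF (fun pq : Var N ⊕ (Fin (N 2) ⊕ Fin (N 3)) → Pt ι d ℓ =>
      smearKernel G (fun v => pq (Sum.inl v)) (fun v => pq (Sum.inr v)) * f fun v => pq (mergeVar N v)) :=
  (contTF_smearKernel hG).mul (hf.comp_any _)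

theorem smear_eq_ptInt (hG : ∀ a b, Continuous (G a b)) {f : TestFn ι d ℓ (Var N)} (hf : ContTF f)
    (p : Var N → Pt ι d ℓ) : smear G f p = ptInt fun q : Fin (N 2) ⊕ Fin (N 3) → Pt ι d ℓ =>
      smearKernel G p q * f fun v => Sum.elim p q (mergeVar N v) := by
  have hc : ContTF (fun q : Fin (N 2) ⊕ Fin (N 3) → Pt ι d ℓ =>
      smearKernel G p q * f fun v => Sum.elim p q (mergeVar N v)) :=
    (contTF_smearIntegrand hG hf).fix_left p
  rw [ptInt_components hc]
  simp only [comp_sumElim]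
  unfold smear
  refine Finset.sum_congr rfl fun b _ => Finset.sum_congr rfl fun c _ => ?_
  refine integral_congr_ae (Filter.Eventually.of_forall fun z => ?_)
  refine integral_congr_ae (Filter.Eventually.of_forall fun w => ?_)
  simp only [smearKernel, Sum.elim_inl, Sum.elim_inr]
  congr 2
  funext v
  match v with
  | ⟨0, i⟩ => rfl
  | ⟨1, i⟩ => rfl
  | ⟨2, i⟩ => rfl
  | ⟨3, i⟩ => rfl

/-- The shift of the variables of `J, J̄`. -/
def shiftVar (y : Fin (N 2) ⊕ Fin (N 3) → Torus d ℓ) : Var N → Torus d ℓ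
  | ⟨0, _⟩ => 0
  | ⟨1, _⟩ => 0
  | ⟨2, i⟩ => -y (Sum.inl i)
  | ⟨3, i⟩ => y (Sum.inr i)

theorem continuous_shiftVar : Continuous fun y : Fin (N 2) ⊕ Fin (N 3) → Torus d ℓ => shiftVar (N := N) y := by
  refine continuous_pi fun v => ?_
  match v with
  | ⟨0, i⟩ => exact continuous_const
  | ⟨1, i⟩ => exact continuous_const
  | ⟨2, i⟩ => exact (continuous_apply _).neg
  | ⟨3, i⟩ => exact continuous_apply _

/-- The indices after the replacement of the variables of `J, J̄`. -/
def mergeIdx (a : Var N → ι) (e : Fin (N 2) ⊕ Fin (N 3) → ι) (v : Var N) : ι :=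
  Sum.elim a e (mergeVar N v)

/-- One factor of the kernel of the substitution. -/
def smearFactor (G : ι → ι → Torus d ℓ → ℂ) (a : Var N → ι) : Fin (N 2) ⊕ Fin (N 3) → ι → Torus d ℓ → ℂ
  | Sum.inl i, c => G (a ⟨2, i⟩) c
  | Sum.inr j, c => G c (a ⟨3, j⟩)

/-- Integrating over differences of points moves `x` out of the covariances and into `f`.
Derivatives then fall on `f` alone, and only the `L¹` norm of `G` enters. -/
theorem comp_smear (hG : ∀ a b, Continuous (G a b)) {f : TestFn ι d ℓ (Var N)} (hf : ContTF f)
    (a : Var N → ι) (x : Var N → Torus d ℓ) :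
    comp (smear G f) a x = ∑ e : Fin (N 2) ⊕ Fin (N 3) → ι, ∫ y : Fin (N 2) ⊕ Fin (N 3) → Torus d ℓ,
      (∏ t, smearFactor G a t (e t) (y t)) * comp f (mergeIdx a e) (x + shiftVar y) := by
  simp only [comp, smear_eq_ptInt hG hf]
  unfold ptInt
  refine Finset.sum_congr rfl fun e _ => ?_
  let φ : Fin (N 2) ⊕ Fin (N 3) → Torus d ℓ → Torus d ℓ
    | Sum.inl i, t => x ⟨2, i⟩ - t
    | Sum.inr j, t => x ⟨3, j⟩ + t
  -- Reflections with a shift for the variables `J` and shifts for the variables `J̄`, according to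
  -- the order of the arguments of `G`.
  have hφ : MeasurePreserving (fun (y : Fin (N 2) ⊕ Fin (N 3) → Torus d ℓ) t => φ t (y t)) := by
    refine volume_preserving_pi fun t => ?_
    rcases t with i | j
    · have : (volume : Measure (Torus d ℓ)).IsNegInvariant := Measure.pi.isNegInvariant _
      exact Measure.measurePreserving_sub_left volume (x ⟨2, i⟩)
    · exact measurePreserving_add_left volume (x ⟨3, j⟩)
  have hc := ((contTF_smearIntegrand hG hf).fix_left fun v => (a v, x v)) e
  conv_lhs => rw [← hφ.map_eq]
  refine (integral_map hφ.aemeasurable hc.aestronglyMeasurable).trans ?_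
  refine integral_congr_ae (Filter.Eventually.of_forall fun y => ?_)
  simp only [comp, Sum.elim_inl, Sum.elim_inr, smearKernel]
  congr 1
  · rw [Fintype.prod_sum_type]
    congr 1
    · refine Finset.prod_congr rfl fun i _ => ?_
      simp [smearFactor, φ]
    · refine Finset.prod_congr rfl fun i _ => ?_
      simp [smearFactor, φ]
  · congr 1
    funext v
    match v with
    | ⟨0, i⟩ => simp [mergeVar, mergeIdx, shiftVar]
    | ⟨1, i⟩ => simp [mergeVar, mergeIdx, shiftVar]
    | ⟨2, i⟩ => simp [mergeVar, mergeIdx, shiftVar, φ, sub_eq_add_neg]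
    | ⟨3, i⟩ => simp [mergeVar, mergeIdx, shiftVar, φ]

theorem lintegral_prod_enorm {Q : Type} [Fintype Q] {γ : Q → Torus d ℓ → ℂ} (hγ : ∀ t, Continuous (γ t)) :
    ∫⁻ y : Q → Torus d ℓ, ‖∏ t, γ t (y t)‖ₑ = ∏ t, ∫⁻ x, ‖γ t x‖ₑ := by
  have hi : ∀ t, Integrable (γ t) := fun t => integrable_torus _ (hγ t)
  have hI : Integrable fun y : Q → Torus d ℓ => ∏ t, γ t (y t) :=
    integrable_torus _ (continuous_finsetProd _ fun t _ => (hγ t).comp (continuous_apply t))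
  rw [← ofReal_integral_norm_eq_lintegral_enorm hI]
  simp only [norm_prod]
  rw [integral_fintype_prod_volume_eq_prod (fun t x => ‖γ t x‖),
    ENNReal.ofReal_prod_of_nonneg fun t _ => integral_nonneg fun x => norm_nonneg _]
  exact Finset.prod_congr rfl fun t _ => ofReal_integral_norm_eq_lintegral_enorm (hi t)

/-- By `comp_smear` every derivative is an average of the same derivative of `f` at shifted points.
Summation over the new indices gives row sums of `G` for `J` and column sums for `J̄`, both at most
`‖G‖`. -/
theorem ckB_smear (hG : ∀ a b, Continuous (G a b)) {f : TestFn ι d ℓ (Var N)} {C : ℝ≥0∞} (hC : C ≠ ⊤)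
    (hf : CkB k C f) : CkB k (covNorm G ^ (N 2 + N 3) * C) (smear G f) := by
  intro a
  have hγ : ∀ t c, Continuous (smearFactor G a t c) := by
    rintro (i | j) c <;> exact hG _ _
  have h1 : ∀ e : Fin (N 2) ⊕ Fin (N 3) → ι, CDB (dirTV (Var N) d ℓ) Prod.fst (fun _ => k)
      ((∏ t, ∫⁻ x, ‖smearFactor G a t (e t) x‖ₑ) * C) (fun x => ∫ y : Fin (N 2) ⊕ Fin (N 3) → Torus d ℓ,
        (∏ t, smearFactor G a t (e t) (y t)) * comp f (mergeIdx a e) (x + shiftVar y)) := by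
    intro e
    rw [← lintegral_prod_enorm fun t => hγ t (e t)]
    refine CDB.integral (g := fun yx : (Fin (N 2) ⊕ Fin (N 3) → Torus d ℓ) × (Var N → Torus d ℓ) =>
      comp f (mergeIdx a e) (yx.2 + shiftVar yx.1)) isFlow_dirTV
      (integrable_torus _ (continuous_finsetProd _ fun t _ => (hγ t (e t)).comp (continuous_apply t))) hC ?_
    refine (hf (mergeIdx a e)).comp_map _ (continuous_snd.add (continuous_shiftVar.comp continuous_fst)) some
      (fun _ _ _ => le_rfl) fun p => Or.inl ⟨p, rfl, fun x t => ?_⟩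
    simp [sndDir, add_right_comm]
  have h2 : ∀ (s : Finset (Fin (N 2) ⊕ Fin (N 3) → ι)), CDB (dirTV (Var N) d ℓ) Prod.fst (fun _ => k)
      (∑ e ∈ s, (∏ t, ∫⁻ x, ‖smearFactor G a t (e t) x‖ₑ) * C) (fun x => ∑ e ∈ s,
        ∫ y : Fin (N 2) ⊕ Fin (N 3) → Torus d ℓ,
        (∏ t, smearFactor G a t (e t) (y t)) * comp f (mergeIdx a e) (x + shiftVar y)) := by
    intro s
    classical
    induction s using Finset.induction_on with
    | empty => simpa using CDB.zero
    | insert e s he ih =>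
      simp only [Finset.sum_insert he]
      exact (h1 e).add ih
  have h3 := h2 Finset.univ
  simp only [← comp_smear hG hf.isCk.contTF] at h3
  refine h3.mono le_rfl ?_
  rw [← Finset.sum_mul]
  gcongr
  -- The sum over families of indices of a product is the product of the sums over single indices.
  rw [← Fintype.piFinset_univ, ← Finset.prod_univ_sum (fun _ => Finset.univ)
    (fun t c => ∫⁻ x, ‖smearFactor G a t c x‖ₑ), Fintype.prod_sum_type, pow_add]
  refine mul_le_mul' ?_ ?_
  · refine (Finset.prod_le_pow_card _ _ (covNorm G) fun i _ => ?_).trans (by simp)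
    exact (le_iSup (fun a => ∑ b, ∫⁻ x, ‖G a b x‖ₑ) (a ⟨2, i⟩)).trans (le_max_left _ _)
  · refine (Finset.prod_le_pow_card _ _ (covNorm G) fun i _ => ?_).trans (by simp)
    exact (le_iSup (fun b => ∑ a, ∫⁻ x, ‖G a b x‖ₑ) (a ⟨3, i⟩)).trans (le_max_right _ _)

theorem varPlus_injective (N : Fin 4 → ℕ) : Function.Injective (varPlus N) := by
  refine Function.LeftInverse.injective (g := fun v : Var ![N 0 + N 2, N 1 + N 3] =>
    match v with
    | ⟨0, i⟩ => Sum.elim (fun i => (⟨0, i⟩ : Var N)) (fun i => ⟨2, i⟩) (finSumFinEquiv.symm i)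
    | ⟨1, i⟩ => Sum.elim (fun i => (⟨1, i⟩ : Var N)) (fun i => ⟨3, i⟩) (finSumFinEquiv.symm i)) ?_
  intro v
  match v with
  | ⟨0, i⟩ => simp [varPlus]
  | ⟨1, i⟩ => simp [varPlus]
  | ⟨2, i⟩ => simp [varPlus]
  | ⟨3, i⟩ => simp [varPlus]

theorem isDistr_translate (hG : ∀ a b, Continuous (G a b)) (hGn : covNorm G ≠ ⊤) {F : Elem ι d ℓ 2}
    (hF : ∀ M, IsDistr k (F M)) (N : Fin 4 → ℕ) : IsDistr k (translate G F N) ∧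
      dualNorm k (translate G F N) ≤ covNorm G ^ (N 2 + N 3) * dualNorm k (F ![N 0 + N 2, N 1 + N 3]) := by
  have h1 := (hF ![N 0 + N 2, N 1 + N 3]).relabel (varPlus_injective N)
  have hck : ∀ f : TestFn ι d ℓ (Var N), IsCk k f → CkB k (covNorm G ^ (N 2 + N 3) * ckNorm k f) (smear G f) :=
    fun f hf => ckB_smear hG hf.ckNorm_lt_top.ne hf.ckB
  have hadd : ∀ f g : TestFn ι d ℓ (Var N), IsCk k f → IsCk k g → smear G (f + g) = smear G f + smear G g := by
    intro f g hf hg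
    funext p
    have hc : ∀ {f : TestFn ι d ℓ (Var N)}, ContTF f → ContTF (fun q : Fin (N 2) ⊕ Fin (N 3) → Pt ι d ℓ =>
        smearKernel G p q * f fun v => Sum.elim p q (mergeVar N v)) :=
      fun hf => (contTF_smearIntegrand hG hf).fix_left p
    rw [Pi.add_apply, smear_eq_ptInt hG (hf.add hg).contTF, smear_eq_ptInt hG hf.contTF,
      smear_eq_ptInt hG hg.contTF, ← ptInt_add (hc hf.contTF) (hc hg.contTF)]
    simp only [Pi.add_apply, mul_add]
  have hsmul : ∀ (c : ℂ) (f : TestFn ι d ℓ (Var N)), IsCk k f → smear G (c • f) = c • smear G f := by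
    intro c f hf
    funext p
    rw [Pi.smul_apply, smear_eq_ptInt hG (hf.smul c).contTF, smear_eq_ptInt hG hf.contTF, smul_eq_mul,
      ← ptInt_smul]
    simp only [Pi.smul_apply, smul_eq_mul, mul_left_comm]
  have h2 : translate G F N = fun f => (-1) ^ (N 2 * N 1) *
      F ![N 0 + N 2, N 1 + N 3] (fun p => smear G f (fun v => p (varPlus N v))) := rfl
  have hb : ∀ f : TestFn ι d ℓ (Var N), IsCk k f → ‖translate G F N f‖ₑ ≤
      covNorm G ^ (N 2 + N 3) * dualNorm k (F ![N 0 + N 2, N 1 + N 3]) * ckNorm k f := by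
    intro f hf
    have h3 := h1.1.enorm_le (hck f hf).isCk
    rw [h2]
    simp only [enorm_mul, enorm_pow, enorm_neg, enorm_one, one_pow, one_mul]
    refine h3.trans ((mul_le_mul' h1.2 (hck f hf).ckNorm_le).trans (le_of_eq ?_))
    ring
  refine ⟨IsDistr.of_bound (ENNReal.mul_ne_top (ENNReal.pow_ne_top hGn) (hF _).bounded.ne) ?_ ?_ hb,
    dualNorm_le hb⟩
  · intro f g hf hg
    simp only [h2, hadd f g hf hg]
    rw [← mul_add]
    congr 1
    exact h1.1.map_add _ _ (hck f hf).isCk (hck g hg).isCk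
  · intro c f hf
    simp only [h2, hsmul c f hf]
    rw [mul_left_comm]
    congr 1
    exact h1.1.map_smul _ _ (hck f hf).isCk

theorem smear_permVar (hG : ∀ a b, Continuous (G a b)) {f : TestFn ι d ℓ (Var N)} (hf : ContTF f)
    (π : (s : Fin 4) → Equiv.Perm (Fin (N s))) (p : Var N → Pt ι d ℓ) :
    smear G (fun p => f fun v => p (permVar π v)) p = smear G f fun v => p (permVar π v) := by
  rw [smear_eq_ptInt hG (hf.comp_any _), smear_eq_ptInt hG hf]
  refine Eq.trans ?_ (ptInt_reindex (Equiv.sumCongr (π 2) (π 3)) _).symm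
  congr 1
  funext q
  congr 1
  · simp only [smearKernel]
    congr 1
    · rw [← Equiv.prod_comp (π 2)]
      rfl
    · rw [← Equiv.prod_comp (π 3)]
      rfl
  · congr 1
    funext v
    match v with
    | ⟨0, i⟩ => rfl
    | ⟨1, i⟩ => rfl
    | ⟨2, i⟩ => rfl
    | ⟨3, i⟩ => rfl

/-- Permutations of the first and of the last variables. -/
def blockPerm {a b : ℕ} (σ : Equiv.Perm (Fin a)) (τ : Equiv.Perm (Fin b)) : Equiv.Perm (Fin (a + b)) :=
  finSumFinEquiv.permCongr (Equiv.sumCongr σ τ)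

theorem blockPerm_castAdd {a b : ℕ} (σ : Equiv.Perm (Fin a)) (τ : Equiv.Perm (Fin b)) (i : Fin a) :
    blockPerm σ τ (Fin.castAdd b i) = Fin.castAdd b (σ i) := by
  simp [blockPerm, Equiv.permCongr_apply]

theorem blockPerm_natAdd {a b : ℕ} (σ : Equiv.Perm (Fin a)) (τ : Equiv.Perm (Fin b)) (i : Fin b) :
    blockPerm σ τ (Fin.natAdd a i) = Fin.natAdd a (τ i) := by
  simp [blockPerm, Equiv.permCongr_apply]

theorem sign_blockPerm {a b : ℕ} (σ : Equiv.Perm (Fin a)) (τ : Equiv.Perm (Fin b)) :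
    Equiv.Perm.sign (blockPerm σ τ) = Equiv.Perm.sign σ * Equiv.Perm.sign τ := by
  rw [blockPerm, Equiv.Perm.sign_permCongr, Equiv.Perm.sign_sumCongr]

/-- Grouping the pairs by their sum `m` gives the binomial expansion of `(x + y) ^ m` divided by
`m!`. -/
theorem tsum_binomial (x y : ℝ≥0∞) (φ : ℕ → ℝ≥0∞) :
    ∑' p : ℕ × ℕ, x ^ p.1 / (p.1.factorial : ℝ≥0∞) * (y ^ p.2 / (p.2.factorial : ℝ≥0∞)) * φ (p.1 + p.2) =
      ∑' m : ℕ, (x + y) ^ m / (m.factorial : ℝ≥0∞) * φ m := by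
  rw [← Finset.HasAntidiagonal.sigmaAntidiagonalEquivProd.tsum_eq, ENNReal.tsum_sigma']
  refine tsum_congr fun m => ?_
  rw [tsum_fintype]
  have h1 : ∀ p : Finset.HasAntidiagonal.antidiagonal m, x ^ p.1.1 / (p.1.1.factorial : ℝ≥0∞) *
      (y ^ p.1.2 / (p.1.2.factorial : ℝ≥0∞)) * φ (p.1.1 + p.1.2) =
      x ^ p.1.1 * y ^ p.1.2 * (m.choose p.1.1 : ℝ≥0∞) / (m.factorial : ℝ≥0∞) * φ m := by
    rintro ⟨p, hp⟩
    rw [Finset.HasAntidiagonal.mem_antidiagonal] at hp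
    subst hp
    simp only
    congr 1
    have h2 : ((p.1 + p.2).factorial : ℝ≥0∞) =
        ((p.1 + p.2).choose p.1 : ℝ≥0∞) * p.1.factorial * p.2.factorial := by
      exact_mod_cast (Nat.choose_mul_factorial_mul_factorial (Nat.le_add_right p.1 p.2)).symm.trans
        (by rw [Nat.add_sub_cancel_left])
    have hc : ((p.1 + p.2).choose p.1 : ℝ≥0∞) ≠ 0 := by
      exact_mod_cast (Nat.choose_pos (Nat.le_add_right _ _)).ne'
    have hc' : ((p.1 + p.2).choose p.1 : ℝ≥0∞) ≠ ⊤ := ENNReal.natCast_ne_top _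
    rw [h2, mul_comm _ ((p.1 + p.2).choose p.1 : ℝ≥0∞), mul_assoc ((p.1 + p.2).choose p.1 : ℝ≥0∞),
      ENNReal.mul_div_mul_left _ _ hc hc', div_eq_mul_inv, div_eq_mul_inv, div_eq_mul_inv,
      ENNReal.mul_inv (Or.inr (ENNReal.natCast_ne_top _)) (Or.inl (ENNReal.natCast_ne_top _))]
    ring
  refine (Finset.sum_congr rfl fun p _ => h1 p).trans ?_
  rw [(Commute.all x y).add_pow' m, div_eq_mul_inv, Finset.sum_mul, Finset.sum_mul,
    ← Finset.sum_coe_sort (Finset.HasAntidiagonal.antidiagonal m)]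
  refine Finset.sum_congr rfl fun p _ => ?_
  rw [nsmul_eq_mul, div_eq_mul_inv, mul_comm (x ^ _ * y ^ _)]

/-- A field `ψ` of `F` becomes either a `ψ`, with weight `η`, or a smeared `J`, with weight `‖G‖
h'`, and likewise for `ψ̄`. The binomial theorem sums both possibilities to the weight `η + ‖G‖ h' ≤
h`. -/
theorem MemG.translate (hG : ∀ a b, Continuous (G a b)) (hGn : covNorm G ≠ ⊤) {F : Elem ι d ℓ 2}
    {η h h' : ℝ≥0∞} (hle : η + covNorm G * h' ≤ h) (hF : MemG k ![h, h] F) :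
    MemG k ![η, η, h', h'] (Grassmann.translate G F) where
  distr N := (isDistr_translate hG hGn hF.distr N).1
  antisymm N π f hf := by
    -- The variables `ψ` and `J` are consecutive blocks in the first species of `F`, and `ψ̄` and
    -- `J̄` in the second.
    let ρ := permPair (blockPerm (π 0) (π 2)) (blockPerm (π 1) (π 3))
    have h1 := hF.antisymm ![N 0 + N 2, N 1 + N 3] ρ (fun p => smear G f fun v => p (varPlus N v))
      ((ckB_smear hG hf.ckNorm_lt_top.ne hf.ckB).isCk.comp_inj (varPlus_injective N))
    have h2 : signs ρ = signs π := by
      rw [signs_permPair, sign_blockPerm, sign_blockPerm, signs, Fin.prod_univ_four]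
      push_cast
      ring
    rw [h2] at h1
    show (-1) ^ (N 2 * N 1) * F ![N 0 + N 2, N 1 + N 3]
      (fun p => smear G (fun p => f fun v => p (permVar π v)) fun v => p (varPlus N v)) =
      signs π * ((-1) ^ (N 2 * N 1) * F ![N 0 + N 2, N 1 + N 3] fun p => smear G f fun v => p (varPlus N v))
    rw [mul_left_comm, ← h1]
    congr 2
    funext p
    rw [smear_permVar hG hf.contTF]
    congr 1
    funext v
    congr 1
    match v with
    | ⟨0, i⟩ => exact congrArg (Sigma.mk 0) (blockPerm_castAdd (π 0) (π 2) i).symm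
    | ⟨1, i⟩ => exact congrArg (Sigma.mk 1) (blockPerm_castAdd (π 1) (π 3) i).symm
    | ⟨2, i⟩ => exact congrArg (Sigma.mk 0) (blockPerm_natAdd (π 0) (π 2) i).symm
    | ⟨3, i⟩ => exact congrArg (Sigma.mk 1) (blockPerm_natAdd (π 1) (π 3) i).symm
  norm_lt_top := by
    refine lt_of_le_of_lt ?_ hF.norm_lt_top
    have h1 : ∀ N : Fin 4 → ℕ, weight ![η, η, h', h'] N * dualNorm k (Grassmann.translate G F N) ≤
        (η ^ N 0 / ((N 0).factorial : ℝ≥0∞) * ((covNorm G * h') ^ N 2 / ((N 2).factorial : ℝ≥0∞))) *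
        (η ^ N 1 / ((N 1).factorial : ℝ≥0∞) * ((covNorm G * h') ^ N 3 / ((N 3).factorial : ℝ≥0∞)) *
        dualNorm k (F ![N 0 + N 2, N 1 + N 3])) := by
      intro N
      refine (mul_le_mul_right (isDistr_translate hG hGn hF.distr N).2 _).trans (le_of_eq ?_)
      simp only [weight, Fin.prod_univ_four, Matrix.cons_val_zero, Matrix.cons_val_one, Matrix.cons_val,
        div_eq_mul_inv, mul_pow, pow_add]
      ring
    -- The degrees of `ψ, J` and of `ψ̄, J̄` are grouped so that `tsum_binomial` applies once to
    -- each group.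
    let e : (ℕ × ℕ) × (ℕ × ℕ) ≃ (Fin 4 → ℕ) :=
      { toFun := fun x => ![x.1.1, x.2.1, x.1.2, x.2.2]
        invFun := fun N => ((N 0, N 2), (N 1, N 3))
        left_inv := fun x => rfl
        right_inv := fun N => by funext s; fin_cases s <;> rfl }
    rw [gNorm_eq, gNorm_eq]
    refine (ENNReal.tsum_le_tsum h1).trans ?_
    rw [← e.tsum_eq]
    refine (ENNReal.tsum_prod' (f := fun c : (ℕ × ℕ) × (ℕ × ℕ) => _)).le.trans ?_
    have h2 : ∀ p : ℕ × ℕ, ∑' p' : ℕ × ℕ,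
        (η ^ p.1 / (p.1.factorial : ℝ≥0∞) * ((covNorm G * h') ^ p.2 / (p.2.factorial : ℝ≥0∞))) *
        (η ^ p'.1 / (p'.1.factorial : ℝ≥0∞) * ((covNorm G * h') ^ p'.2 / (p'.2.factorial : ℝ≥0∞)) *
        dualNorm k (F ![p.1 + p.2, p'.1 + p'.2])) =
        (η ^ p.1 / (p.1.factorial : ℝ≥0∞) * ((covNorm G * h') ^ p.2 / (p.2.factorial : ℝ≥0∞))) *
        ∑' m : ℕ, (η + covNorm G * h') ^ m / (m.factorial : ℝ≥0∞) * dualNorm k (F ![p.1 + p.2, m]) := by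
      intro p
      rw [ENNReal.tsum_mul_left, tsum_binomial η (covNorm G * h') fun m => dualNorm k (F ![p.1 + p.2, m])]
    refine (tsum_congr h2).le.trans ?_
    rw [tsum_binomial η (covNorm G * h') fun n =>
      ∑' m : ℕ, (η + covNorm G * h') ^ m / (m.factorial : ℝ≥0∞) * dualNorm k (F ![n, m])]
    rw [← (finTwoArrowEquiv ℕ).symm.tsum_eq]
    refine le_trans ?_ (ENNReal.tsum_prod' (f := fun c : ℕ × ℕ => _)).ge
    refine ENNReal.tsum_le_tsum fun n => ?_
    rw [← ENNReal.tsum_mul_left]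
    refine ENNReal.tsum_le_tsum fun m => ?_
    simp only [weight, Fin.prod_univ_two, finTwoArrowEquiv_symm_apply, Matrix.cons_val_zero,
      Matrix.cons_val_one]
    rw [← mul_assoc]
    gcongr
    exact le_rfl

end Smear

/-! ### Reduction to anti-symmetric test functions -/

section Anti

variable {ι : Type} [Fintype ι] {d k q : ℕ} {ℓ : ℝ} [Fact (0 < ℓ)] {N : Fin q → ℕ}

/-- A test function that is anti-symmetric in the variables of each of the species. -/
def IsAnti (f : TestFn ι d ℓ (Var N)) : Prop :=
  ∀ (π : (s : Fin q) → Equiv.Perm (Fin (N s))) (p : Var N → Pt ι d ℓ),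
    f (fun v => p (permVar π v)) = signs π * f p

/-- An anti-symmetric kernel takes on the anti-symmetrization of `f` the value `∏ N_s!` times its
value on `f`, so no information is lost. -/
theorem sameElem_of_isAnti {F H : Elem ι d ℓ q} {h h' : Fin q → ℝ≥0∞} (hF : MemG k h F) (hH : MemG k h' H)
    (heq : ∀ (N : Fin q → ℕ) (f : TestFn ι d ℓ (Var N)), IsCk k f → IsAnti f → F N f = H N f) :
    SameElem k F H := by
  intro N f hf
  let g : TestFn ι d ℓ (Var N) := ∑ π : (s : Fin q) → Equiv.Perm (Fin (N s)),
    signs π • fun p => f fun v => p (permVar π v)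
  have hi : ∀ π : (s : Fin q) → Equiv.Perm (Fin (N s)), IsCk k fun p => f fun v => p (permVar π v) :=
    fun π => hf.comp_inj (permVar_injective π)
  have hg : IsCk k g := IsCk.sum _ fun π _ => (hi π).smul _
  have hga : IsAnti g := by
    intro ρ p
    simp only [g, Finset.sum_apply, Pi.smul_apply, smul_eq_mul]
    rw [Finset.mul_sum]
    refine Fintype.sum_equiv (Equiv.mulLeft ρ) _ _ fun π => ?_
    simp only [Equiv.coe_mulLeft, permVar_mul, signs_mul]
    linear_combination (-signs π * f fun v => p (permVar ρ (permVar π v))) * signs_mul_self ρ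
  have key : ∀ {F : Elem ι d ℓ q} {h : Fin q → ℝ≥0∞}, MemG k h F →
      F N g = (Fintype.card ((s : Fin q) → Equiv.Perm (Fin (N s))) : ℂ) * F N f := by
    intro F h hF
    rw [(hF.distr N).map_sum _ fun π _ => (hi π).smul _]
    have : ∀ π : (s : Fin q) → Equiv.Perm (Fin (N s)),
        F N (signs π • fun p => f fun v => p (permVar π v)) = F N f := by
      intro π
      rw [(hF.distr N).map_smul _ _ (hi π), hF.antisymm N π f hf, ← mul_assoc, signs_mul_self, one_mul]
    rw [Finset.sum_congr rfl fun π _ => this π, Finset.sum_const, Finset.card_univ, nsmul_eq_mul]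
  have h1 := heq N g hg hga
  rw [key hF, key hH] at h1
  exact mul_left_cancel₀ (by exact_mod_cast Fintype.card_ne_zero) h1

/-- On an anti-symmetric `f` all permutations contribute equally, so the sum over them becomes a
factor `∏ N_s!`. -/
theorem mul_of_isAnti {F H : Elem ι d ℓ q} (hF : ∀ N, IsDistr k (F N)) (hH : ∀ N, IsDistr k (H N))
    {f : TestFn ι d ℓ (Var N)} (hf : IsCk k f) (ha : IsAnti f) :
    mul F H N f = ∑ n ∈ Finset.Icc 0 N, reorderSign n (fun s => N s - n s) * (∏ s, ((N s).choose (n s) : ℂ)) *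
      F n fun p => H (fun s => N s - n s) fun p' => f fun v => join p p' v := by
  refine Finset.sum_congr rfl fun n hn => ?_
  have hn' : n ≤ N := (Finset.mem_Icc.1 hn).2
  have h1 : ∀ π : (s : Fin q) → Equiv.Perm (Fin (N s)),
      (F n fun p => H (fun s => N s - n s) fun p' => f fun v => join p p' (permVar π v)) =
      signs π * F n fun p => H (fun s => N s - n s) fun p' => f fun v => join p p' v := by
    intro π
    have hpair : IsCk k fun p : Var n → Pt ι d ℓ => H (fun s => N s - n s) fun p' => f fun v => join p p' v := by
      simp only [join_eq]
      exact (hH _).isCk_pair hf splitVar_injective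
    rw [← (hF n).map_smul _ _ hpair]
    congr 1
    funext p
    rw [Pi.smul_apply, smul_eq_mul]
    have hfix : IsCk k fun p' : Var (fun s => N s - n s) → Pt ι d ℓ => f fun v => join p p' v := by
      have := hf.fix (e := fun v => (splitVar N n v).swap) (Sum.swap_leftInverse.injective.comp splitVar_injective) p
      convert this using 1
      funext p'
      congr 1
      funext v
      rw [join_eq]
      rcases splitVar N n v with u | u <;> rfl
    rw [← (hH _).map_smul _ _ hfix]
    congr 1
    funext p'
    exact ha π fun v => join p p' v
  simp only [h1, ← mul_assoc, signs_mul_self, one_mul]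
  rw [Finset.sum_const, Finset.card_univ, Fintype.card_pi, nsmul_eq_mul, ← mul_assoc]
  congr 1
  rw [mul_assoc]
  congr 1
  push_cast
  rw [← Finset.prod_mul_distrib]
  refine Finset.prod_congr rfl fun s _ => ?_
  rw [Fintype.card_perm, Fintype.card_fin, Nat.cast_choose ℂ (hn' s)]
  ring

/-- The variables of one species in a product. -/
def joinEquiv {n : Fin q → ℕ} (hn : n ≤ N) (s : Fin q) : Fin (n s) ⊕ Fin (N s - n s) ≃ Fin (N s) :=
  finSumFinEquiv.trans (finCongr (Nat.add_sub_of_le (hn s)))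

theorem join_inl {n : Fin q → ℕ} (hn : n ≤ N) {P : Type} (p : Var n → P) (p' : Var (fun s => N s - n s) → P)
    (s : Fin q) (i : Fin (n s)) : join p p' ⟨s, joinEquiv hn s (Sum.inl i)⟩ = p ⟨s, i⟩ := by
  simp [join, joinEquiv]

theorem join_inr {n : Fin q → ℕ} (hn : n ≤ N) {P : Type} (p : Var n → P) (p' : Var (fun s => N s - n s) → P)
    (s : Fin q) (i : Fin (N s - n s)) : join p p' ⟨s, joinEquiv hn s (Sum.inr i)⟩ = p' ⟨s, i⟩ := by
  simp [join, joinEquiv]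

/-- Separate permutations of the two blocks form one permutation of all variables, whose sign is the
product of the signs. This keeps partial pairings anti-symmetric. -/
theorem IsAnti.join {n : Fin q → ℕ} {f : TestFn ι d ℓ (Var N)} (ha : IsAnti f) (hn : n ≤ N)
    (π : (s : Fin q) → Equiv.Perm (Fin (n s))) (π' : (s : Fin q) → Equiv.Perm (Fin (N s - n s)))
    (p : Var n → Pt ι d ℓ) (p' : Var (fun s => N s - n s) → Pt ι d ℓ) :
    (f fun v => Grassmann.join (fun v => p (permVar π v)) (fun v => p' (permVar π' v)) v) =
      signs π * signs π' * f fun v => Grassmann.join p p' v := by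
  have h1 := ha (fun s => (joinEquiv hn s).permCongr (Equiv.sumCongr (π s) (π' s))) fun v => Grassmann.join p p' v
  have h2 : signs (N := N) (fun s => (joinEquiv hn s).permCongr (Equiv.sumCongr (π s) (π' s))) =
      signs π * signs π' := by
    simp only [signs, Equiv.Perm.sign_permCongr, Equiv.Perm.sign_sumCongr, ← Finset.prod_mul_distrib]
    push_cast
    rfl
  rw [h2] at h1
  rw [← h1]
  congr 1
  funext v
  obtain ⟨s, i⟩ := v
  obtain ⟨i, rfl⟩ := (joinEquiv hn s).surjective i
  simp only [permVar, Equiv.permCongr_apply, Equiv.symm_apply_apply]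
  rcases i with i | i
  · simp only [Equiv.sumCongr_apply, Sum.map_inl, join_inl]
  · simp only [Equiv.sumCongr_apply, Sum.map_inr, join_inr]

theorem signs_one : signs (1 : (s : Fin q) → Equiv.Perm (Fin (N s))) = 1 := by
  simp [signs]

theorem IsAnti.join_right {n : Fin q → ℕ} {f : TestFn ι d ℓ (Var N)} (ha : IsAnti f) (hn : n ≤ N)
    (p : Var n → Pt ι d ℓ) :
    IsAnti fun p' : Var (fun s => N s - n s) → Pt ι d ℓ => f fun v => Grassmann.join p p' v := by
  intro π p'
  have h1 := ha.join hn 1 π p p'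
  rw [signs_one, one_mul] at h1
  exact h1

theorem IsCk.join_right {n : Fin q → ℕ} {f : TestFn ι d ℓ (Var N)} (hf : IsCk k f) (p : Var n → Pt ι d ℓ) :
    IsCk k fun p' : Var (fun s => N s - n s) → Pt ι d ℓ => f fun v => join p p' v := by
  have := hf.fix (e := fun v => (splitVar N n v).swap) (Sum.swap_leftInverse.injective.comp splitVar_injective) p
  convert this using 1
  funext p'
  congr 1
  funext v
  rw [join_eq]
  rcases splitVar N n v with u | u <;> rfl

/-- The terms of the product `A T` on anti-symmetric test functions. -/
def mulTerm (A T : Elem ι d ℓ q) (N : Fin q → ℕ) (f : TestFn ι d ℓ (Var N)) (n : Fin q → ℕ) : ℂ :=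
  reorderSign n (fun s => N s - n s) * (∏ s, ((N s).choose (n s) : ℂ)) *
    A n fun p => T (fun s => N s - n s) fun p' => f fun v => join p p' v

open Classical in
theorem sum_mulTerm {A T : Elem ι d ℓ q} {e : Fin q → ℕ} (hA : ∀ n g, n ≠ e → A n g = 0)
    (f : TestFn ι d ℓ (Var N)) :
    ∑ n ∈ Finset.Icc 0 N, mulTerm A T N f n = if e ≤ N then mulTerm A T N f e else 0 := by
  have h0 : ∀ n, n ≠ e → mulTerm A T N f n = 0 := fun n hn => by rw [mulTerm, hA n _ hn, mul_zero]
  split_ifs with he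
  · exact Finset.sum_eq_single_of_mem e (Finset.mem_Icc.2 ⟨fun s => Nat.zero_le _, he⟩) fun n _ hn => h0 n hn
  · refine Finset.sum_eq_zero fun n hn => h0 n ?_
    rintro rfl
    exact he (Finset.mem_Icc.1 hn).2

/-- A solution of `A T = (deg / 2) T` is the exponential of the quadratic element `A`. -/
theorem pow_eq_of_recursion {A T : Elem ι d ℓ q} {h : Fin q → ℝ≥0∞} (hA : MemG k h A)
    (hAs : ∀ n (c : ℂ) g, A n (fun p => c * g p) = c * A n g)
    (hA2 : ∀ n g, ∑ s, n s ≠ 2 → A n g = 0)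
    (hT0 : ∀ N f, ∑ s, N s = 0 → T N f = one ι d ℓ q N f)
    (hrec : ∀ (N : Fin q → ℕ) (f : TestFn ι d ℓ (Var N)), IsCk k f → IsAnti f →
      2 * ∑ n ∈ Finset.Icc 0 N, mulTerm A T N f n = ((∑ s, N s : ℕ) : ℂ) * T N f) (j : ℕ) :
    ∀ (N : Fin q → ℕ) (f : TestFn ι d ℓ (Var N)), IsCk k f → IsAnti f →
      pow A j N f = if ∑ s, N s = 2 * j then (j.factorial : ℂ) * T N f else 0 := by
  induction j with
  | zero =>
    intro N f hf ha
    split_ifs with h0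
    · rw [hT0 N f h0]
      simp [pow]
    · unfold pow one
      refine dif_neg fun he => h0 ?_
      rw [isEmpty_var_iff.1 he]
      simp
  | succ j ih =>
    intro N f hf ha
    -- For fixed `p` the function of the other variables is still anti-symmetric, so the induction
    -- hypothesis replaces the power by `T` inside `A`. Removing the two fields of `A` lowers the
    -- degree by two.
    have h1 : pow A (j + 1) N f = ∑ n ∈ Finset.Icc 0 N, if ∑ s, N s = 2 * (j + 1) then
        (j.factorial : ℂ) * mulTerm A T N f n else 0 := by
      refine (mul_of_isAnti hA.distr (hA.pow j).1.distr hf ha).trans (Finset.sum_congr rfl fun n hn => ?_)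
      have hn' : n ≤ N := (Finset.mem_Icc.1 hn).2
      unfold mulTerm
      by_cases hn2 : ∑ s, n s = 2
      · have h2 : (fun p : Var n → Pt ι d ℓ => pow A j (fun s => N s - n s) fun p' => f fun v => join p p' v) =
            fun p => (if ∑ s, N s = 2 * (j + 1) then (j.factorial : ℂ) else 0) *
              T (fun s => N s - n s) fun p' => f fun v => join p p' v := by
          funext p
          rw [ih _ _ (hf.join_right p) (ha.join_right hn' p)]
          have h3 : ∑ s, (N s - n s) + ∑ s, n s = ∑ s, N s := by
            rw [← Finset.sum_add_distrib]
            exact Finset.sum_congr rfl fun s _ => Nat.sub_add_cancel (hn' s)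
          have h4 : ∑ s, (N s - n s) = 2 * j ↔ ∑ s, N s = 2 * (j + 1) := by omega
          simp only [h4]
          split_ifs <;> simp
        rw [h2, hAs]
        split_ifs
        · ring
        · simp
      · rw [hA2 n _ hn2, hA2 n _ hn2]
        simp
    rw [h1]
    split_ifs with h2
    · rw [← Finset.mul_sum, Nat.factorial_succ]
      have h3 := hrec N f hf ha
      rw [h2] at h3
      push_cast at h3 ⊢
      linear_combination (j.factorial : ℂ) / 2 * h3
    · simp

/-- As `A` is quadratic, only the power `j = deg / 2` contributes in a given degree, and its factor
`j!` cancels that of the exponential series. -/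
theorem exp_eq_of_recursion {A T : Elem ι d ℓ q} {h : Fin q → ℝ≥0∞} (hA : MemG k h A)
    (hAs : ∀ n (c : ℂ) g, A n (fun p => c * g p) = c * A n g)
    (hA2 : ∀ n g, ∑ s, n s ≠ 2 → A n g = 0)
    (hT0 : ∀ N f, ∑ s, N s = 0 → T N f = one ι d ℓ q N f)
    (hT1 : ∀ N f, ¬ Even (∑ s, N s) → T N f = 0)
    (hrec : ∀ (N : Fin q → ℕ) (f : TestFn ι d ℓ (Var N)), IsCk k f → IsAnti f →
      2 * ∑ n ∈ Finset.Icc 0 N, mulTerm A T N f n = ((∑ s, N s : ℕ) : ℂ) * T N f)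
    {f : TestFn ι d ℓ (Var N)} (hf : IsCk k f) (ha : IsAnti f) : exp A N f = T N f := by
  unfold exp
  simp only [pow_eq_of_recursion hA hAs hA2 hT0 hrec _ N f hf ha]
  rw [tsum_eq_single ((∑ s, N s) / 2)]
  · split_ifs with h0
    · rw [one_div, inv_mul_cancel_left₀ (by exact_mod_cast Nat.factorial_ne_zero _)]
    · rw [hT1 N f fun he => h0 (Nat.two_mul_div_two_of_even he).symm, mul_zero]
  · intro j hj
    rw [if_neg (by omega), mul_zero]

end Anti

/-! ### The exponential of the pairing with the sources -/

section Source

variable {ι : Type} [Fintype ι] {d k : ℕ} {ℓ : ℝ} [Fact (0 < ℓ)]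

/-- The variables `J, J̄` that are paired with `ψ, ψ̄`. -/
def dupVar {N : Fin 4 → ℕ} (h : N 0 = N 3 ∧ N 1 = N 2) : Var N → Var ![N 2, N 3]
  | ⟨0, i⟩ => ⟨1, Fin.cast h.1 i⟩
  | ⟨1, i⟩ => ⟨0, Fin.cast h.2 i⟩
  | ⟨2, i⟩ => ⟨0, i⟩
  | ⟨3, i⟩ => ⟨1, i⟩

/-- The kernels of `e^{⟨J̄, ψ⟩ + ⟨ψ̄, J⟩}`. -/
def expSource : Elem ι d ℓ 4 := fun N f =>
  if h : N 0 = N 3 ∧ N 1 = N 2 then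
    -- With `a = N 3` and `b = N 2`: sorting `⟨J̄, ψ⟩^a` into `ψ^a J̄^a` gives `a` signs from `J̄ ψ
    -- = -ψ J̄` and `a.choose 2` from the reordering; sorting `⟨ψ̄, J⟩^b` gives `b.choose 2`. The
    -- kernel normalization turns `1 / (a! b!)` into `a! b!`.
    (-1) ^ ((N 3 + 1).choose 2 + (N 2).choose 2) * ((N 3).factorial * (N 2).factorial : ℂ) *
      ptInt fun q : Var ![N 2, N 3] → Pt ι d ℓ => f fun v => q (dupVar h v)
  else 0

theorem ptInt_isEmpty {V : Type} [Fintype V] [DecidableEq V] [IsEmpty V] (g : TestFn ι d ℓ V) :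
    ptInt g = g isEmptyElim := by
  simp only [ptInt, comp, Fintype.sum_unique]
  rw [integral_unique]
  simp only [volume_pi, Measure.real, Measure.pi_univ, Finset.univ_eq_empty, Finset.prod_empty,
    ENNReal.toReal_one, one_smul]
  congr 1
  funext v
  exact isEmptyElim v

theorem pairJbarPsi_eq (f : TestFn ι d ℓ (Var ![1, 0, 0, 1])) :
    pairJbarPsi ι d ℓ ![1, 0, 0, 1] f = -ptInt fun q : Unit → Pt ι d ℓ => f fun _ => q () := by
  simp [pairJbarPsi, ptInt_unit]

theorem pairPsibarJ_eq (f : TestFn ι d ℓ (Var ![0, 1, 1, 0])) :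
    pairPsibarJ ι d ℓ ![0, 1, 1, 0] f = ptInt fun q : Unit → Pt ι d ℓ => f fun _ => q () := by
  simp [pairPsibarJ, ptInt_unit]

theorem expSource_eq (a b : ℕ) (f : TestFn ι d ℓ (Var ![a, b, b, a])) :
    expSource ![a, b, b, a] f = (-1) ^ ((a + 1).choose 2 + b.choose 2) * (a.factorial * b.factorial : ℂ) *
      ptInt fun q : Var ![b, a] → Pt ι d ℓ => f fun v => q (dupVar (N := ![a, b, b, a]) ⟨rfl, rfl⟩ v) :=
  dif_pos _

/-- Single out the first of the variables `J̄`. -/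
def consSnd (b a : ℕ) : Var ![b, a + 1] ≃ Unit ⊕ Var ![b, a] where
  toFun
    | ⟨0, i⟩ => Sum.inr ⟨0, i⟩
    | ⟨1, i⟩ => Fin.cases (motive := fun _ => Unit ⊕ Var ![b, a]) (Sum.inl ()) (fun i => Sum.inr ⟨1, i⟩) i
  invFun
    | Sum.inl _ => ⟨1, (0 : Fin (a + 1))⟩
    | Sum.inr ⟨0, i⟩ => ⟨0, i⟩
    | Sum.inr ⟨1, i⟩ => ⟨1, Fin.succ i⟩
  left_inv v := by
    match v with
    | ⟨0, i⟩ => rfl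
    | ⟨1, i⟩ =>
      revert i
      exact Fin.cases (n := a) rfl fun i => rfl
  right_inv v := by
    match v with
    | Sum.inl _ => rfl
    | Sum.inr ⟨0, i⟩ => rfl
    | Sum.inr ⟨1, i⟩ => rfl

/-- Single out the first of the variables `J`. -/
def consFst (b a : ℕ) : Var ![b + 1, a] ≃ Unit ⊕ Var ![b, a] where
  toFun
    | ⟨0, i⟩ => Fin.cases (motive := fun _ => Unit ⊕ Var ![b, a]) (Sum.inl ()) (fun i => Sum.inr ⟨0, i⟩) i
    | ⟨1, i⟩ => Sum.inr ⟨1, i⟩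
  invFun
    | Sum.inl _ => ⟨0, (0 : Fin (b + 1))⟩
    | Sum.inr ⟨0, i⟩ => ⟨0, Fin.succ i⟩
    | Sum.inr ⟨1, i⟩ => ⟨1, i⟩
  left_inv v := by
    match v with
    | ⟨0, i⟩ =>
      revert i
      exact Fin.cases (n := b) rfl fun i => rfl
    | ⟨1, i⟩ => rfl
  right_inv v := by
    match v with
    | Sum.inl _ => rfl
    | Sum.inr ⟨0, i⟩ => rfl
    | Sum.inr ⟨1, i⟩ => rfl

theorem expSource_of_not {N : Fin 4 → ℕ} (h : ¬(N 0 = N 3 ∧ N 1 = N 2)) (f : TestFn ι d ℓ (Var N)) :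
    expSource N f = 0 := dif_neg h

/-- Two binomial coefficients `a + 1` meet `a!`, giving `(a + 1) (a + 1)!`; the signs `-(-1) ^ a`
account for the step from `(a + 1).choose 2` to `(a + 2).choose 2`. -/
theorem mulTerm_pairJbarPsi {a b : ℕ} {f : TestFn ι d ℓ (Var ![a + 1, b, b, a + 1])} (hf : ContTF f) :
    mulTerm (pairJbarPsi ι d ℓ) expSource _ f ![1, 0, 0, 1] = (a + 1 : ℂ) * expSource _ f := by
  have hT : ∀ f' : TestFn ι d ℓ (Var fun s => ![a + 1, b, b, a + 1] s - ![1, 0, 0, 1] s), expSource _ f' =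
      (-1) ^ ((a + 1).choose 2 + b.choose 2) * (a.factorial * b.factorial : ℂ) *
      ptInt fun q : Var ![b, a] → Pt ι d ℓ => f' fun v =>
        q (dupVar (N := fun s => ![a + 1, b, b, a + 1] s - ![1, 0, 0, 1] s) ⟨rfl, rfl⟩ v) := fun f' => dif_pos _
  have h1 : ∀ (x : Unit → Pt ι d ℓ) (p' : Var ![b, a] → Pt ι d ℓ) (v : Var ![a + 1, b, b, a + 1]),
      join (n := ![1, 0, 0, 1]) (fun _ => x ()) (fun v =>
        p' (dupVar (N := fun s => ![a + 1, b, b, a + 1] s - ![1, 0, 0, 1] s) ⟨rfl, rfl⟩ v)) v =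
      Sum.elim x p' (consSnd b a (dupVar (N := ![a + 1, b, b, a + 1]) ⟨rfl, rfl⟩ v)) := by
    intro x p' v
    match v with
    | ⟨0, i⟩ =>
      revert i
      exact Fin.cases (n := a) rfl fun i => rfl
    | ⟨1, i⟩ => rfl
    | ⟨2, i⟩ => rfl
    | ⟨3, i⟩ =>
      revert i
      exact Fin.cases (n := a) rfl fun i => rfl
  have h3 : (ptInt fun x : Unit → Pt ι d ℓ => ptInt fun p' : Var ![b, a] → Pt ι d ℓ => f fun v =>
      join (n := ![1, 0, 0, 1]) (fun _ => x ()) (fun v =>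
        p' (dupVar (N := fun s => ![a + 1, b, b, a + 1] s - ![1, 0, 0, 1] s) ⟨rfl, rfl⟩ v)) v) =
      ptInt fun q : Var ![b, a + 1] → Pt ι d ℓ => f fun v =>
        q (dupVar (N := ![a + 1, b, b, a + 1]) ⟨rfl, rfl⟩ v) := by
    simp only [h1]
    exact (ptInt_split (consSnd b a) (hf.comp_any (dupVar (N := ![a + 1, b, b, a + 1]) ⟨rfl, rfl⟩))).symm
  have h2 : reorderSign ![1, 0, 0, 1] (fun s => ![a + 1, b, b, a + 1] s - ![1, 0, 0, 1] s) = (-1) ^ a := by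
    simp only [reorderSign, Fin.prod_univ_four]
    simp [← pow_add, show a + b + b = a + 2 * b by ring]
    simp [pow_add]
  unfold mulTerm
  rw [pairJbarPsi_eq, expSource_eq, h2]
  simp only [hT]
  rw [ptInt_smul, h3]
  simp [Fin.prod_univ_four, Nat.factorial_succ, Nat.choose_succ_succ' (a + 1) 1, pow_add]
  ring

/-- Same count as for the other source; here the sign is `(-1) ^ b`, the step from `b.choose 2` to
`(b + 1).choose 2`. -/
theorem mulTerm_pairPsibarJ {a b : ℕ} {f : TestFn ι d ℓ (Var ![a, b + 1, b + 1, a])} (hf : ContTF f) :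
    mulTerm (pairPsibarJ ι d ℓ) expSource _ f ![0, 1, 1, 0] = (b + 1 : ℂ) * expSource _ f := by
  have hT : ∀ f' : TestFn ι d ℓ (Var fun s => ![a, b + 1, b + 1, a] s - ![0, 1, 1, 0] s), expSource _ f' =
      (-1) ^ ((a + 1).choose 2 + b.choose 2) * (a.factorial * b.factorial : ℂ) *
      ptInt fun q : Var ![b, a] → Pt ι d ℓ => f' fun v =>
        q (dupVar (N := fun s => ![a, b + 1, b + 1, a] s - ![0, 1, 1, 0] s) ⟨rfl, rfl⟩ v) := fun f' => dif_pos _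
  have h1 : ∀ (x : Unit → Pt ι d ℓ) (p' : Var ![b, a] → Pt ι d ℓ) (v : Var ![a, b + 1, b + 1, a]),
      join (n := ![0, 1, 1, 0]) (fun _ => x ()) (fun v =>
        p' (dupVar (N := fun s => ![a, b + 1, b + 1, a] s - ![0, 1, 1, 0] s) ⟨rfl, rfl⟩ v)) v =
      Sum.elim x p' (consFst b a (dupVar (N := ![a, b + 1, b + 1, a]) ⟨rfl, rfl⟩ v)) := by
    intro x p' v
    match v with
    | ⟨0, i⟩ => rfl
    | ⟨1, i⟩ =>
      revert i
      exact Fin.cases (n := b) rfl fun i => rfl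
    | ⟨2, i⟩ =>
      revert i
      exact Fin.cases (n := b) rfl fun i => rfl
    | ⟨3, i⟩ => rfl
  have h3 : (ptInt fun x : Unit → Pt ι d ℓ => ptInt fun p' : Var ![b, a] → Pt ι d ℓ => f fun v =>
      join (n := ![0, 1, 1, 0]) (fun _ => x ()) (fun v =>
        p' (dupVar (N := fun s => ![a, b + 1, b + 1, a] s - ![0, 1, 1, 0] s) ⟨rfl, rfl⟩ v)) v) =
      ptInt fun q : Var ![b + 1, a] → Pt ι d ℓ => f fun v =>
        q (dupVar (N := ![a, b + 1, b + 1, a]) ⟨rfl, rfl⟩ v) := by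
    simp only [h1]
    exact (ptInt_split (consFst b a) (hf.comp_any (dupVar (N := ![a, b + 1, b + 1, a]) ⟨rfl, rfl⟩))).symm
  have h2 : reorderSign ![0, 1, 1, 0] (fun s => ![a, b + 1, b + 1, a] s - ![0, 1, 1, 0] s) = (-1) ^ b := by
    simp only [reorderSign, Fin.prod_univ_four]
    simp [← pow_add, show a + (a + b) = b + 2 * a by ring]
    simp [pow_add]
  unfold mulTerm
  rw [pairPsibarJ_eq, expSource_eq, h2]
  simp only [hT]
  rw [ptInt_smul, h3]
  simp [Fin.prod_univ_four, Nat.factorial_succ, Nat.choose_succ_succ' b 1, pow_add]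
  ring

/-- In the degree `(a, b, b, a)` the two sources contribute `a` and `b`, together half of the total
degree. -/
theorem two_mul_sum_mulTerm_source {N : Fin 4 → ℕ} {f : TestFn ι d ℓ (Var N)} (hf : ContTF f) :
    2 * ∑ n ∈ Finset.Icc 0 N,
      mulTerm (fun N f => pairJbarPsi ι d ℓ N f + pairPsibarJ ι d ℓ N f) expSource N f n =
      ((∑ s, N s : ℕ) : ℂ) * expSource N f := by
  classical
  have h0 : ∀ n, mulTerm (fun N f => pairJbarPsi ι d ℓ N f + pairPsibarJ ι d ℓ N f) expSource N f n =
      mulTerm (pairJbarPsi ι d ℓ) expSource N f n + mulTerm (pairPsibarJ ι d ℓ) expSource N f n :=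
    fun n => mul_add _ _ _
  simp only [h0]
  rw [Finset.sum_add_distrib, sum_mulTerm (A := pairJbarPsi ι d ℓ) (e := ![1, 0, 0, 1]) (fun n g hn => if_neg hn),
    sum_mulTerm (A := pairPsibarJ ι d ℓ) (e := ![0, 1, 1, 0]) (fun n g hn => if_neg hn)]
  by_cases hN : N 0 = N 3 ∧ N 1 = N 2
  · obtain ⟨a, b, rfl⟩ : ∃ a b, N = ![a, b, b, a] := by
      refine ⟨N 3, N 2, ?_⟩
      funext s
      fin_cases s
      · exact hN.1
      · exact hN.2
      · rfl
      · rfl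
    have h1 : (if ![1, 0, 0, 1] ≤ ![a, b, b, a] then
        mulTerm (pairJbarPsi ι d ℓ) expSource ![a, b, b, a] f ![1, 0, 0, 1] else 0) = (a : ℂ) * expSource _ f := by
      cases a with
      | zero =>
        rw [if_neg fun h => absurd (h 0) (by simp)]
        simp
      | succ a =>
        rw [if_pos, mulTerm_pairJbarPsi hf]
        · push_cast; rfl
        · intro s
          fin_cases s <;> simp
    have h2 : (if ![0, 1, 1, 0] ≤ ![a, b, b, a] then
        mulTerm (pairPsibarJ ι d ℓ) expSource ![a, b, b, a] f ![0, 1, 1, 0] else 0) = (b : ℂ) * expSource _ f := by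
      cases b with
      | zero =>
        rw [if_neg fun h => absurd (h 1) (by simp)]
        simp
      | succ b =>
        rw [if_pos, mulTerm_pairPsibarJ hf]
        · push_cast; rfl
        · intro s
          fin_cases s <;> simp
    rw [h1, h2]
    simp only [Fin.sum_univ_four, Matrix.cons_val]
    push_cast
    ring
  -- Removing a balanced pair of fields does not repair an imbalance, so both sides vanish.
  · have h1 : ∀ n : Fin 4 → ℕ, n 0 = n 3 → n 1 = n 2 → n ≤ N →
        ∀ f', expSource (ι := ι) (d := d) (ℓ := ℓ) (fun s => N s - n s) f' = 0 := by
      intro n h03 h12 hn f'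
      refine expSource_of_not (fun h => hN ?_) f'
      have e0 : n 0 ≤ N 0 := hn 0
      have e1 : n 1 ≤ N 1 := hn 1
      have e2 : n 2 ≤ N 2 := hn 2
      have e3 : n 3 ≤ N 3 := hn 3
      have h1 : N 0 - n 0 = N 3 - n 3 := h.1
      have h2 : N 1 - n 1 = N 2 - n 2 := h.2
      omega
    rw [expSource_of_not hN]
    split_ifs with ha hb hb
    · simp [mulTerm, h1 _ rfl rfl ha, h1 _ rfl rfl hb, pairJbarPsi, pairPsibarJ]
    · simp [mulTerm, h1 _ rfl rfl ha, pairJbarPsi]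
    · simp [mulTerm, h1 _ rfl rfl hb, pairPsibarJ]
    · simp

theorem exp_source_eq {N : Fin 4 → ℕ} {f : TestFn ι d ℓ (Var N)} (hf : IsCk k f) (ha : IsAnti f) :
    exp (fun N f => pairJbarPsi ι d ℓ N f + pairPsibarJ ι d ℓ N f) N f = expSource N f := by
  -- The identity does not involve the weights; `1` is merely a finite choice.
  refine exp_eq_of_recursion (h := fun _ => 1) ((memG_pairJbarPsi (k := k) (by simp)).add
    (memG_pairPsibarJ (by simp))) ?_ ?_ ?_ ?_ (fun N f hf _ => two_mul_sum_mulTerm_source hf.contTF) hf ha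
  · intro n c g
    simp only [pairJbarPsi, pairPsibarJ]
    split_ifs <;> simp [integral_const_mul, Finset.mul_sum]
  · intro n g hn
    simp only [pairJbarPsi, pairPsibarJ]
    rw [if_neg, if_neg, add_zero]
    · rintro rfl
      exact hn (by decide)
    · rintro rfl
      exact hn (by decide)
  · intro N f hN
    have h0 : N = ![0, 0, 0, 0] := by
      simp only [Finset.sum_eq_zero_iff, Finset.mem_univ, true_imp_iff] at hN
      funext s
      fin_cases s <;> exact hN _
    subst h0
    have he : IsEmpty (Var ![0, 0, 0, 0]) := isEmpty_var_iff.2 (by decide)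
    have he' : IsEmpty (Var ![0, 0]) := isEmpty_var_iff.2 (by decide)
    rw [expSource_eq, ptInt_isEmpty, one, dif_pos he]
    simp
    exact congrArg f (funext fun v => he.elim v)
  · intro N f hN
    refine expSource_of_not (fun h => hN ?_) f
    rw [Fin.sum_univ_four, h.1, h.2]
    exact ⟨N 3 + N 2, by ring⟩

end Source

/-! ### The exponential of the covariance -/

section Covariance

variable {ι : Type} [Fintype ι] {d k : ℕ} {ℓ : ℝ} [Fact (0 < ℓ)]

/-- Lets statements about `𝓒_k` be used for functions that are only continuous. -/
theorem ContTF.isCk_zero {V : Type} [Fintype V] [DecidableEq V] {f : TestFn ι d ℓ V} (hf : ContTF f) :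
    IsCk 0 f := by
  have h0 : ∀ w : List (V × Fin d), AdmWord 0 w → w = [] := by
    intro w hw
    match w with
    | [] => rfl
    | p :: w =>
      have := hw p.1
      simp at this
  refine fun a => ⟨fun w hw => ?_, fun p w hw => absurd (h0 _ hw) (by simp)⟩
  rw [h0 w hw]
  exact hf a

theorem ContTF.ptInt {P Q : Type} [Fintype P] [DecidableEq P] [Fintype Q] [DecidableEq Q]
    {f : TestFn ι d ℓ (P ⊕ Q)} (hf : ContTF f) :
    ContTF (fun q => Grassmann.ptInt fun p => f (Sum.elim p q)) :=
  hf.isCk_zero.ptInt.contTF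

/-- The covariance of two points. -/
def covPt (G : ι → ι → Torus d ℓ → ℂ) (p p' : Pt ι d ℓ) : ℂ := G p.1 p'.1 (p.2 - p'.2)

/-- The kernels of `e^{⟨J̄, G J⟩}`. -/
def expCov (G : ι → ι → Torus d ℓ → ℂ) : Elem ι d ℓ 2 := fun N f =>
  if h : N 0 = N 1 then
    -- For `j` fields of each kind: `j` signs from `J̄ J = -J J̄`, and `j.choose 2` from sorting `(J
    -- J̄)^j` into `J^j J̄^j`.
    (-1) ^ ((N 0 + 1).choose 2) * ((N 0).factorial : ℂ) *
      ptInt fun q : Var N → Pt ι d ℓ => (∏ i, covPt G (q ⟨1, Fin.cast h i⟩) (q ⟨0, i⟩)) * f q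
  else 0

variable {G : ι → ι → Torus d ℓ → ℂ}

theorem expCov_of_not {N : Fin 2 → ℕ} (h : ¬N 0 = N 1) (f : TestFn ι d ℓ (Var N)) : expCov G N f = 0 := dif_neg h

theorem expCov_eq (j : ℕ) (f : TestFn ι d ℓ (Var ![j, j])) :
    expCov G ![j, j] f = (-1) ^ ((j + 1).choose 2) * (j.factorial : ℂ) *
      ptInt fun q : Var ![j, j] → Pt ι d ℓ => (∏ i : Fin j, covPt G (q ⟨1, i⟩) (q ⟨0, i⟩)) * f q :=
  dif_pos rfl

/-- The two variables of `⟨J̄, G J⟩`. -/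
def pairVar : Unit ⊕ Unit ≃ Var ![1, 1] where
  toFun := Sum.elim (fun _ => ⟨1, (0 : Fin 1)⟩) fun _ => ⟨0, (0 : Fin 1)⟩
  invFun v := if v.1 = 0 then Sum.inr () else Sum.inl ()
  left_inv v := by rcases v with v | v <;> rfl
  right_inv v := by
    match v with
    | ⟨0, i⟩ => exact var_ext rfl (by simp; omega)
    | ⟨1, i⟩ => exact var_ext rfl (by simp; omega)

theorem pairJbarGJ_eq_ptInt (hG : ∀ a b, Continuous (G a b)) {f : TestFn ι d ℓ (Var ![1, 1])} (hf : ContTF f) :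
    pairJbarGJ G ![1, 1] f = -ptInt fun p : Var ![1, 1] → Pt ι d ℓ =>
      covPt G (p ⟨1, (0 : Fin 1)⟩) (p ⟨0, (0 : Fin 1)⟩) * f p := by
  rw [pairJbarGJ_eq hG rfl hf, ptInt_reindex pairVar]
  congr 2
  funext p
  congr 2
  funext v
  exact congrArg p (pairVar.apply_symm_apply v)

theorem contTF_covPt (hG : ∀ a b, Continuous (G a b)) {V : Type} [Fintype V] [DecidableEq V] (v v' : V) :
    ContTF fun q : V → Pt ι d ℓ => covPt G (q v) (q v') := contTF_cov hG v v'

theorem ContTF.const_mul {V : Type} [Fintype V] [DecidableEq V] {f : TestFn ι d ℓ V} (hf : ContTF f) (c : ℂ) :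
    ContTF fun p => c * f p := fun a => continuous_const.mul (hf a)

/-- The first pair is split off from the product of covariances; two binomial coefficients `j + 1`
and a sign `-(-1) ^ j` give the recursion, as for the sources. -/
theorem mulTerm_pairJbarGJ (hG : ∀ a b, Continuous (G a b)) {j : ℕ}
    {f : TestFn ι d ℓ (Var ![j + 1, j + 1])} (hf : ContTF f) :
    mulTerm (pairJbarGJ G) (expCov G) _ f ![1, 1] = (j + 1 : ℂ) * expCov G _ f := by
  have hT : ∀ f' : TestFn ι d ℓ (Var fun s => ![j + 1, j + 1] s - ![1, 1] s), expCov G _ f' =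
      (-1) ^ ((j + 1).choose 2) * (j.factorial : ℂ) *
      ptInt fun q : Var (fun s => ![j + 1, j + 1] s - ![1, 1] s) → Pt ι d ℓ =>
        (∏ i : Fin j, covPt G (q ⟨1, i⟩) (q ⟨0, i⟩)) * f' q := fun f' => dif_pos rfl
  have hle : ![1, 1] ≤ ![j + 1, j + 1] := by
    intro s
    fin_cases s <;> simp
  have hc : ContTF fun pp : Var ![1, 1] ⊕ Var (fun s => ![j + 1, j + 1] s - ![1, 1] s) → Pt ι d ℓ =>
      (∏ i : Fin j, covPt G (pp (Sum.inr ⟨1, i⟩)) (pp (Sum.inr ⟨0, i⟩))) * f fun v => pp (splitEquiv hle v) :=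
    (contTF_prod _ fun i _ => contTF_covPt hG _ _).mul (hf.comp_any _)
  have hc2 : ContTF fun p : Var ![1, 1] → Pt ι d ℓ =>
      ptInt fun q : Var (fun s => ![j + 1, j + 1] s - ![1, 1] s) → Pt ι d ℓ =>
        (∏ i : Fin j, covPt G (q ⟨1, i⟩) (q ⟨0, i⟩)) * f fun v => join p q v := by
    have := (hc.comp_any (Equiv.sumComm _ _)).ptInt
    convert this using 1
    funext p
    congr 1
    funext q
    congr 2
    funext v
    rw [join_eq]
    show _ = Sum.elim q p (Sum.swap (splitVar _ _ v))
    rcases splitVar _ _ v with u | u <;> rfl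
  have h3 : (ptInt fun p : Var ![1, 1] → Pt ι d ℓ => covPt G (p ⟨1, (0 : Fin 1)⟩) (p ⟨0, (0 : Fin 1)⟩) *
      ptInt fun q : Var (fun s => ![j + 1, j + 1] s - ![1, 1] s) → Pt ι d ℓ =>
        (∏ i : Fin j, covPt G (q ⟨1, i⟩) (q ⟨0, i⟩)) * f fun v => join p q v) =
      ptInt fun q : Var ![j + 1, j + 1] → Pt ι d ℓ =>
        (∏ i : Fin (j + 1), covPt G (q ⟨1, i⟩) (q ⟨0, i⟩)) * f q := by
    refine Eq.trans ?_ (ptInt_split (splitEquiv hle)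
      ((contTF_prod _ fun i _ => contTF_covPt hG _ _).mul hf)).symm
    congr 1
    funext p
    rw [← ptInt_smul]
    congr 1
    funext q
    rw [← mul_assoc, Fin.prod_univ_succ]
    congr 2
    funext v
    exact join_eq p q v
  have h2 : reorderSign ![1, 1] (fun s => ![j + 1, j + 1] s - ![1, 1] s) = (-1) ^ j := by
    simp [reorderSign, Fin.prod_univ_two]
  unfold mulTerm
  rw [expCov_eq, h2]
  simp only [hT]
  rw [pairJbarGJ_eq_ptInt hG (hc2.const_mul _)]
  simp only [mul_left_comm (covPt G _ _)]
  rw [ptInt_smul, h3]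
  simp [Fin.prod_univ_two, Nat.factorial_succ, Nat.choose_succ_succ' (j + 1) 1, pow_add]
  ring

theorem two_mul_sum_mulTerm_cov (hG : ∀ a b, Continuous (G a b)) {N : Fin 2 → ℕ} {f : TestFn ι d ℓ (Var N)}
    (hf : ContTF f) : 2 * ∑ n ∈ Finset.Icc 0 N, mulTerm (pairJbarGJ G) (expCov G) N f n =
      ((∑ s, N s : ℕ) : ℂ) * expCov G N f := by
  classical
  rw [sum_mulTerm (A := pairJbarGJ G) (e := ![1, 1]) (fun n g hn => if_neg hn)]
  by_cases hN : N 0 = N 1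
  · obtain ⟨j, rfl⟩ : ∃ j, N = ![j, j] := by
      refine ⟨N 1, ?_⟩
      funext s
      fin_cases s
      · exact hN
      · rfl
    cases j with
    | zero =>
      rw [if_neg fun h => absurd (h 0) (by simp)]
      simp
    | succ j =>
      rw [if_pos, mulTerm_pairJbarGJ hG hf]
      · simp only [Fin.sum_univ_two, Matrix.cons_val_zero, Matrix.cons_val_one]
        push_cast
        ring
      · intro s
        fin_cases s <;> simp
  · rw [expCov_of_not hN]
    split_ifs with ha
    · have h1 : ∀ f', expCov G (fun s => N s - ![1, 1] s) f' = 0 := by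
        intro f'
        refine expCov_of_not (fun h => hN ?_) f'
        have h0 : 1 ≤ N 0 := ha 0
        have h1 : 1 ≤ N 1 := ha 1
        have h2 : N 0 - 1 = N 1 - 1 := h
        omega
      simp [mulTerm, h1, pairJbarGJ]
    · simp

theorem exp_cov_eq (hG : ∀ a b, Continuous (G a b)) {N : Fin 2 → ℕ} {f : TestFn ι d ℓ (Var N)} (hf : IsCk k f)
    (ha : IsAnti f) : exp (pairJbarGJ G) N f = expCov G N f := by
  refine exp_eq_of_recursion (h := fun _ => 1) (memG_pairJbarGJ (k := k) (by simp) hG) ?_ ?_ ?_ ?_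
    (fun N f hf _ => two_mul_sum_mulTerm_cov hG hf.contTF) hf ha
  · intro n c g
    simp only [pairJbarGJ]
    split_ifs
    · simp only [mul_left_comm (G _ _ _), integral_const_mul, Finset.mul_sum, mul_neg]
    · simp
  · intro n g hn
    refine if_neg ?_
    rintro rfl
    exact hn (by decide)
  · intro N f hN
    have h0 : N = ![0, 0] := by
      simp only [Finset.sum_eq_zero_iff, Finset.mem_univ, true_imp_iff] at hN
      funext s
      fin_cases s <;> exact hN _
    subst h0
    have he : IsEmpty (Var ![0, 0]) := isEmpty_var_iff.2 (by decide)
    rw [expCov_eq, ptInt_isEmpty, one, dif_pos he]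
    simp
    exact congrArg f (funext fun v => he.elim v)
  · intro N f hN
    refine expCov_of_not (fun h => hN ?_) f
    rw [Fin.sum_univ_two, h]
    exact ⟨N 1, rfl⟩

end Covariance

/-! ### Bijections between disjoint unions -/

section Bijections

/-- Equal cardinalities and equally many `true` values make the fibres equinumerous; the bijections
of the fibres are glued. -/
theorem exists_equiv_of_card {X Y : Type*} [Fintype X] [Fintype Y] (f : X → Bool) (g : Y → Bool)
    (hc : Fintype.card X = Fintype.card Y) (h : ∑ x, (if f x then 1 else 0) = ∑ y, if g y then 1 else 0) :
    ∃ e : X ≃ Y, ∀ x, g (e x) = f x := by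
  have h1 : Fintype.card {x // f x = true} = Fintype.card {y // g y = true} := by
    rw [Fintype.card_subtype, Fintype.card_subtype, Finset.card_filter, Finset.card_filter]
    exact h
  have h2 : ∀ c, Nonempty ({x // f x = c} ≃ {y // g y = c}) := by
    intro c
    refine ⟨Fintype.equivOfCardEq ?_⟩
    cases c with
    | true => exact h1
    | false =>
      have hX := Fintype.card_subtype_compl fun x => f x = true
      have hY := Fintype.card_subtype_compl fun y => g y = true
      simp only [Bool.not_eq_true] at hX hY
      rw [hX, hY, hc, h1]
  exact ⟨Equiv.ofFiberEquiv fun c => (h2 c).some, fun x => Equiv.ofFiberEquiv_map _ x⟩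

theorem exists_sumCongr {A B : Type*} [Finite A] [Finite B] (τ : Equiv.Perm (A ⊕ B))
    (h : ∀ x, (τ x).isLeft = x.isLeft) :
    ∃ (α : Equiv.Perm A) (β : Equiv.Perm B), τ = Equiv.sumCongr α β := by
  have h1 : τ ∈ (Equiv.Perm.sumCongrHom A B).range := by
    refine Equiv.Perm.mem_sumCongrHom_range_of_perm_mapsTo_inl ?_
    rintro _ ⟨a, rfl⟩
    obtain ⟨b, hb⟩ := Sum.isLeft_iff.1 ((h (Sum.inl a)).trans rfl)
    exact ⟨b, hb.symm⟩
  obtain ⟨⟨α, β⟩, hαβ⟩ := h1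
  exact ⟨α, β, hαβ.symm⟩

variable {L M K M' : ℕ}

/-- The number of elements of the first summand that are mapped to the first summand. -/
def leftCount (σ : Fin L ⊕ Fin M ≃ Fin K ⊕ Fin M') : ℕ := ∑ i : Fin L, if (σ (Sum.inl i)).isLeft then 1 else 0

theorem leftCount_add (σ : Fin L ⊕ Fin M ≃ Fin K ⊕ Fin M') :
    leftCount σ + (∑ i : Fin M, if (σ (Sum.inr i)).isLeft then 1 else 0) = K := by
  have h := Equiv.sum_comp σ fun c => if c.isLeft then 1 else 0
  rw [Fintype.sum_sum_type, Fintype.sum_sum_type] at h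
  refine Eq.trans h ?_
  simp

theorem card_eq_of_equiv (σ : Fin L ⊕ Fin M ≃ Fin K ⊕ Fin M') : K + M' = L + M := by
  simpa using (Fintype.card_congr σ).symm

/-- The bijections with a given `leftCount` form a single orbit under permutations within the four
blocks: rows are first matched by the side of their image, and the columns then differ by a
permutation preserving sides. -/
theorem exists_perm_of_leftCount_eq {σ σ' : Fin L ⊕ Fin M ≃ Fin K ⊕ Fin M'}
    (h : leftCount σ = leftCount σ') : ∃ (α : Equiv.Perm (Fin L)) (α' : Equiv.Perm (Fin M))
      (β : Equiv.Perm (Fin K)) (β' : Equiv.Perm (Fin M')),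
      σ' = (Equiv.sumCongr α α').symm.trans (σ.trans (Equiv.sumCongr β β')) := by
  have h2 := leftCount_add σ
  have h2' := leftCount_add σ'
  obtain ⟨α, hα⟩ := exists_equiv_of_card (fun i : Fin L => (σ (Sum.inl i)).isLeft)
    (fun i : Fin L => (σ' (Sum.inl i)).isLeft) rfl h
  obtain ⟨α', hα'⟩ := exists_equiv_of_card (fun i : Fin M => (σ (Sum.inr i)).isLeft)
    (fun i : Fin M => (σ' (Sum.inr i)).isLeft) rfl (by omega)
  obtain ⟨β, β', hβ⟩ := exists_sumCongr (σ.symm.trans ((Equiv.sumCongr α α').trans σ')) (by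
    intro c
    obtain ⟨r, rfl⟩ := σ.surjective c
    rcases r with i | i
    · simpa using hα i
    · simpa using hα' i)
  refine ⟨α, α', β, β', ?_⟩
  rw [← hβ]
  ext r
  simp

/-- Composition with one such bijection `σ₀` turns the count into that of the permutations of the
columns preserving their side, of which there are `K! M'!`. -/
theorem card_isLeft_eq (f : Fin L ⊕ Fin M → Bool) (hn : L + M = K + M')
    (hf : ∑ r, (if f r then 1 else 0) = K) :
    Fintype.card {σ : Fin L ⊕ Fin M ≃ Fin K ⊕ Fin M' // ∀ r, (σ r).isLeft = f r} =
      K.factorial * M'.factorial := by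
  obtain ⟨σ₀, h₀⟩ := exists_equiv_of_card f (fun c : Fin K ⊕ Fin M' => c.isLeft) (by simpa using hn) (by
    rw [hf, Fintype.sum_sum_type]
    simp)
  have e : {σ : Fin L ⊕ Fin M ≃ Fin K ⊕ Fin M' // ∀ r, (σ r).isLeft = f r} ≃
      {τ : Equiv.Perm (Fin K ⊕ Fin M') // Sum.isLeft ∘ τ = Sum.isLeft} :=
    (Equiv.equivCongr σ₀ (Equiv.refl _)).subtypeEquiv fun σ => by
      constructor
      · intro h
        funext c
        obtain ⟨r, rfl⟩ := σ₀.surjective c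
        simp [h, h₀]
      · intro h r
        have := congrFun h (σ₀ r)
        simpa [h₀] using this
  rw [Fintype.card_congr e, DomMulAct.stabilizer_card]
  have h1 : Fintype.card {c : Fin K ⊕ Fin M' // c.isLeft = true} = K := by
    rw [Fintype.card_subtype, Finset.card_filter, Fintype.sum_sum_type]
    simp
  have h2 : Fintype.card {c : Fin K ⊕ Fin M' // c.isLeft = false} = M' := by
    rw [Fintype.card_subtype, Finset.card_filter, Fintype.sum_sum_type]
    simp
  rw [Fintype.prod_bool, h1, h2]

/-- Fibring over the sets of rows sent to the left: `j` out of `L` and `K - j` out of `M`, with `K!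
M'!` bijections over each choice. -/
theorem card_leftCount_eq (hn : L + M = K + M') {j : ℕ} (hj : j ≤ K) :
    (Finset.univ.filter fun σ : Fin L ⊕ Fin M ≃ Fin K ⊕ Fin M' => leftCount σ = j).card =
      L.choose j * M.choose (K - j) * (K.factorial * M'.factorial) := by
  classical
  let φ : (Fin L ⊕ Fin M ≃ Fin K ⊕ Fin M') → Finset (Fin L) × Finset (Fin M) := fun σ =>
    (Finset.univ.filter fun i => (σ (Sum.inl i)).isLeft, Finset.univ.filter fun i => (σ (Sum.inr i)).isLeft)
  have hφ : ∀ σ ∈ Finset.univ.filter fun σ : Fin L ⊕ Fin M ≃ Fin K ⊕ Fin M' => leftCount σ = j,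
      φ σ ∈ Finset.powersetCard j Finset.univ ×ˢ Finset.powersetCard (K - j) Finset.univ := by
    intro σ hσ
    rw [Finset.mem_filter] at hσ
    have h := leftCount_add σ
    have h1 : (φ σ).1.card = leftCount σ := Finset.card_filter _ _
    have h2 : (φ σ).2.card = ∑ i : Fin M, if (σ (Sum.inr i)).isLeft then 1 else 0 := Finset.card_filter _ _
    simp only [Finset.mem_product, Finset.mem_powersetCard, Finset.subset_univ, true_and]
    omega
  rw [Finset.card_eq_sum_card_fiberwise hφ, Finset.sum_congr rfl (g := fun _ => K.factorial * M'.factorial)]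
  · rw [Finset.sum_const, Finset.card_product, Finset.card_powersetCard, Finset.card_powersetCard]
    simp
  · rintro ⟨A, B⟩ hAB
    simp only [Finset.mem_product, Finset.mem_powersetCard, Finset.subset_univ, true_and] at hAB
    let f : Fin L ⊕ Fin M → Bool := Sum.elim (fun i => decide (i ∈ A)) fun i => decide (i ∈ B)
    have hf : ∑ r, (if f r then 1 else 0) = K := by
      rw [Fintype.sum_sum_type]
      simp [f]
      omega
    rw [← card_isLeft_eq f hn hf, Fintype.card_subtype]
    congr 1
    ext σ
    simp only [Finset.mem_filter, Finset.mem_univ, true_and, φ, Prod.mk.injEq]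
    constructor
    · rintro ⟨-, rfl, rfl⟩ r
      rcases r with i | i <;> simp [f]
    · intro h
      have hA : (Finset.univ.filter fun i => (σ (Sum.inl i)).isLeft = true) = A := by
        ext i
        simp [h, f]
      refine ⟨?_, hA, ?_⟩
      · rw [leftCount, ← Finset.card_filter, hA]
        exact hAB.1
      · ext i
        simp [h, f]

theorem sum_leftCount (hn : L + M = K + M') (φ : ℕ → ℂ) :
    ∑ σ : Fin L ⊕ Fin M ≃ Fin K ⊕ Fin M', φ (leftCount σ) = ∑ j ∈ Finset.range (K + 1),
      ((L.choose j * M.choose (K - j) * (K.factorial * M'.factorial) : ℕ) : ℂ) * φ j := by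
  rw [← Finset.sum_fiberwise_of_maps_to (s := Finset.univ) (t := Finset.range (K + 1)) (g := leftCount)]
  · refine Finset.sum_congr rfl fun j hj => ?_
    rw [← card_leftCount_eq hn (Nat.lt_succ_iff.1 (Finset.mem_range.1 hj)), ← nsmul_eq_mul, ← Finset.sum_const]
    refine Finset.sum_congr rfl fun σ hσ => ?_
    rw [(Finset.mem_filter.1 hσ).2]
  · intro σ _
    rw [Finset.mem_range]
    have := leftCount_add σ
    omega

/-! ### Signs -/

/-- The sign of a bijection of sets that are enumerated. -/
def equivSign {X Y : Type*} {n : ℕ} (e : X ≃ Fin n) (e' : Y ≃ Fin n) (σ : X ≃ Y) : ℤˣ :=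
  Equiv.Perm.sign (e.symm.trans (σ.trans e'))

/-- The enumeration of a disjoint union. -/
def sumEnum {a b n : ℕ} (h : a + b = n) : Fin a ⊕ Fin b ≃ Fin n := finSumFinEquiv.trans (finCongr h)

theorem equivSign_trans {X Y : Type*} [Fintype X] [DecidableEq X] [Fintype Y] [DecidableEq Y] {n : ℕ}
    (e : X ≃ Fin n) (e' : Y ≃ Fin n) (σ : X ≃ Y) (α : Equiv.Perm X) (β : Equiv.Perm Y) :
    equivSign e e' (α.symm.trans (σ.trans β)) = Equiv.Perm.sign α * Equiv.Perm.sign β * equivSign e e' σ := by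
  have h : e.symm.trans ((α.symm.trans (σ.trans β)).trans e') =
      e'.permCongr β * (e.symm.trans (σ.trans e')) * e.permCongr α⁻¹ := by
    ext i
    simp [Equiv.permCongr_apply]
  rw [equivSign, h, Equiv.Perm.sign_mul, Equiv.Perm.sign_mul, Equiv.Perm.sign_permCongr,
    Equiv.Perm.sign_permCongr, Equiv.Perm.sign_inv, equivSign]
  ac_rfl

/-- The sign by inversions, indexed by an enumerated set so that the product can be split along a
disjoint union. -/
theorem sign_eq_prod_prod {X : Type*} [Fintype X] {n : ℕ} (b : X ≃ Fin n) (π : Equiv.Perm (Fin n)) :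
    Equiv.Perm.sign π = ∏ y, ∏ x, if b x < b y then (if π (b x) < π (b y) then (1 : ℤˣ) else -1) else 1 := by
  rw [π.sign_eq_prod_prod_Iio, ← Equiv.prod_comp b]
  refine Finset.prod_congr rfl fun y _ => ?_
  rw [Equiv.prod_comp b fun i => if i < b y then (if π i < π (b y) then (1 : ℤˣ) else -1) else 1,
    ← Finset.prod_filter]
  congr 1
  ext i
  simp

/-- The exchange of two blocks. -/
def crossSum {A B C D : Type*} : (A ⊕ B) ⊕ (C ⊕ D) ≃ (A ⊕ D) ⊕ (C ⊕ B) where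
  toFun
    | Sum.inl (Sum.inl a) => Sum.inl (Sum.inl a)
    | Sum.inl (Sum.inr b) => Sum.inr (Sum.inr b)
    | Sum.inr (Sum.inl c) => Sum.inr (Sum.inl c)
    | Sum.inr (Sum.inr d) => Sum.inl (Sum.inr d)
  invFun
    | Sum.inl (Sum.inl a) => Sum.inl (Sum.inl a)
    | Sum.inl (Sum.inr b) => Sum.inr (Sum.inr b)
    | Sum.inr (Sum.inl c) => Sum.inr (Sum.inl c)
    | Sum.inr (Sum.inr d) => Sum.inl (Sum.inr d)
  left_inv x := by rcases x with (_ | _) | (_ | _) <;> rfl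
  right_inv x := by rcases x with (_ | _) | (_ | _) <;> rfl

/-- A bijection with given number of elements of the first summand mapped to the first summand. -/
def crossEquiv (j κ l m : ℕ) : Fin (j + l) ⊕ Fin (m + κ) ≃ Fin (j + κ) ⊕ Fin (m + l) :=
  (Equiv.sumCongr finSumFinEquiv.symm finSumFinEquiv.symm).trans
    (crossSum.trans (Equiv.sumCongr finSumFinEquiv finSumFinEquiv))

theorem leftCount_crossEquiv (j κ l m : ℕ) : leftCount (crossEquiv j κ l m) = j := by
  unfold leftCount
  rw [← Equiv.sum_comp finSumFinEquiv, Fintype.sum_sum_type]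
  simp [crossEquiv, crossSum]

theorem prod_prod_const {a b : ℕ} {f : Fin a → Fin b → ℤˣ} (c : ℤˣ) (h : ∀ x y, f x y = c) :
    ∏ x, ∏ y, f x y = c ^ (a * b) := by
  simp [h, ← pow_mul, mul_comm]

/-- The row blocks of lengths `j, l, m, κ` land in the column order `j, κ, m, l`. The last three
blocks are reversed, so the inversions are the pairs of points from two different ones among them.
-/
theorem equivSign_crossEquiv (j κ l m : ℕ) {n : ℕ} (h : (j + l) + (m + κ) = n) (h' : (j + κ) + (m + l) = n) :
    equivSign (sumEnum h) (sumEnum h') (crossEquiv j κ l m) = (-1) ^ (l * m + l * κ + m * κ) := by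
  let b : (Fin j ⊕ Fin l) ⊕ (Fin m ⊕ Fin κ) ≃ Fin n :=
    (Equiv.sumCongr finSumFinEquiv finSumFinEquiv).trans (sumEnum h)
  unfold equivSign
  rw [sign_eq_prod_prod b]
  simp only [Fintype.prod_sum_type, Finset.prod_mul_distrib]
  simp only [b, crossEquiv, sumEnum, crossSum, Equiv.trans_apply, Equiv.sumCongr_apply,
    Sum.map_inl, Sum.map_inr, finSumFinEquiv_apply_left, finSumFinEquiv_apply_right, finCongr_apply,
    Equiv.symm_trans_apply, Equiv.coe_fn_mk, Fin.lt_def, Fin.val_cast, Fin.val_castAdd, Fin.val_natAdd, finCongr_symm,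
    Fin.cast_cast, Fin.cast_eq_self, finSumFinEquiv_symm_apply_castAdd,
    finSumFinEquiv_symm_apply_natAdd]
  -- One factor for each ordered pair of the four blocks; three of the sixteen consist of
  -- inversions.
  refine (congrArg₂ (· * ·) (congrArg₂ (· * ·)
    (congrArg₂ (· * ·) (congrArg₂ (· * ·) (prod_prod_const 1 ?_) (prod_prod_const 1 ?_)) (congrArg₂ (· * ·) (prod_prod_const 1 ?_) (prod_prod_const 1 ?_))) (congrArg₂ (· * ·) (congrArg₂ (· * ·) (prod_prod_const 1 ?_) (prod_prod_const 1 ?_)) (congrArg₂ (· * ·) (prod_prod_const (-1) ?_) (prod_prod_const (-1) ?_)))) (congrArg₂ (· * ·) (congrArg₂ (· * ·)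
    (congrArg₂ (· * ·) (prod_prod_const 1 ?_) (prod_prod_const 1 ?_)) (congrArg₂ (· * ·) (prod_prod_const 1 ?_) (prod_prod_const (-1) ?_))) (congrArg₂ (· * ·) (congrArg₂ (· * ·) (prod_prod_const 1 ?_) (prod_prod_const 1 ?_)) (congrArg₂ (· * ·) (prod_prod_const 1 ?_) (prod_prod_const 1 ?_))))).trans ?_
  on_goal 17 =>
    simp only [one_pow, one_mul, mul_one, ← pow_add]
    congr 1
    ring
  all_goals
    intro x y
    have hx := x.isLt
    have hy := y.isLt
    split_ifs <;> first | rfl | (exfalso; omega)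

end Bijections

/-! ### The integrals of products of covariances -/

section Pairing

variable {ι : Type} [Fintype ι] {d k : ℕ} {ℓ : ℝ} [Fact (0 < ℓ)] {G : ι → ι → Torus d ℓ → ℂ} {η : ℝ≥0∞}
  {K L M M' : ℕ}

/-- The first arguments of the covariances: the variables `J̄` and the variables `ψ` of the kernel. -/
def rowVar (K L M M' : ℕ) : Fin L ⊕ Fin M → Var ![K, L] ⊕ Var ![M, M'] :=
  Sum.elim (fun i => Sum.inl ⟨1, i⟩) fun i => Sum.inr ⟨0, i⟩

/-- The second arguments of the covariances: the variables `J` and the variables `ψ̄` of the kernel. -/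
def colVar (K L M M' : ℕ) : Fin K ⊕ Fin M' → Var ![K, L] ⊕ Var ![M, M'] :=
  Sum.elim (fun i => Sum.inl ⟨0, i⟩) fun i => Sum.inr ⟨1, i⟩

/-- A product of covariances with the test function. -/
def pairing (G : ι → ι → Torus d ℓ → ℂ) (f : TestFn ι d ℓ (Var ![K, L])) (σ : Fin L ⊕ Fin M ≃ Fin K ⊕ Fin M') :
    TestFn ι d ℓ (Var ![K, L] ⊕ Var ![M, M']) := fun s =>
  (∏ r, covPt G (s (rowVar K L M M' r)) (s (colVar K L M M' (σ r)))) * f fun v => s (Sum.inl v)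

/-- The pairing of a product of covariances with the kernel of `F` and the test function. -/
def pairInt (G : ι → ι → Torus d ℓ → ℂ) (F : Elem ι d ℓ 2) (f : TestFn ι d ℓ (Var ![K, L]))
    (σ : Fin L ⊕ Fin M ≃ Fin K ⊕ Fin M') : ℂ :=
  ptInt fun q : Var ![K, L] → Pt ι d ℓ => F ![M, M'] fun p => pairing G f σ (Sum.elim q p)

theorem rowVar_ne_colVar (r : Fin L ⊕ Fin M) (c : Fin K ⊕ Fin M') : rowVar K L M M' r ≠ colVar K L M M' c := by
  rcases r with i | i <;> rcases c with i' | i'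
  · intro h
    exact absurd (congrArg (fun v : Var ![K, L] => v.1) (Sum.inl_injective h)) (by simp)
  · exact Sum.inl_ne_inr
  · exact Sum.inr_ne_inl
  · intro h
    exact absurd (congrArg (fun v : Var ![M, M'] => v.1) (Sum.inr_injective h)) (by simp)

theorem isCk_pairing (hG : IsCov k G η) {f : TestFn ι d ℓ (Var ![K, L])} (hf : IsCk k f)
    (σ : Fin L ⊕ Fin M ≃ Fin K ⊕ Fin M') : IsCk k (pairing G f σ) :=
  (IsCk.prod _ fun r _ => hG.isCk (rowVar_ne_colVar r (σ r))).mul (hf.comp_inj Sum.inl_injective)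

theorem pairing_perm {f : TestFn ι d ℓ (Var ![K, L])} (ha : IsAnti f) (σ : Fin L ⊕ Fin M ≃ Fin K ⊕ Fin M')
    (α : Equiv.Perm (Fin L)) (α' : Equiv.Perm (Fin M)) (β : Equiv.Perm (Fin K)) (β' : Equiv.Perm (Fin M'))
    (q : Var ![K, L] → Pt ι d ℓ) (p : Var ![M, M'] → Pt ι d ℓ) :
    pairing G f ((Equiv.sumCongr α α').symm.trans (σ.trans (Equiv.sumCongr β β'))) (Sum.elim q p) =
      signs (permPair β α) * pairing G f σ (Sum.elim (fun v => q (permVar (permPair β α) v))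
        fun v => p (permVar (permPair α' β') v)) := by
  have hr : ∀ r, Sum.elim (fun v => q (permVar (permPair β α) v)) (fun v => p (permVar (permPair α' β') v))
      (rowVar K L M M' r) = Sum.elim q p (rowVar K L M M' (Equiv.sumCongr α α' r)) := by
    rintro (i | i) <;> rfl
  have hc : ∀ c, Sum.elim (fun v => q (permVar (permPair β α) v)) (fun v => p (permVar (permPair α' β') v))
      (colVar K L M M' c) = Sum.elim q p (colVar K L M M' (Equiv.sumCongr β β' c)) := by
    rintro (i | i) <;> rfl
  simp only [pairing, hr, hc, Sum.elim_inl, ha (permPair β α) q]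
  rw [← Equiv.prod_comp (Equiv.sumCongr α α')]
  simp only [Equiv.trans_apply, Equiv.symm_apply_apply]
  linear_combination -((∏ r, covPt G (Sum.elim q p (rowVar K L M M' (Equiv.sumCongr α α' r)))
    (Sum.elim q p (colVar K L M M' (Equiv.sumCongr β β' (σ r))))) * f q) * signs_mul_self (permPair β α)

theorem IsCk.elim_right {P Q : Type} [Fintype P] [DecidableEq P] [Fintype Q] [DecidableEq Q]
    {f : TestFn ι d ℓ (P ⊕ Q)} (hf : IsCk k f) (p : P → Pt ι d ℓ) : IsCk k fun q => f (Sum.elim p q) := by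
  have := hf.fix (e := Sum.swap) Sum.swap_leftInverse.injective p
  convert this using 1
  funext q
  congr 1
  funext v
  rcases v with v | v <;> rfl

theorem IsDistr.isCk_elim {P Q : Type} [Fintype P] [DecidableEq P] [Fintype Q] [DecidableEq Q]
    {u : TestFn ι d ℓ Q → ℂ} (hu : IsDistr k u) {f : TestFn ι d ℓ (P ⊕ Q)} (hf : IsCk k f) :
    IsCk k fun p => u fun q => f (Sum.elim p q) :=
  hu.isCk_pair hf (e := id) Function.injective_id

/-- Permutations of source points are undone in the integral at the cost of a sign from `f`, those
of kernel points by the anti-symmetry of `F`. -/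
theorem pairInt_perm (hG : IsCov k G η) {h : Fin 2 → ℝ≥0∞} {F : Elem ι d ℓ 2} (hF : MemG k h F)
    {f : TestFn ι d ℓ (Var ![K, L])} (hf : IsCk k f) (ha : IsAnti f) (σ : Fin L ⊕ Fin M ≃ Fin K ⊕ Fin M')
    (α : Equiv.Perm (Fin L)) (α' : Equiv.Perm (Fin M)) (β : Equiv.Perm (Fin K)) (β' : Equiv.Perm (Fin M')) :
    pairInt G F f ((Equiv.sumCongr α α').symm.trans (σ.trans (Equiv.sumCongr β β'))) =
      signs (permPair β α) * signs (permPair α' β') * pairInt G F f σ := by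
  have hck := isCk_pairing hG hf σ
  have h1 : ∀ q : Var ![K, L] → Pt ι d ℓ, (F ![M, M'] fun p => pairing G f
      ((Equiv.sumCongr α α').symm.trans (σ.trans (Equiv.sumCongr β β'))) (Sum.elim q p)) =
      signs (permPair β α) * signs (permPair α' β') *
        F ![M, M'] fun p => pairing G f σ (Sum.elim (fun v => q (permVar (permPair β α) v)) p) := by
    intro q
    simp only [pairing_perm ha]
    have h2 : IsCk k fun p : Var ![M, M'] → Pt ι d ℓ =>
        pairing G f σ (Sum.elim (fun v => q (permVar (permPair β α) v)) p) := hck.elim_right _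
    rw [mul_assoc, ← hF.antisymm _ (permPair α' β') _ h2]
    exact (hF.distr _).map_smul _ _ (h2.comp_inj (permVar_injective (permPair α' β')))
  unfold pairInt
  simp only [h1]
  rw [ptInt_smul, ptInt_reindex (Equiv.sigmaCongrRight (permPair β α))
    fun q => F ![M, M'] fun p => pairing G f σ (Sum.elim q p)]
  rfl

/-- A product of covariances with its sign. -/
def signedPairInt (G : ι → ι → Torus d ℓ → ℂ) (F : Elem ι d ℓ 2) (f : TestFn ι d ℓ (Var ![K, L]))
    (σ : Fin L ⊕ Fin M ≃ Fin K ⊕ Fin M') : ℂ :=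
  ((equivSign (sumEnum rfl) (sumEnum (card_eq_of_equiv σ)) σ : ℤ) : ℂ) * pairInt G F f σ

/-- Both the sign of the bijection and the pairing change by the product of the signs of the four
block permutations, so their product depends only on the orbit. -/
theorem signedPairInt_eq_of_leftCount_eq (hG : IsCov k G η) {h : Fin 2 → ℝ≥0∞} {F : Elem ι d ℓ 2} (hF : MemG k h F)
    {f : TestFn ι d ℓ (Var ![K, L])} (hf : IsCk k f) (ha : IsAnti f) {σ σ' : Fin L ⊕ Fin M ≃ Fin K ⊕ Fin M'}
    (hσ : leftCount σ = leftCount σ') : signedPairInt G F f σ = signedPairInt G F f σ' := by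
  obtain ⟨α, α', β, β', rfl⟩ := exists_perm_of_leftCount_eq hσ
  unfold signedPairInt
  rw [pairInt_perm hG hF hf ha, equivSign_trans, Equiv.Perm.sign_sumCongr, Equiv.Perm.sign_sumCongr,
    signs_permPair, signs_permPair]
  have hs : ∀ x : ℤˣ, ((x : ℤ) : ℂ) * ((x : ℤ) : ℂ) = 1 := fun x => by
    rw [← Int.cast_mul, ← Units.val_mul, Int.units_mul_self]
    simp
  push_cast
  -- The squares of the four signs are replaced by `1` in turn.
  linear_combination (-((equivSign (sumEnum rfl) (sumEnum (card_eq_of_equiv σ)) σ : ℤ) : ℂ) * pairInt G F f σ) *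
    ((((Equiv.Perm.sign α : ℤ) : ℂ) * ((Equiv.Perm.sign α' : ℤ) : ℂ) * ((Equiv.Perm.sign β : ℤ) : ℂ)) ^ 2 * hs (Equiv.Perm.sign β') +
    (((Equiv.Perm.sign α : ℤ) : ℂ) * ((Equiv.Perm.sign α' : ℤ) : ℂ)) ^ 2 * hs (Equiv.Perm.sign β) +
    (((Equiv.Perm.sign α : ℤ) : ℂ)) ^ 2 * hs (Equiv.Perm.sign α') + hs (Equiv.Perm.sign α))

open Classical in
/-- The common value of the products of covariances of which `j` pair the variables `J, J̄`. -/
def pairVal (G : ι → ι → Torus d ℓ → ℂ) (F : Elem ι d ℓ 2) (f : TestFn ι d ℓ (Var ![K, L])) (M M' j : ℕ) : ℂ :=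
  if h : ∃ σ : Fin L ⊕ Fin M ≃ Fin K ⊕ Fin M', leftCount σ = j then signedPairInt G F f h.choose else 0

theorem signedPairInt_eq_pairVal (hG : IsCov k G η) {h : Fin 2 → ℝ≥0∞} {F : Elem ι d ℓ 2} (hF : MemG k h F)
    {f : TestFn ι d ℓ (Var ![K, L])} (hf : IsCk k f) (ha : IsAnti f) (σ : Fin L ⊕ Fin M ≃ Fin K ⊕ Fin M') :
    signedPairInt G F f σ = pairVal G F f M M' (leftCount σ) := by
  have h : ∃ σ' : Fin L ⊕ Fin M ≃ Fin K ⊕ Fin M', leftCount σ' = leftCount σ := ⟨σ, rfl⟩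
  rw [pairVal, dif_pos h]
  exact signedPairInt_eq_of_leftCount_eq hG hF hf ha h.choose_spec.symm

/-- The Leibniz formula for rows and columns indexed by different enumerated sets. -/
theorem det_eq_sum_equiv {X Y : Type*} [Fintype X] [Fintype Y] [DecidableEq X] [DecidableEq Y] {n : ℕ}
    (e : X ≃ Fin n) (e' : Y ≃ Fin n) (A : X → Y → ℂ) :
    Matrix.det (fun i j : Fin n => A (e.symm i) (e'.symm j)) =
      ∑ σ : X ≃ Y, ((equivSign e e' σ : ℤ) : ℂ) * ∏ x, A x (σ x) := by
  show Matrix.det (Matrix.of fun i j : Fin n => A (e.symm i) (e'.symm j)) = _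
  rw [← Matrix.det_transpose, Matrix.det_apply', ← (Equiv.equivCongr e e').sum_comp]
  refine Finset.sum_congr rfl fun σ _ => ?_
  congr 1
  rw [← e.prod_comp]
  refine Finset.prod_congr rfl fun x _ => ?_
  simp [Matrix.transpose]

end Pairing

/-! ### The integral of `e^{⟨J̄, ψ⟩ + ⟨ψ̄, J⟩} F` -/

section Sourced

variable {ι : Type} [Fintype ι] {d k : ℕ} {ℓ : ℝ} [Fact (0 < ℓ)] {G : ι → ι → Torus d ℓ → ℂ} {η : ℝ≥0∞}

theorem IsAnti.pair_left {q : ℕ} {N n : Fin q → ℕ} (hn : n ≤ N) {u : TestFn ι d ℓ (Var fun s => N s - n s) → ℂ}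
    (hu : IsDistr k u) {f : TestFn ι d ℓ (Var N)} (hf : IsCk k f) (ha : IsAnti f) :
    IsAnti fun p : Var n → Pt ι d ℓ => u fun p' => f fun v => Grassmann.join p p' v := by
  intro π p
  rw [← hu.map_smul _ _ (hf.join_right p)]
  refine congrArg u (funext fun p' => ?_)
  have h1 := ha.join hn π 1 p p'
  rw [signs_one, mul_one] at h1
  exact h1

theorem IsDistr.isCk_join {q : ℕ} {N n : Fin q → ℕ} {u : TestFn ι d ℓ (Var fun s => N s - n s) → ℂ}
    (hu : IsDistr k u) {f : TestFn ι d ℓ (Var N)} (hf : IsCk k f) :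
    IsCk k fun p : Var n → Pt ι d ℓ => u fun p' => f fun v => Grassmann.join p p' v := by
  simp only [join_eq]
  exact hu.isCk_pair hf splitVar_injective

/-- The permutations of the variables `J, J̄`. -/
def restrictJ {n : ℕ} {N : Fin 2 → ℕ} (π : (s : Fin 4) → Equiv.Perm (Fin (![n, n, N 0, N 1] s))) :
    (s : Fin 2) → Equiv.Perm (Fin (N s))
  | 0 => π 2
  | 1 => π 3

/-- The determinant is anti-symmetric in its rows and columns separately, so products in all four
species can be evaluated by `mul_of_isAnti`. -/
theorem isAnti_detTensor (n : ℕ) {N : Fin 2 → ℕ} {f : TestFn ι d ℓ (Var N)} (ha : IsAnti f) :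
    IsAnti (detTensor G n N f) := by
  intro π p
  have h1 := ha (restrictJ π) fun v => p (varJ n N v)
  have h2 : (fun v => p (varJ n N (permVar (restrictJ π) v))) = fun v => p (permVar π (varJ n N v)) := by
    funext v
    match v with
    | ⟨0, i⟩ => rfl
    | ⟨1, i⟩ => rfl
  rw [h2] at h1
  let A : Matrix (Fin n) (Fin n) ℂ := Matrix.of fun i j => covPt G (p ⟨0, i⟩) (p ⟨1, j⟩)
  have h3 : ∀ σ τ : Equiv.Perm (Fin n), Matrix.det (A.submatrix σ τ) =
      ((Equiv.Perm.sign σ : ℤ) : ℂ) * (((Equiv.Perm.sign τ : ℤ) : ℂ) * A.det) := by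
    intro σ τ
    have h4 : A.submatrix σ τ = (A.submatrix id τ).submatrix σ id := rfl
    rw [h4, Matrix.det_permute, Matrix.det_permute']
  show Matrix.det (A.submatrix (π 0) (π 1)) * f (fun v => p (permVar π (varJ n N v))) =
    signs π * (A.det * f fun v => p (varJ n N v))
  rw [h1]
  have h4 : ∀ σ τ : Equiv.Perm (Fin n), signs π = ((Equiv.Perm.sign σ : ℤ) : ℂ) *
      ((Equiv.Perm.sign τ : ℤ) : ℂ) * signs (restrictJ π) → ∀ x : ℂ,
      Matrix.det (A.submatrix σ τ) * (signs (restrictJ π) * x) = signs π * (A.det * x) := by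
    intro σ τ h x
    rw [h3, h]
    ring
  refine h4 (π 0) (π 1) ?_ _
  simp only [signs, Fin.prod_univ_four, Fin.prod_univ_two]
  rw [mul_assoc]
  rfl

variable {K L M M' n : ℕ}

/-- The exponential of the sources puts the points of `J̄` into the first `L` rows and the points of
`J` into the first `K` columns. The other rows and columns carry the points of the kernel of `F`. -/
theorem detTensor_join (hL : L + M = n) (hK : K + M' = n) (hle : ![L, K, K, L] ≤ ![n, n, K, L])
    (f : TestFn ι d ℓ (Var ![K, L])) (q : Var ![K, L] → Pt ι d ℓ)
    (p' : Var (fun s => ![n, n, K, L] s - ![L, K, K, L] s) → Pt ι d ℓ) (p : Var ![M, M'] → Pt ι d ℓ)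
    (h0 : ∀ i : Fin (n - L), p' ⟨0, i⟩ = p ⟨0, Fin.cast (show n - L = M by omega) i⟩)
    (h1 : ∀ i : Fin (n - K), p' ⟨1, i⟩ = p ⟨1, Fin.cast (show n - K = M' by omega) i⟩) :
    detTensor G n ![K, L] f (join (fun v => q (dupVar (N := ![L, K, K, L]) ⟨rfl, rfl⟩ v)) p') =
      ∑ σ : Fin L ⊕ Fin M ≃ Fin K ⊕ Fin M', ((equivSign (sumEnum hL) (sumEnum hK) σ : ℤ) : ℂ) *
        pairing G f σ (Sum.elim q p) := by
  subst hL
  obtain rfl : M' = L + M - K := by omega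
  have hrow : ∀ i : Fin (L + M), join (fun v => q (dupVar (N := ![L, K, K, L]) ⟨rfl, rfl⟩ v)) p'
      (⟨0, i⟩ : Var ![L + M, L + M, K, L]) =
      Sum.elim q p (rowVar K L M (L + M - K) ((sumEnum rfl).symm i)) := by
    intro i
    obtain ⟨r, rfl⟩ := (sumEnum (rfl : L + M = L + M)).surjective i
    rw [Equiv.symm_apply_apply]
    rcases r with r | r
    · exact join_inl hle (fun v => q (dupVar (N := ![L, K, K, L]) ⟨rfl, rfl⟩ v)) p' 0 r
    · refine Eq.trans ?_ ((join_inr hle (fun v => q (dupVar (N := ![L, K, K, L]) ⟨rfl, rfl⟩ v)) p' 0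
        (Fin.cast (show M = L + M - L by omega) r)).trans (h0 _))
      rfl
  have hcol : ∀ i : Fin (L + M), join (fun v => q (dupVar (N := ![L, K, K, L]) ⟨rfl, rfl⟩ v)) p'
      (⟨1, i⟩ : Var ![L + M, L + M, K, L]) =
      Sum.elim q p (colVar K L M (L + M - K) ((sumEnum hK).symm i)) := by
    intro i
    obtain ⟨r, rfl⟩ := (sumEnum hK).surjective i
    rw [Equiv.symm_apply_apply]
    rcases r with r | r
    · exact join_inl hle (fun v => q (dupVar (N := ![L, K, K, L]) ⟨rfl, rfl⟩ v)) p' 1 r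
    · exact (join_inr hle (fun v => q (dupVar (N := ![L, K, K, L]) ⟨rfl, rfl⟩ v)) p' 1 r).trans (h1 _)
  have hJ : (fun v => join (fun v => q (dupVar (N := ![L, K, K, L]) ⟨rfl, rfl⟩ v)) p'
      (varJ (L + M) ![K, L] v)) = q := by
    funext v
    match v with
    | ⟨0, i⟩ =>
      exact dif_pos i.isLt
    | ⟨1, i⟩ =>
      exact dif_pos i.isLt
  have hdet := det_eq_sum_equiv (sumEnum (rfl : L + M = L + M)) (sumEnum hK) fun r c =>
    covPt G (Sum.elim q p (rowVar K L M (L + M - K) r)) (Sum.elim q p (colVar K L M (L + M - K) c))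
  have hD : detTensor G (L + M) ![K, L] f (join (fun v => q (dupVar (N := ![L, K, K, L]) ⟨rfl, rfl⟩ v)) p') =
      Matrix.det (fun i j : Fin (L + M) => covPt G
        (join (fun v => q (dupVar (N := ![L, K, K, L]) ⟨rfl, rfl⟩ v)) p' (⟨0, i⟩ : Var ![L + M, L + M, K, L]))
        (join (fun v => q (dupVar (N := ![L, K, K, L]) ⟨rfl, rfl⟩ v)) p' (⟨1, j⟩ : Var ![L + M, L + M, K, L]))) *
      f fun v => join (fun v => q (dupVar (N := ![L, K, K, L]) ⟨rfl, rfl⟩ v)) p' (varJ (L + M) ![K, L] v) := rfl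
  rw [hD, hJ]
  simp only [hrow, hcol]
  rw [hdet, Finset.sum_mul]
  refine Finset.sum_congr rfl fun σ _ => ?_
  rw [mul_assoc]
  rfl

theorem factorial_choose (h : L + M = n) :
    (n.choose L : ℂ) * (L.factorial : ℂ) / (n.factorial : ℂ) = 1 / (M.factorial : ℂ) := by
  subst h
  rw [Nat.cast_add_choose ℂ]
  have h1 : ((L + M).factorial : ℂ) ≠ 0 := by exact_mod_cast Nat.factorial_ne_zero _
  have h2 : (L.factorial : ℂ) ≠ 0 := by exact_mod_cast Nat.factorial_ne_zero _
  have h3 : (M.factorial : ℂ) ≠ 0 := by exact_mod_cast Nat.factorial_ne_zero _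
  field_simp

/-- Since `embed F` contains no sources, the exponential supplies all `K` fields `J` and `L` fields
`J̄`, and with them as many `ψ̄` and `ψ`. Only its degree `(L, K, K, L)` contributes. -/
theorem sourced_eq (hG : IsCov k G η) {h h' : ℝ≥0∞} {F : Elem ι d ℓ 2} (hF : MemG k ![h, h] F)
    (hh : h ≠ 0) (hht : h ≠ ⊤) (hh' : h' ≠ 0) (hht' : h' ≠ ⊤)
    {f : TestFn ι d ℓ (Var ![K, L])} (hf : IsCk k f) (ha : IsAnti f) :
    sourced F ![n, n, K, L] (detTensor G n ![K, L] f) =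
      if L ≤ n ∧ K ≤ n then
        mulTerm expSource (embed F) ![n, n, K, L] (detTensor G n ![K, L] f) ![L, K, K, L] else 0 := by
  classical
  have hg : IsCk k (detTensor G n ![K, L] f) := (ckB_detTensor hG n hf.ckB).isCk
  have hga : IsAnti (detTensor G n ![K, L] f) := isAnti_detTensor n ha
  have hE := (MemG.exp (k := k) (h := ![h, h, h', h']) (by intro s; fin_cases s <;> assumption)
    ((memG_pairJbarPsi (ι := ι) (d := d) (ℓ := ℓ) (by intro s; fin_cases s <;> assumption)).add
    (memG_pairPsibarJ (by intro s; fin_cases s <;> assumption)))).distr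
  have hH : ∀ N, IsDistr k (embed F N) := (MemG.embed (h' := h') hF).distr
  have h1 : ∀ n' ∈ Finset.Icc 0 ![n, n, K, L], ∀ c : ℂ, (c * exp (fun N f => pairJbarPsi ι d ℓ N f + pairPsibarJ ι d ℓ N f)
      n' fun p => embed F (fun s => ![n, n, K, L] s - n' s) fun p' =>
        detTensor G n ![K, L] f fun v => join p p' v) =
      c * expSource n' fun p => embed F (fun s => ![n, n, K, L] s - n' s) fun p' =>
        detTensor G n ![K, L] f fun v => join p p' v := by
    intro n' hn' c
    congr 1
    exact exp_source_eq ((hH _).isCk_join hg) (IsAnti.pair_left (Finset.mem_Icc.1 hn').2 (hH _) hg hga)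
  have h2 : sourced F ![n, n, K, L] (detTensor G n ![K, L] f) = ∑ n' ∈ Finset.Icc 0 ![n, n, K, L],
      mulTerm expSource (embed F) ![n, n, K, L] (detTensor G n ![K, L] f) n' :=
    (mul_of_isAnti hE hH hg hga).trans (Finset.sum_congr rfl fun n' hn' => h1 n' hn' _)
  have h3 : ∀ n' ∈ Finset.Icc 0 ![n, n, K, L], n' ≠ ![L, K, K, L] →
      mulTerm expSource (embed F) ![n, n, K, L] (detTensor G n ![K, L] f) n' = 0 := by
    intro n' hn' hne
    have hle := (Finset.mem_Icc.1 hn').2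
    unfold mulTerm
    by_cases hm : n' 0 = n' 3 ∧ n' 1 = n' 2
    · have hne' : ¬((fun s => ![n, n, K, L] s - n' s) 2 = 0 ∧ (fun s => ![n, n, K, L] s - n' s) 3 = 0) := by
        rintro ⟨e2, e3⟩
        refine hne ?_
        have l2 : n' 2 ≤ K := hle 2
        have l3 : n' 3 ≤ L := hle 3
        have e2' : K - n' 2 = 0 := e2
        have e3' : L - n' 3 = 0 := e3
        have a2 : n' 2 = K := by omega
        have a3 : n' 3 = L := by omega
        funext s
        fin_cases s
        · exact hm.1.trans a3
        · exact hm.2.trans a2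
        · exact a2
        · exact a3
      have : ∀ f', embed F (fun s => ![n, n, K, L] s - n' s) f' = 0 := fun f' => dif_neg hne'
      simp only [this]
      unfold expSource
      rw [dif_pos hm]
      simp [ptInt, comp]
    · rw [expSource_of_not hm, mul_zero]
  rw [h2]
  split_ifs with hle
  · refine Finset.sum_eq_single_of_mem _ (Finset.mem_Icc.2 ⟨fun s => Nat.zero_le _, fun s => ?_⟩) h3
    fin_cases s
    · exact hle.1
    · exact hle.2
    · exact le_rfl
    · exact le_rfl
  · refine Finset.sum_eq_zero fun n' hn' => h3 n' hn' ?_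
    rintro rfl
    exact hle ⟨(Finset.mem_Icc.1 hn').2 0, (Finset.mem_Icc.1 hn').2 1⟩

/-- The sign of the integral of `e^{⟨J̄, ψ⟩ + ⟨ψ̄, J⟩} F`. -/
def sourcedSign (n K L M M' : ℕ) : ℂ :=
  -- The terms come from the Gaussian integral, from moving the fields of `F` past those of the
  -- exponential, and from `expSource`.
  (-1) ^ (n.choose 2 + M * L + M' * (K + L) + (L + 1).choose 2 + K.choose 2)

theorem elem_cast (F : Elem ι d ℓ 2) {a b : ℕ} (ha : a = M) (hb : b = M') (g : TestFn ι d ℓ (Var ![a, b])) :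
    F ![a, b] g = F ![M, M'] fun p => g fun v => match v with
      | ⟨0, i⟩ => p ⟨0, Fin.cast ha i⟩
      | ⟨1, i⟩ => p ⟨1, Fin.cast hb i⟩ := by
  subst ha hb
  congr 1
  funext p
  congr 1
  funext v
  match v with
  | ⟨0, i⟩ => rfl
  | ⟨1, i⟩ => rfl

theorem gaussTerm_sourced (hG : IsCov k G η) {h h' : ℝ≥0∞} {F : Elem ι d ℓ 2} (hF : MemG k ![h, h] F)
    (hh : h ≠ 0) (hht : h ≠ ⊤) (hh' : h' ≠ 0) (hht' : h' ≠ ⊤) (hL : L + M = n) (hK : K + M' = n)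
    {f : TestFn ι d ℓ (Var ![K, L])} (hf : IsCk k f) (ha : IsAnti f) :
    gaussTerm G (sourced F) ![K, L] f n = sourcedSign n K L M M' / (M.factorial * M'.factorial : ℂ) *
      ∑ σ : Fin L ⊕ Fin M ≃ Fin K ⊕ Fin M', signedPairInt G F f σ := by
  have hle : ![L, K, K, L] ≤ ![n, n, K, L] := by
    intro s
    fin_cases s
    · exact (show L ≤ n by omega)
    · exact (show K ≤ n by omega)
    · exact le_rfl
    · exact le_rfl
  have hck : ∀ σ : Fin L ⊕ Fin M ≃ Fin K ⊕ Fin M', IsCk k fun q : Var ![K, L] → Pt ι d ℓ =>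
      F ![M, M'] fun p => pairing G f σ (Sum.elim q p) := fun σ => (hF.distr _).isCk_elim (isCk_pairing hG hf σ)
  have h1 : ∀ q : Var ![K, L] → Pt ι d ℓ, (embed F (fun s => ![n, n, K, L] s - ![L, K, K, L] s) fun p' =>
      detTensor G n ![K, L] f fun v => join (fun v => q (dupVar (N := ![L, K, K, L]) ⟨rfl, rfl⟩ v)) p' v) =
      ∑ σ : Fin L ⊕ Fin M ≃ Fin K ⊕ Fin M', ((equivSign (sumEnum hL) (sumEnum hK) σ : ℤ) : ℂ) *
        F ![M, M'] fun p => pairing G f σ (Sum.elim q p) := by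
    intro q
    have hz : (fun s => ![n, n, K, L] s - ![L, K, K, L] s) 2 = 0 ∧
        (fun s => ![n, n, K, L] s - ![L, K, K, L] s) 3 = 0 := ⟨Nat.sub_self K, Nat.sub_self L⟩
    have hck' : ∀ σ : Fin L ⊕ Fin M ≃ Fin K ⊕ Fin M', IsCk k fun p : Var ![M, M'] → Pt ι d ℓ =>
        pairing G f σ (Sum.elim q p) := fun σ => (isCk_pairing hG hf σ).elim_right q
    rw [embed_eq F hz]
    refine (elem_cast F (show n - L = M by omega) (show n - K = M' by omega) _).trans ?_
    have h2 := fun σ => ((hF.distr ![M, M']).map_smul ((equivSign (sumEnum hL) (sumEnum hK) σ : ℤ) : ℂ) _ (hck' σ)).symm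
    simp only [h2]
    rw [← (hF.distr ![M, M']).map_sum _ fun σ _ => (hck' σ).smul _]
    congr 1
    funext p
    rw [Finset.sum_apply]
    exact detTensor_join hL hK hle f q _ p (fun i => rfl) fun i => rfl
  have h3 : reorderSign ![L, K, K, L] (fun s => ![n, n, K, L] s - ![L, K, K, L] s) =
      (-1) ^ (M * L + M' * (K + L)) := by
    simp only [reorderSign, Fin.prod_univ_four]
    have e0 : n - L = M := by omega
    have e1 : n - K = M' := by omega
    simp [e0, e1]
    have e : (-1 : ℂ) ^ (M * K) * (-1) ^ (M * K) = 1 := by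
      rw [← pow_add, ← two_mul, pow_mul]
      simp
    rw [mul_add, pow_add, pow_add]
    linear_combination ((-1) ^ (M' * K) * (-1) ^ (M * L) * (-1) ^ (M' * L)) * e
  have hs : ∀ σ : Fin L ⊕ Fin M ≃ Fin K ⊕ Fin M', equivSign (sumEnum hL) (sumEnum hK) σ =
      equivSign (sumEnum rfl) (sumEnum (card_eq_of_equiv σ)) σ := by
    subst hL
    intro σ
    rfl
  have h4 : (ptInt fun q : Var ![K, L] → Pt ι d ℓ => embed F (fun s => ![n, n, K, L] s - ![L, K, K, L] s) fun p' =>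
      detTensor G n ![K, L] f fun v => join (fun v => q (dupVar (N := ![L, K, K, L]) ⟨rfl, rfl⟩ v)) p' v) =
      ∑ σ : Fin L ⊕ Fin M ≃ Fin K ⊕ Fin M', signedPairInt G F f σ := by
    rw [funext h1]
    refine (ptInt_finset_sum _ fun σ _ => (hck σ).contTF.const_mul _).trans (Finset.sum_congr rfl fun σ _ => ?_)
    rw [ptInt_smul, hs]
    rfl
  have h5 : sourced F ![n, n, K, L] (detTensor G n ![K, L] f) =
      (-1) ^ (M * L + M' * (K + L)) * (∏ s, ((![n, n, K, L] s).choose (![L, K, K, L] s) : ℂ)) *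
      ((-1) ^ ((L + 1).choose 2 + K.choose 2) * (L.factorial * K.factorial : ℂ) *
        ∑ σ : Fin L ⊕ Fin M ≃ Fin K ⊕ Fin M', signedPairInt G F f σ) := by
    rw [sourced_eq hG hF hh hht hh' hht' hf ha, if_pos ⟨by omega, by omega⟩, ← h3, ← h4]
    exact congrArg _ (expSource_eq L K _)
  have h6 := factorial_choose hL
  have h7 := factorial_choose hK
  unfold gaussTerm
  refine (congrArg _ h5).trans ?_
  have h8 : (∏ s, ((![n, n, K, L] s).choose (![L, K, K, L] s) : ℂ)) = (n.choose L : ℂ) * (n.choose K : ℂ) := by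
    simp [Fin.prod_univ_four]
  have h9 : 1 / ((M.factorial : ℂ) * (M'.factorial : ℂ)) = (n.choose L : ℂ) * (L.factorial : ℂ) / (n.factorial : ℂ) *
      ((n.choose K : ℂ) * (K.factorial : ℂ) / (n.factorial : ℂ)) := by
    rw [h6, h7]
    ring
  rw [h8, ← Nat.choose_two_right, sourcedSign, div_eq_mul_one_div _ ((M.factorial : ℂ) * _), h9]
  simp only [pow_add]
  ring

end Sourced

/-! ### The integral of `F(ψ + G J, ψ̄ + J̄ G)` -/

section Translated

variable {ι : Type} [Fintype ι] {d k : ℕ} {ℓ : ℝ} [Fact (0 < ℓ)] {G : ι → ι → Torus d ℓ → ℂ} {η : ℝ≥0∞}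
  {K L j κ l m : ℕ}

/-- A bijection with `j` elements of the first summand mapped to the first summand. -/
def crossEquivOf (hK : j + κ = K) (hL : j + l = L) (m : ℕ) : Fin L ⊕ Fin (m + κ) ≃ Fin K ⊕ Fin (m + l) :=
  (Equiv.sumCongr (sumEnum hL).symm finSumFinEquiv.symm).trans
    (crossSum.trans (Equiv.sumCongr (sumEnum hK) finSumFinEquiv))

theorem crossEquivOf_rfl : crossEquivOf (rfl : j + κ = j + κ) (rfl : j + l = j + l) m = crossEquiv j κ l m :=
  Equiv.ext fun _ => rfl

theorem leftCount_crossEquivOf (hK : j + κ = K) (hL : j + l = L) (m : ℕ) : leftCount (crossEquivOf hK hL m) = j := by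
  subst hK hL
  rw [crossEquivOf_rfl, leftCount_crossEquiv]

theorem signedPairInt_crossEquivOf (hK : j + κ = K) (hL : j + l = L) (m : ℕ) (F : Elem ι d ℓ 2)
    (f : TestFn ι d ℓ (Var ![K, L])) : signedPairInt G F f (crossEquivOf hK hL m) =
      (-1) ^ (l * m + l * κ + m * κ) * pairInt G F f (crossEquivOf hK hL m) := by
  subst hK hL
  rw [crossEquivOf_rfl, signedPairInt, equivSign_crossEquiv]
  push_cast
  rfl

/-- The variables of two species as a disjoint union. -/
def varTwo (N : Fin 2 → ℕ) : Var N ≃ Fin (N 0) ⊕ Fin (N 1) where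
  toFun
    | ⟨0, i⟩ => Sum.inl i
    | ⟨1, i⟩ => Sum.inr i
  invFun := Sum.elim (fun i => ⟨0, i⟩) fun i => ⟨1, i⟩
  left_inv v := by
    match v with
    | ⟨0, i⟩ => rfl
    | ⟨1, i⟩ => rfl
  right_inv v := by rcases v with v | v <;> rfl

/-- The permutations of the variables `ψ̄` that are not contracted with `J̄`. -/
def crossPerm (hK : j + κ = K) (hL : j + l = L) (τ : Equiv.Perm (Fin m)) :
    Fin L ⊕ Fin (m + κ) ≃ Fin K ⊕ Fin (m + l) :=
  (Equiv.sumCongr (1 : Equiv.Perm (Fin L)) (1 : Equiv.Perm (Fin (m + κ)))).symm.trans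
    ((crossEquivOf hK hL m).trans (Equiv.sumCongr (1 : Equiv.Perm (Fin K)) (blockPerm τ (1 : Equiv.Perm (Fin l)))))

theorem crossPerm_apply (hK : j + κ = K) (hL : j + l = L) (τ : Equiv.Perm (Fin m)) (x : Fin L ⊕ Fin (m + κ)) :
    crossPerm hK hL τ x = Sum.map id (blockPerm τ (1 : Equiv.Perm (Fin l))) (crossEquivOf hK hL m x) := by
  rcases x with x | x <;> rfl

theorem crossPerm_inl_inl (hK : j + κ = K) (hL : j + l = L) (τ : Equiv.Perm (Fin m)) (i : Fin j) :
    crossPerm (κ := κ) hK hL τ (Sum.inl (sumEnum hL (Sum.inl i))) = Sum.inl (sumEnum hK (Sum.inl i)) := by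
  simp [crossPerm_apply, crossEquivOf, crossSum]

theorem crossPerm_inl_inr (hK : j + κ = K) (hL : j + l = L) (τ : Equiv.Perm (Fin m)) (i : Fin l) :
    crossPerm (κ := κ) hK hL τ (Sum.inl (sumEnum hL (Sum.inr i))) = Sum.inr (Fin.natAdd m i) := by
  simp [crossPerm_apply, crossEquivOf, crossSum, blockPerm_natAdd]

theorem crossPerm_inr_inl (hK : j + κ = K) (hL : j + l = L) (τ : Equiv.Perm (Fin m)) (i : Fin m) :
    crossPerm (κ := κ) hK hL τ (Sum.inr (Fin.castAdd κ i)) = Sum.inr (Fin.castAdd l (τ i)) := by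
  simp [crossPerm_apply, crossEquivOf, crossSum, blockPerm_castAdd]

theorem crossPerm_inr_inr (hK : j + κ = K) (hL : j + l = L) (τ : Equiv.Perm (Fin m)) (i : Fin κ) :
    crossPerm (κ := κ) hK hL τ (Sum.inr (Fin.natAdd m i)) = Sum.inl (sumEnum hK (Sum.inr i)) := by
  simp [crossPerm_apply, crossEquivOf, crossSum]

/-- The sum over the permutations of the variables `ψ̄` of the products of covariances. -/
def crossSumPairing (G : ι → ι → Torus d ℓ → ℂ) (f : TestFn ι d ℓ (Var ![K, L])) (hK : j + κ = K) (hL : j + l = L)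
    (m : ℕ) : TestFn ι d ℓ (Var ![K, L] ⊕ Var ![m + κ, m + l]) :=
  ∑ τ : Equiv.Perm (Fin m), ((Equiv.Perm.sign τ : ℤ) : ℂ) • pairing G f (crossPerm hK hL τ)

theorem isCk_crossSumPairing (hG : IsCov k G η) {f : TestFn ι d ℓ (Var ![K, L])} (hf : IsCk k f) (hK : j + κ = K)
    (hL : j + l = L) (m : ℕ) : IsCk k (crossSumPairing G f hK hL m) :=
  IsCk.sum _ fun _ _ => (isCk_pairing hG hf _).smul _

/-- The permutation `τ` of arguments `ψ̄` of the kernel is absorbed by `F` with the sign of `τ`,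
leaving `m!` equal terms. -/
theorem ptInt_crossSumPairing (hG : IsCov k G η) {h : Fin 2 → ℝ≥0∞} {F : Elem ι d ℓ 2} (hF : MemG k h F)
    {f : TestFn ι d ℓ (Var ![K, L])} (hf : IsCk k f) (ha : IsAnti f) (hK : j + κ = K)
    (hL : j + l = L) (m : ℕ) :
    (ptInt fun Q : Var ![K, L] → Pt ι d ℓ => F ![m + κ, m + l] fun p =>
      crossSumPairing G f hK hL m (Sum.elim Q p)) =
      (m.factorial : ℂ) * pairInt G F f (crossEquivOf hK hL m) := by
  have h1 : ∀ Q : Var ![K, L] → Pt ι d ℓ, (F ![m + κ, m + l] fun p =>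
      crossSumPairing G f hK hL m (Sum.elim Q p)) = ∑ τ : Equiv.Perm (Fin m), ((Equiv.Perm.sign τ : ℤ) : ℂ) *
        F ![m + κ, m + l] fun p => pairing G f (crossPerm hK hL τ) (Sum.elim Q p) := by
    intro Q
    have h2 := fun τ : Equiv.Perm (Fin m) => (isCk_pairing hG hf (crossPerm hK hL τ)).elim_right Q
    have h3 := fun τ : Equiv.Perm (Fin m) =>
      ((hF.distr ![m + κ, m + l]).map_smul ((Equiv.Perm.sign τ : ℤ) : ℂ) _ (h2 τ)).symm
    simp only [h3]
    rw [← (hF.distr ![m + κ, m + l]).map_sum _ fun τ _ => (h2 τ).smul _]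
    congr 1
    funext p
    simp [crossSumPairing, Finset.sum_apply]
  simp only [h1]
  refine (ptInt_finset_sum _ fun τ _ =>
    ((hF.distr _).isCk_elim (isCk_pairing hG hf (crossPerm hK hL τ))).contTF.const_mul _).trans ?_
  have h4 : ∀ τ : Equiv.Perm (Fin m), (ptInt fun Q : Var ![K, L] → Pt ι d ℓ => ((Equiv.Perm.sign τ : ℤ) : ℂ) *
        F ![m + κ, m + l] fun p => pairing G f (crossPerm hK hL τ) (Sum.elim Q p)) =
      pairInt G F f (crossEquivOf hK hL m) := by
    intro τ
    rw [ptInt_smul]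
    refine (congrArg _ (pairInt_perm hG hF hf ha (crossEquivOf hK hL m) 1 1 1 (blockPerm τ 1))).trans ?_
    rw [signs_permPair, signs_permPair, sign_blockPerm]
    simp only [Equiv.Perm.sign_one, mul_one, Units.val_one, Int.cast_one, one_mul]
    rw [← mul_assoc, ← Int.cast_mul, ← Units.val_mul, Int.units_mul_self]
    simp
  rw [Finset.sum_congr rfl fun τ _ => h4 τ, Finset.sum_const, Finset.card_univ, Fintype.card_perm, Fintype.card_fin,
    nsmul_eq_mul]

theorem le_vec2 (hjK : j ≤ K) (hjL : j ≤ L) : ![j, j] ≤ ![K, L] := by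
  intro s
  fin_cases s
  · exact hjK
  · exact hjL

/-- The covariances split into the pairs `J̄, J`, those joining a source to an argument of `F`, and
those joining two arguments of `F`. The second group is the smearing kernel, and the signed sum over
`τ` of the third is a determinant. -/
theorem crossSumPairing_join (hjK : j ≤ K) (hjL : j ≤ L) (f : TestFn ι d ℓ (Var ![K, L])) (m : ℕ)
    (q : Var ![j, j] → Pt ι d ℓ) (u : Fin (K - j) ⊕ Fin (L - j) → Pt ι d ℓ)
    (p : Var ![m + (K - j), m + (L - j)] → Pt ι d ℓ) :
    crossSumPairing G f (Nat.add_sub_of_le hjK) (Nat.add_sub_of_le hjL) m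
      (Sum.elim (join q fun v => u (varTwo (fun s => ![K, L] s - ![j, j] s) v)) p) =
    (∏ i : Fin j, covPt G (q ⟨1, i⟩) (q ⟨0, i⟩)) *
      (smearKernel (N := ![m, m, K - j, L - j]) G (fun v => p (varPlus ![m, m, K - j, L - j] v)) u *
      detTensor G m (fun s => ![K, L] s - ![j, j] s) (fun p' => f fun v => join q p' v) fun v =>
        Sum.elim (fun v => p (varPlus ![m, m, K - j, L - j] v)) u (mergeVar ![m, m, K - j, L - j] v)) := by
  let Q : Var ![K, L] → Pt ι d ℓ := join q fun v => u (varTwo (fun s => ![K, L] s - ![j, j] s) v)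
  have hle := le_vec2 hjK hjL
  have e0 : ∀ i : Fin j, Q ⟨0, sumEnum (Nat.add_sub_of_le hjK) (Sum.inl i)⟩ = q ⟨0, i⟩ :=
    fun i => join_inl hle q _ 0 i
  have e1 : ∀ i : Fin j, Q ⟨1, sumEnum (Nat.add_sub_of_le hjL) (Sum.inl i)⟩ = q ⟨1, i⟩ :=
    fun i => join_inl hle q _ 1 i
  have e2 : ∀ i : Fin (K - j), Q ⟨0, sumEnum (Nat.add_sub_of_le hjK) (Sum.inr i)⟩ = u (Sum.inl i) :=
    fun i => join_inr hle q _ 0 i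
  have e3 : ∀ i : Fin (L - j), Q ⟨1, sumEnum (Nat.add_sub_of_le hjL) (Sum.inr i)⟩ = u (Sum.inr i) :=
    fun i => join_inr hle q _ 1 i
  have hpair : ∀ τ : Equiv.Perm (Fin m),
      pairing G f (crossPerm (Nat.add_sub_of_le hjK) (Nat.add_sub_of_le hjL) τ) (Sum.elim Q p) =
      (((∏ i : Fin j, covPt G (q ⟨1, i⟩) (q ⟨0, i⟩)) *
        ∏ i : Fin (L - j), covPt G (u (Sum.inr i)) (p ⟨1, Fin.natAdd m i⟩)) *
      ((∏ i : Fin m, covPt G (p ⟨0, Fin.castAdd (K - j) i⟩) (p ⟨1, Fin.castAdd (L - j) (τ i)⟩)) *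
        ∏ i : Fin (K - j), covPt G (p ⟨0, Fin.natAdd m i⟩) (u (Sum.inl i)))) * f Q := by
    intro τ
    unfold pairing
    rw [Fintype.prod_sum_type, ← Equiv.prod_comp (sumEnum (Nat.add_sub_of_le hjL)), ← Equiv.prod_comp finSumFinEquiv,
      Fintype.prod_sum_type, Fintype.prod_sum_type]
    simp only [finSumFinEquiv_apply_left, finSumFinEquiv_apply_right, crossPerm_inl_inl, crossPerm_inl_inr,
      crossPerm_inr_inl, crossPerm_inr_inr, rowVar, colVar, Sum.elim_inl, Sum.elim_inr, e0, e1, e2, e3]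
  have hdet := det_eq_sum_equiv (Equiv.refl (Fin m)) (Equiv.refl (Fin m)) fun i i' =>
    covPt G (p ⟨0, Fin.castAdd (K - j) i⟩) (p ⟨1, Fin.castAdd (L - j) i'⟩)
  have hD : (detTensor G m (fun s => ![K, L] s - ![j, j] s) (fun p' => f fun v => join q p' v) fun v =>
        Sum.elim (fun v => p (varPlus ![m, m, K - j, L - j] v)) u (mergeVar ![m, m, K - j, L - j] v)) =
      (∑ τ : Equiv.Perm (Fin m), ((Equiv.Perm.sign τ : ℤ) : ℂ) *
        ∏ i : Fin m, covPt G (p ⟨0, Fin.castAdd (K - j) i⟩) (p ⟨1, Fin.castAdd (L - j) (τ i)⟩)) * f Q := by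
    refine congrArg₂ (· * ·) hdet (congrArg f (congrArg (join q) (funext fun v => ?_)))
    match v with
    | ⟨0, i⟩ => rfl
    | ⟨1, i⟩ => rfl
  have hK : smearKernel (N := ![m, m, K - j, L - j]) G (fun v => p (varPlus ![m, m, K - j, L - j] v)) u =
      (∏ i : Fin (K - j), covPt G (p ⟨0, Fin.natAdd m i⟩) (u (Sum.inl i))) *
        ∏ i : Fin (L - j), covPt G (u (Sum.inr i)) (p ⟨1, Fin.natAdd m i⟩) := rfl
  rw [hD, hK]
  unfold crossSumPairing
  simp only [Finset.sum_apply, Pi.smul_apply, smul_eq_mul]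
  refine (Finset.sum_congr rfl fun τ _ => congrArg _ (hpair τ)).trans ?_
  rw [Finset.sum_mul, Finset.mul_sum, Finset.mul_sum]
  refine Finset.sum_congr rfl fun τ _ => ?_
  ring

end Translated

section Translated

variable {ι : Type} [Fintype ι] {d k : ℕ} {ℓ : ℝ} [Fact (0 < ℓ)] {G : ι → ι → Torus d ℓ → ℂ} {η : ℝ≥0∞}
  {K L j : ℕ}

/-- Split off the first `j` variables of each of two species. -/
def splitTwo (hjK : j ≤ K) (hjL : j ≤ L) : Var ![K, L] ≃ Var ![j, j] ⊕ (Fin (K - j) ⊕ Fin (L - j)) :=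
  (splitEquiv (le_vec2 hjK hjL)).trans (Equiv.sumCongr (Equiv.refl _) (varTwo fun s => ![K, L] s - ![j, j] s))

theorem sumElim_splitTwo (hjK : j ≤ K) (hjL : j ≤ L) {P : Type} (q : Var ![j, j] → P)
    (u : Fin (K - j) ⊕ Fin (L - j) → P) (v : Var ![K, L]) :
    Sum.elim q u (splitTwo hjK hjL v) = join q (fun v => u (varTwo (fun s => ![K, L] s - ![j, j] s) v)) v := by
  rw [join_eq]
  show Sum.elim q u (Sum.map id (varTwo fun s => ![K, L] s - ![j, j] s) (splitVar ![K, L] ![j, j] v)) = _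
  rcases splitVar ![K, L] ![j, j] v with w | w <;> rfl

theorem IsCk.elim_join (hjK : j ≤ K) (hjL : j ≤ L) {Q : Type} [Fintype Q] [DecidableEq Q]
    {W : TestFn ι d ℓ (Var ![K, L] ⊕ Q)} (hW : IsCk k W) (q : Var ![j, j] → Pt ι d ℓ) :
    IsCk k fun s : (Fin (K - j) ⊕ Fin (L - j)) ⊕ Q → Pt ι d ℓ =>
      W (Sum.elim (join q fun v => s (Sum.inl (varTwo (fun s => ![K, L] s - ![j, j] s) v))) fun v => s (Sum.inr v)) := by
  let e := ((Equiv.sumCongr (splitTwo hjK hjL) (Equiv.refl Q)).trans (Equiv.sumAssoc _ _ _)).trans (Equiv.sumComm _ _)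
  refine (congrArg (IsCk k) (funext fun s => congrArg W (funext fun v => ?_))).mp (hW.fix e.injective q)
  rcases v with v | v
  · refine Eq.trans ?_ (sumElim_splitTwo hjK hjL q (fun v => s (Sum.inl v)) v)
    show Sum.elim s q (e (Sum.inl v)) = _
    rcases h : splitTwo hjK hjL v with w | w <;> simp [e, h]
  · rfl

/-- Source points are integrated in two stages, the `j` contracted pairs and the rest, and `F` is
exchanged with the inner integral. The `m!` terms of the determinant agree, which reduces `1 /
(m!)²` to `1 / m!`. -/
theorem ptInt_gaussTerm_translate (hG : IsCov k G η) {h : Fin 2 → ℝ≥0∞} {F : Elem ι d ℓ 2} (hF : MemG k h F)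
    (hη : η ≠ ⊤) {f : TestFn ι d ℓ (Var ![K, L])} (hf : IsCk k f) (ha : IsAnti f) (hjK : j ≤ K) (hjL : j ≤ L) (m : ℕ) :
    (ptInt fun q : Var ![j, j] → Pt ι d ℓ => (∏ i : Fin j, covPt G (q ⟨1, i⟩) (q ⟨0, i⟩)) *
      gaussTerm G (translate G F) (fun s => ![K, L] s - ![j, j] s) (fun p' => f fun v => join q p' v) m) =
    (-1) ^ (m.choose 2 + (K - j) * m) / m.factorial *
      pairInt G F f (crossEquivOf (Nat.add_sub_of_le hjK) (Nat.add_sub_of_le hjL) m) := by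
  set W := crossSumPairing G f (Nat.add_sub_of_le hjK) (Nat.add_sub_of_le hjL) m with hWdef
  have hW : IsCk k W := isCk_crossSumPairing hG hf _ _ m
  have hFd := hF.distr ![m + (K - j), m + (L - j)]
  have h1 : ∀ q : Var ![j, j] → Pt ι d ℓ, (∏ i : Fin j, covPt G (q ⟨1, i⟩) (q ⟨0, i⟩)) *
      gaussTerm G (translate G F) (fun s => ![K, L] s - ![j, j] s) (fun p' => f fun v => join q p' v) m =
      (-1) ^ (m.choose 2 + (K - j) * m) / (m.factorial * m.factorial) *
      ptInt fun u : Fin (K - j) ⊕ Fin (L - j) → Pt ι d ℓ => F ![m + (K - j), m + (L - j)] fun p =>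
        W (Sum.elim (join q fun v => u (varTwo (fun s => ![K, L] s - ![j, j] s) v)) p) := by
    intro q
    have hD := ckB_detTensor hG m (hf.join_right q).ckB
    have hDt : η ^ m * η ^ m * ckNorm k (fun p' => f fun v => join q p' v) ≠ ⊤ :=
      ENNReal.mul_ne_top (ENNReal.mul_ne_top (ENNReal.pow_ne_top hη) (ENNReal.pow_ne_top hη))
        (hf.join_right q).ckNorm_lt_top.ne
    have hS := (ckB_smear hG.cont hDt hD).isCk.comp_inj (varPlus_injective ![m, m, K - j, L - j])
    have h2 := hFd.map_smul (∏ i : Fin j, covPt G (q ⟨1, i⟩) (q ⟨0, i⟩)) _ hS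
    have h3 := hFd.map_ptInt (hW.elim_join hjK hjL q)
    have h4 : gaussTerm G (translate G F) (fun s => ![K, L] s - ![j, j] s) (fun p' => f fun v => join q p' v) m =
        (-1) ^ (m * (m - 1) / 2) / ((m.factorial : ℂ) * m.factorial) * ((-1) ^ ((K - j) * m) *
          F ![m + (K - j), m + (L - j)] fun p => smear (N := ![m, m, K - j, L - j]) G
            (detTensor G m (fun s => ![K, L] s - ![j, j] s) (fun p' => f fun v => join q p' v))
            fun v => p (varPlus ![m, m, K - j, L - j] v)) := rfl
    have h5 : ((∏ i : Fin j, covPt G (q ⟨1, i⟩) (q ⟨0, i⟩)) • fun p : Var ![m + (K - j), m + (L - j)] → Pt ι d ℓ =>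
        smear (N := ![m, m, K - j, L - j]) G
            (detTensor G m (fun s => ![K, L] s - ![j, j] s) (fun p' => f fun v => join q p' v))
            fun v => p (varPlus ![m, m, K - j, L - j] v)) = fun p => ptInt fun u =>
        W (Sum.elim (join q fun v => u (varTwo (fun s => ![K, L] s - ![j, j] s) v)) p) := by
      funext p
      have h8 := smear_eq_ptInt (N := ![m, m, K - j, L - j]) hG.cont hD.isCk.contTF
        fun v => p (varPlus ![m, m, K - j, L - j] v)
      refine (congrArg (fun t => (∏ i : Fin j, covPt G (q ⟨1, i⟩) (q ⟨0, i⟩)) * t) h8).trans ?_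
      refine (ptInt_smul _ _).symm.trans (congrArg ptInt (funext fun u => ?_))
      exact (crossSumPairing_join hjK hjL f m q u p).symm
    have h6 : ((∏ i : Fin j, covPt G (q ⟨1, i⟩) (q ⟨0, i⟩)) * F ![m + (K - j), m + (L - j)] fun p =>
          smear (N := ![m, m, K - j, L - j]) G
            (detTensor G m (fun s => ![K, L] s - ![j, j] s) (fun p' => f fun v => join q p' v))
            fun v => p (varPlus ![m, m, K - j, L - j] v)) =
        ptInt fun u : Fin (K - j) ⊕ Fin (L - j) → Pt ι d ℓ => F ![m + (K - j), m + (L - j)] fun p =>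
        W (Sum.elim (join q fun v => u (varTwo (fun s => ![K, L] s - ![j, j] s) v)) p) :=
      h2.symm.trans ((congrArg (F ![m + (K - j), m + (L - j)]) h5).trans h3)
    rw [← h6, h4, Nat.choose_two_right, pow_add]
    ring
  have h7 := ptInt_split (splitTwo hjK hjL) (hFd.isCk_elim hW).contTF
  simp only [sumElim_splitTwo] at h7
  rw [ptInt_crossSumPairing hG hF hf ha] at h7
  simp only [h1]
  rw [ptInt_smul]
  refine (congrArg _ h7.symm).trans ?_
  have hm : (m.factorial : ℂ) ≠ 0 := Nat.cast_ne_zero.mpr m.factorial_ne_zero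
  field_simp

end Translated

/-! ### The identity -/

/-- The bounds are uniform in the points and the volume is finite, so summability of `B` permits the
exchange. -/
theorem hasSum_ptInt {ι : Type} [Fintype ι] {d : ℕ} {ℓ : ℝ} [Fact (0 < ℓ)] {V : Type} [Fintype V] [DecidableEq V]
    {g : ℕ → TestFn ι d ℓ V} (hg : ∀ n, ContTF (g n)) {B : ℕ → ℝ≥0∞} (hB : ∀ n p, ‖g n p‖ₑ ≤ B n)
    (hs : ∑' n, B n ≠ ⊤) : HasSum (fun n => ptInt (g n)) (ptInt fun p => ∑' n, g n p) := by
  unfold ptInt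
  refine hasSum_sum fun a _ => hasSum_integral_of_summable_integral_norm
    (fun n => integrable_torus _ (hg n a)) ?_
  have hBn : ∀ n, B n ≠ ⊤ := fun n => ENNReal.ne_top_of_tsum_ne_top hs n
  refine Summable.of_nonneg_of_le (fun n => integral_nonneg fun x => norm_nonneg _) (fun n => ?_)
    ((ENNReal.summable_toReal hs).mul_right (volume.real (Set.univ : Set (V → Torus d ℓ))))
  have h1 : ∀ x, ‖comp (g n) a x‖ ≤ (B n).toReal := fun x => by
    have := ENNReal.toReal_mono (hBn n) (hB n fun v => (a v, x v))
    rwa [toReal_enorm] at this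
  refine (integral_mono (integrable_torus _ (hg n a)).norm (integrable_const (B n).toReal) h1).trans (le_of_eq ?_)
  rw [integral_const, smul_eq_mul, mul_comm]

theorem add_choose_two (a b : ℕ) : (a + b).choose 2 = a.choose 2 + b.choose 2 + a * b := by
  induction b with
  | zero => simp
  | succ b ih =>
    have h1 : (a + (b + 1)).choose 2 = (a + b) + (a + b).choose 2 := by
      rw [← add_assoc, Nat.choose_succ_succ' (a + b) 1, Nat.choose_one_right]
    have h2 : (b + 1).choose 2 = b + b.choose 2 := by rw [Nat.choose_succ_succ' b 1, Nat.choose_one_right]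
    rw [h1, h2, ih]
    ring

theorem neg_one_pow_eq_of_even_add {a b : ℕ} (h : Even (a + b)) : (-1 : ℂ) ^ a = (-1) ^ b :=
  neg_one_pow_congr (Nat.even_add.mp h)

theorem sourcedSign_mul {K L j κ l m : ℕ} (hK : j + κ = K) (hL : j + l = L) :
    sourcedSign (m + κ + L) K L (m + κ) (m + l) * (-1) ^ (l * m + l * κ + m * κ) =
      (-1) ^ (κ * j + (j + 1).choose 2 + (m.choose 2 + κ * m)) := by
  subst hK hL
  rw [sourcedSign, ← pow_add]
  refine neg_one_pow_eq_of_even_add ?_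
  simp only [add_choose_two, Nat.choose_eq_zero_of_lt (show 1 < 2 by norm_num)]
  -- After expansion all terms occur an even number of times except for `l * (l + 1)`, which is
  -- even.
  obtain ⟨r, hr⟩ := Nat.even_mul_succ_self l
  refine ⟨m.choose 2 + κ.choose 2 + 2 * j.choose 2 + l.choose 2 +
    2 * (m * κ + m * j + m * l + κ * j + κ * l + j * l) + j + r, ?_⟩
  linear_combination hr

/-- The factorials match because `(m + κ)! = (m + κ).choose κ * m! * κ!` and `K! = K.choose j * κ! *
j!`. -/
theorem sourced_coeff {K L j κ l m : ℕ} (hK : j + κ = K) (hL : j + l = L) :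
    sourcedSign (m + κ + L) K L (m + κ) (m + l) / ((m + κ).factorial * (m + l).factorial) *
      ((L.choose j * (m + κ).choose κ * (K.factorial * (m + l).factorial) : ℕ) : ℂ) *
        (-1) ^ (l * m + l * κ + m * κ) =
      (-1) ^ (κ * j) * (K.choose j * L.choose j) * ((-1) ^ ((j + 1).choose 2) * j.factorial) *
        ((-1) ^ (m.choose 2 + κ * m) / m.factorial) := by
  have h1 : ((m + κ).choose κ * m.factorial * κ.factorial : ℂ) = (m + κ).factorial := by
    have h := Nat.choose_mul_factorial_mul_factorial (Nat.le_add_left κ m)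
    rw [Nat.add_sub_cancel, mul_right_comm] at h
    exact_mod_cast h
  have h2 : (K.choose j * κ.factorial * j.factorial : ℂ) = K.factorial := by
    subst hK
    have h := Nat.choose_mul_factorial_mul_factorial (Nat.le_add_right j κ)
    rw [Nat.add_sub_cancel_left, mul_right_comm] at h
    exact_mod_cast h
  have hs := sourcedSign_mul (m := m) hK hL
  have n1 : (m.factorial : ℂ) ≠ 0 := Nat.cast_ne_zero.mpr m.factorial_ne_zero
  have n2 : (κ.factorial : ℂ) ≠ 0 := Nat.cast_ne_zero.mpr κ.factorial_ne_zero
  have n3 : ((m + l).factorial : ℂ) ≠ 0 := Nat.cast_ne_zero.mpr (m + l).factorial_ne_zero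
  have n4 : ((m + κ).factorial : ℂ) ≠ 0 := Nat.cast_ne_zero.mpr (m + κ).factorial_ne_zero
  push_cast
  calc _ = (sourcedSign (m + κ + L) K L (m + κ) (m + l) * (-1) ^ (l * m + l * κ + m * κ)) * L.choose j *
        ((m + κ).choose κ * K.factorial / (m + κ).factorial) := by field_simp
    _ = (sourcedSign (m + κ + L) K L (m + κ) (m + l) * (-1) ^ (l * m + l * κ + m * κ)) * L.choose j *
        (K.choose j * j.factorial / m.factorial) := by
      congr 1
      rw [div_eq_div_iff n4 n1]
      rw [← h1, ← h2]
      ring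
    _ = _ := by
      rw [hs, pow_add, pow_add]
      ring

theorem IsCk.ckNorm_join_le {ι : Type} [Fintype ι] {d k q : ℕ} {ℓ : ℝ} [Fact (0 < ℓ)] {N n : Fin q → ℕ}
    {f : TestFn ι d ℓ (Var N)} (hf : IsCk k f) (p : Var n → Pt ι d ℓ) :
    ckNorm k (fun p' : Var (fun s => N s - n s) → Pt ι d ℓ => f fun v => join p p' v) ≤ ckNorm k f := by
  have h := hf.ckB.fix (e := fun v => (splitVar N n v).swap)
    (Sum.swap_leftInverse.injective.comp splitVar_injective) p
  refine le_trans (le_of_eq ?_) h.ckNorm_le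
  refine congrArg (ckNorm k) (funext fun p' => congrArg f (funext fun v => ?_))
  rw [join_eq]
  rcases splitVar N n v with u | u <;> rfl

section Identity

variable {ι : Type} [Fintype ι] {d k : ℕ} {ℓ : ℝ} [Fact (0 < ℓ)] {G : ι → ι → Torus d ℓ → ℂ} {η : ℝ≥0∞}
  {K L : ℕ}

/-- The part of the `n`-th term of `∫ e^{⟨J̄, ψ⟩ + ⟨ψ̄, J⟩} F dμ_G` in which `j` of the fields `J̄` are contracted with
fields `J`. -/
def sourcedTerm (G : ι → ι → Torus d ℓ → ℂ) (F : Elem ι d ℓ 2) (f : TestFn ι d ℓ (Var ![K, L])) (j n : ℕ) : ℂ :=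
  if L ≤ n ∧ K ≤ n then
    sourcedSign n K L (n - L) (n - K) / ((n - L).factorial * (n - K).factorial) *
      ((L.choose j * (n - L).choose (K - j) * (K.factorial * (n - K).factorial) : ℕ) : ℂ) *
        pairVal G F f (n - L) (n - K) j
  else 0

theorem gaussTerm_sourced_eq_sum (hG : IsCov k G η) {h h' : ℝ≥0∞} {F : Elem ι d ℓ 2} (hF : MemG k ![h, h] F)
    (hh : h ≠ 0) (hht : h ≠ ⊤) (hh' : h' ≠ 0) (hht' : h' ≠ ⊤) {f : TestFn ι d ℓ (Var ![K, L])} (hf : IsCk k f)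
    (ha : IsAnti f) (n : ℕ) :
    gaussTerm G (sourced F) ![K, L] f n = ∑ j ∈ Finset.range (K + 1), sourcedTerm G F f j n := by
  by_cases hn : L ≤ n ∧ K ≤ n
  · rw [gaussTerm_sourced hG hF hh hht hh' hht' (Nat.add_sub_of_le hn.1) (Nat.add_sub_of_le hn.2) hf ha]
    simp only [signedPairInt_eq_pairVal hG hF hf ha, sourcedTerm, if_pos hn]
    rw [sum_leftCount ((Nat.add_sub_of_le hn.1).trans (Nat.add_sub_of_le hn.2).symm), Finset.mul_sum]
    exact Finset.sum_congr rfl fun j _ => (mul_assoc _ _ _).symm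
  · have h1 := sourced_eq (n := n) hG hF hh hht hh' hht' hf ha
    rw [if_neg hn] at h1
    simp only [sourcedTerm, if_neg hn, Finset.sum_const_zero]
    exact (congrArg _ h1).trans (mul_zero _)

theorem sourcedTerm_add (hG : IsCov k G η) {h : Fin 2 → ℝ≥0∞} {F : Elem ι d ℓ 2} (hF : MemG k h F)
    {f : TestFn ι d ℓ (Var ![K, L])} (hf : IsCk k f) (ha : IsAnti f) {j : ℕ} (hjK : j ≤ K) (hjL : j ≤ L) (m : ℕ) :
    sourcedTerm G F f j (m + (K - j) + L) =
      (-1) ^ ((K - j) * j) * (K.choose j * L.choose j) * ((-1) ^ ((j + 1).choose 2) * j.factorial) *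
        ((-1) ^ (m.choose 2 + (K - j) * m) / m.factorial *
          pairInt G F f (crossEquivOf (Nat.add_sub_of_le hjK) (Nat.add_sub_of_le hjL) m)) := by
  have e1 : m + (K - j) + L - L = m + (K - j) := by omega
  have e2 : m + (K - j) + L - K = m + (L - j) := by omega
  have h1 := signedPairInt_eq_pairVal hG hF hf ha (crossEquivOf (Nat.add_sub_of_le hjK) (Nat.add_sub_of_le hjL) m)
  rw [leftCount_crossEquivOf, signedPairInt_crossEquivOf] at h1
  rw [sourcedTerm, if_pos ⟨by omega, by omega⟩, e1, e2, ← h1, ← mul_assoc,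
    sourced_coeff (Nat.add_sub_of_le hjK) (Nat.add_sub_of_le hjL), mul_assoc]

/-- One of the two binomial coefficients vanishes, or the degree is too small to hold the sources.
-/
theorem sourcedTerm_eq_zero_of_lt {F : Elem ι d ℓ 2} {f : TestFn ι d ℓ (Var ![K, L])} {j n : ℕ}
    (h : L < j ∨ n < K - j + L) : sourcedTerm G F f j n = 0 := by
  unfold sourcedTerm
  split_ifs with hn
  · rcases h with h | h
    · simp [Nat.choose_eq_zero_of_lt h]
    · simp [Nat.choose_eq_zero_of_lt (show n - L < K - j by omega)]
  · rfl

/-- The nonzero terms are those with `n = m + (K - j) + L`, where `m` is the size of the remaining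
determinant. They match the Gaussian series on the right side, summed under the integral over the
`j` contracted pairs. -/
theorem hasSum_sourcedTerm (hG : IsCov k G η) {h h' : ℝ≥0∞} {F : Elem ι d ℓ 2} (hF : MemG k ![h, h] F)
    (hη : η ≠ ⊤) (hh' : h' ≠ 0) (hT : MemG k ![η, η, h', h'] (translate G F)) {f : TestFn ι d ℓ (Var ![K, L])}
    (hf : IsCk k f) (ha : IsAnti f) {j : ℕ} (hjK : j ≤ K) (hjL : j ≤ L) :
    HasSum (sourcedTerm G F f j) ((-1) ^ ((K - j) * j) * (K.choose j * L.choose j) *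
      ((-1) ^ ((j + 1).choose 2) * j.factorial *
        ptInt fun q : Var ![j, j] → Pt ι d ℓ => (∏ i : Fin j, covPt G (q ⟨1, i⟩) (q ⟨0, i⟩)) *
          gaussInt G (translate G F) (fun s => ![K, L] s - ![j, j] s) fun p' => f fun v => join q p' v)) := by
  have hinj : Function.Injective fun m => m + (K - j) + L := fun a b hab => by
    simp only at hab
    omega
  refine (hinj.hasSum_iff fun n hn => sourcedTerm_eq_zero_of_lt (Or.inr ?_)).mp ?_
  · by_contra hlt
    exact hn ⟨n - (K - j + L), by simp only; omega⟩
  have hcov : ContTF fun q : Var ![j, j] → Pt ι d ℓ => ∏ i : Fin j, covPt G (q ⟨1, i⟩) (q ⟨0, i⟩) :=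
    contTF_prod _ fun i _ => contTF_covPt hG.cont _ _
  obtain ⟨C, hC⟩ := hcov.bounded
  have hd := fun m => (isDistr_gaussTerm hG hη hT.distr m fun s => ![K, L] s - ![j, j] s).1
  have hB : ∀ (m : ℕ) (q : Var ![j, j] → Pt ι d ℓ), ‖(∏ i : Fin j, covPt G (q ⟨1, i⟩) (q ⟨0, i⟩)) *
      gaussTerm G (translate G F) (fun s => ![K, L] s - ![j, j] s) (fun p' => f fun v => join q p' v) m‖ₑ ≤
      C * (dualNorm k (fun f => gaussTerm G (translate G F) (fun s => ![K, L] s - ![j, j] s) f m) * ckNorm k f) := by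
    intro m q
    rw [enorm_mul]
    refine mul_le_mul' (hC q) (((hd m).enorm_le (hf.join_right q)).trans ?_)
    gcongr
    exact hf.ckNorm_join_le q
  have hS := hasSum_ptInt (fun m => hcov.mul ((hd m).isCk_join hf).contTF) hB (by
    rw [ENNReal.tsum_mul_left, ENNReal.tsum_mul_right]
    exact ENNReal.mul_ne_top ENNReal.coe_ne_top (ENNReal.mul_ne_top (tsum_dualNorm_gaussTerm hG hη hh' hT _)
      hf.ckNorm_lt_top.ne))
  simp only [ptInt_gaussTerm_translate hG hF hη hf ha hjK hjL, tsum_mul_left] at hS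
  have hS' := hS.mul_left ((-1) ^ ((K - j) * j) * (K.choose j * L.choose j) *
    ((-1) ^ ((j + 1).choose 2) * (j.factorial : ℂ)))
  rw [mul_assoc (_ * _)] at hS'
  exact hS'.congr_fun fun m => sourcedTerm_add hG hF hf ha hjK hjL m

/-- The kernel `expCov` lives in the degrees `(j, j)`. The sign `(-1) ^ ((K - j) * j)` moves the
remaining fields `J` past the `j` fields `J̄` of the exponential. -/
theorem exp_cov_mul_eq_sum (hG : IsCov k G η) {h : Fin 2 → ℝ≥0∞} {H : Elem ι d ℓ 2} (hH : MemG k h H)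
    (hE : ∀ N, IsDistr k (exp (pairJbarGJ G) N)) {f : TestFn ι d ℓ (Var ![K, L])} (hf : IsCk k f) (ha : IsAnti f) :
    mul (exp (pairJbarGJ G)) H ![K, L] f = ∑ j ∈ Finset.range (K + 1) with j ≤ L,
      (-1) ^ ((K - j) * j) * (K.choose j * L.choose j) * ((-1) ^ ((j + 1).choose 2) * j.factorial *
        ptInt fun q : Var ![j, j] → Pt ι d ℓ => (∏ i : Fin j, covPt G (q ⟨1, i⟩) (q ⟨0, i⟩)) *
          H (fun s => ![K, L] s - ![j, j] s) fun p' => f fun v => join q p' v) := by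
  rw [mul_of_isAnti hE hH.distr hf ha]
  have hinj : Function.Injective fun j : ℕ => ![j, j] := fun a b hab => congrFun hab 0
  have h1 : ∀ n ∈ Finset.Icc 0 ![K, L], (exp (pairJbarGJ G) n fun p => H (fun s => ![K, L] s - n s) fun p' =>
      f fun v => join p p' v) = expCov G n fun p => H (fun s => ![K, L] s - n s) fun p' => f fun v => join p p' v :=
    fun n hn => exp_cov_eq hG.cont ((hH.distr _).isCk_join hf)
      (ha.pair_left (Finset.mem_Icc.mp hn).2 (hH.distr _) hf)
  rw [Finset.sum_congr rfl fun n hn => congrArg _ (h1 n hn)]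
  refine Eq.trans (Finset.sum_subset (s₁ := ((Finset.range (K + 1)).filter (· ≤ L)).image fun j => ![j, j])
    ?_ ?_).symm ?_
  · intro n hn
    obtain ⟨j, hj, rfl⟩ := Finset.mem_image.mp hn
    rw [Finset.mem_filter, Finset.mem_range] at hj
    exact Finset.mem_Icc.mpr ⟨fun s => Nat.zero_le _, le_vec2 (by omega) hj.2⟩
  · intro n hn hn'
    rw [expCov_of_not, mul_zero]
    intro h01
    have hle := (Finset.mem_Icc.mp hn).2
    have h0 : n 0 ≤ K := hle 0
    have h1 : n 1 ≤ L := hle 1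
    refine hn' (Finset.mem_image.mpr ⟨n 0, Finset.mem_filter.mpr ⟨Finset.mem_range.mpr (by omega), h01 ▸ h1⟩, ?_⟩)
    conv_rhs => rw [← vec2_eta n, ← h01]
  · rw [Finset.sum_image fun a _ b _ hab => hinj hab]
    refine Finset.sum_congr rfl fun j _ => ?_
    rw [expCov_eq]
    congr 2
    · simp [reorderSign]
    · simp

/-- For each of the finitely many `j` the series over `n` is summed separately; those with `j > L`
vanish. -/
theorem gaussInt_sourced_eq (hG : IsCov k G η) {h h' : ℝ≥0∞} {F : Elem ι d ℓ 2} (hF : MemG k ![h, h] F)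
    (hη : η ≠ ⊤) (hh : h ≠ 0) (hht : h ≠ ⊤) (hh' : h' ≠ 0) (hht' : h' ≠ ⊤)
    (hT : MemG k ![η, η, h', h'] (translate G F)) (hE : ∀ N, IsDistr k (exp (pairJbarGJ G) N))
    {N : Fin 2 → ℕ} {f : TestFn ι d ℓ (Var N)} (hf : IsCk k f) (ha : IsAnti f) :
    gaussInt G (sourced F) N f = mul (exp (pairJbarGJ G)) (gaussInt G (translate G F)) N f := by
  obtain ⟨K, L, rfl⟩ : ∃ K L, N = ![K, L] := ⟨N 0, N 1, (vec2_eta N).symm⟩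
  rw [exp_cov_mul_eq_sum hG (hT.gaussInt hG hη hh') hE hf ha]
  refine HasSum.tsum_eq ?_
  refine HasSum.congr_fun ?_ fun n => gaussTerm_sourced_eq_sum hG hF hh hht hh' hht' hf ha n
  rw [Finset.sum_filter]
  refine hasSum_sum fun j hj => ?_
  rw [Finset.mem_range] at hj
  split_ifs with hjL
  · exact hasSum_sourcedTerm hG hF hη hh' hT hf ha (by omega) hjL
  · exact hasSum_zero.congr_fun fun n => sourcedTerm_eq_zero_of_lt (Or.inl (by omega))

end Identity

end Grassmann

end

open MeasureTheory in
open scoped ENNReal NNReal in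
theorem mainTheorem2 {ι : Type} [Fintype ι] (d k : ℕ) (ℓ : ℝ) [Fact (0 < ℓ)]
    (G : ι → ι → Grassmann.Torus d ℓ → ℂ)
    (G₁ G₂ : ι → ι → Grassmann.Torus d ℓ →
      Lp ℂ 2 (volume : Measure (Grassmann.Torus d ℓ)))
    (hG : ∀ a b, Grassmann.SmoothT (G a b))
    (hG₁ : ∀ a c, Grassmann.IsCkL2 k (G₁ a c))
    (hG₂ : ∀ c b, Grassmann.IsCkL2 k (G₂ c b))
    (hfac : ∀ a b x y, G a b (x - y) = ∑ c, ∫ z, G₁ a c x z * G₂ c b y z)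
    (h h' : ℝ≥0) (hh' : 0 < h')
    (hlt : Grassmann.covH k G₁ G₂ + Grassmann.covNorm G * h' < h)
    (F : Grassmann.Elem ι d ℓ 2) (hF : Grassmann.MemG k ![h, h] F) :
    -- the integrands are in the domain of the integral
    Grassmann.MemG k ![h, h, h', h'] (Grassmann.sourced F) ∧
    Grassmann.MemG k ![Grassmann.covH k G₁ G₂, Grassmann.covH k G₁ G₂, h', h']
      (Grassmann.translate G F) ∧
    Grassmann.GaussIntegrable k G (Grassmann.sourced F) ∧
    Grassmann.GaussIntegrable k G (Grassmann.translate G F) ∧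
    -- the integrals and both sides are in the algebra generated by the source fields
    Grassmann.MemG k ![h', h'] (Grassmann.gaussInt G (Grassmann.sourced F)) ∧
    Grassmann.MemG k ![h', h'] (Grassmann.gaussInt G (Grassmann.translate G F)) ∧
    Grassmann.MemG k ![h', h'] (Grassmann.exp (Grassmann.pairJbarGJ G)) ∧
    -- the identity
    Grassmann.SameElem k (Grassmann.gaussInt G (Grassmann.sourced F))
      (Grassmann.mul (Grassmann.exp (Grassmann.pairJbarGJ G))
        (Grassmann.gaussInt G (Grassmann.translate G F))) := by
  have hcov := Grassmann.isCov_of_factorization hG₁ hG₂ hfac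
  have hη : Grassmann.covH k G₁ G₂ ≠ ⊤ := ((le_self_add.trans_lt hlt).trans_le le_top).ne
  have hh'0 : (h' : ℝ≥0∞) ≠ 0 := ENNReal.coe_ne_zero.mpr hh'.ne'
  have hh0 : (h : ℝ≥0∞) ≠ 0 := (bot_le.trans_lt hlt).ne'
  -- As `h'` is positive, an infinite `‖G‖` would make the left side of `hlt` infinite.
  have hGn : Grassmann.covNorm G ≠ ⊤ := by
    intro htop
    rw [htop, ENNReal.top_mul hh'0, add_top] at hlt
    exact not_top_lt hlt
  have hw0 : ∀ s, (![h, h, h', h'] : Fin 4 → ℝ≥0∞) s ≠ 0 := by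
    intro s
    fin_cases s <;> assumption
  have hwt : ∀ s, (![h, h, h', h'] : Fin 4 → ℝ≥0∞) s ≠ ⊤ := by
    intro s
    fin_cases s <;> exact ENNReal.coe_ne_top
  have hv0 : ∀ s, (![h', h'] : Fin 2 → ℝ≥0∞) s ≠ 0 := by
    intro s
    fin_cases s <;> assumption
  have hvt : ∀ s, (![h', h'] : Fin 2 → ℝ≥0∞) s ≠ ⊤ := by
    intro s
    fin_cases s <;> exact ENNReal.coe_ne_top
  have hS : Grassmann.MemG k ![h, h, h', h'] (Grassmann.sourced F) :=
    (Grassmann.MemG.exp hw0 ((Grassmann.memG_pairJbarPsi hwt).add (Grassmann.memG_pairPsibarJ hwt))).mul hF.embed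
  -- The Gaussian integral is estimated with the weight `h(G) < h` for `ψ, ψ̄`.
  have hS' : Grassmann.MemG k ![Grassmann.covH k G₁ G₂, Grassmann.covH k G₁ G₂, h', h'] (Grassmann.sourced F) := by
    refine hS.mono fun s => ?_
    have hle : Grassmann.covH k G₁ G₂ ≤ h := (le_self_add.trans_lt hlt).le
    fin_cases s
    · exact hle
    · exact hle
    · exact le_rfl
    · exact le_rfl
  have hT : Grassmann.MemG k ![Grassmann.covH k G₁ G₂, Grassmann.covH k G₁ G₂, h', h'] (Grassmann.translate G F) :=
    Grassmann.MemG.translate hcov.cont hGn hlt.le hF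
  have hE : Grassmann.MemG k ![h', h'] (Grassmann.exp (Grassmann.pairJbarGJ G)) :=
    Grassmann.MemG.exp hv0 (Grassmann.memG_pairJbarGJ hvt hcov.cont)
  have hIS := hS'.gaussInt hcov hη hh'0
  have hIT := hT.gaussInt hcov hη hh'0
  exact ⟨hS, hT, hS'.gaussIntegrable hcov hη hh'0, hT.gaussIntegrable hcov hη hh'0, hIS, hIT, hE,
    Grassmann.sameElem_of_isAnti hIS (hE.mul hIT) fun N f hf ha =>
      Grassmann.gaussInt_sourced_eq hcov hF hη hh0 ENNReal.coe_ne_top hh'0 ENNReal.coe_ne_top hT hE.distr hf ha⟩
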